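/- Let $f:[0,1]\to(0,\infty)$ be a $C^2$ function with $f(0)=f(1)$ and $f'(0)=f'(1)$ (one-sided derivatives), let $c>0$, and let $S=\{(x,y): 0\le x\le 1,\ 0\le y\le f(x)\}$. For each $n$ let $N_n$ be a Poisson point process on $\mathbb R^2$ whose intensity measure is $nc$ times the Lebesgue measure restricted to $S$. Given integers $k_n$ and $b_n\to\infty$, let $I_{n,1},\dots,I_{n,k_n}$ be the partition of $[0,1]$ into $k_n$ consecutive intervals of length $1/k_n$ and put $D_{n,r}=\{(x,y)\in S: x\in I_{n,r}\}$. Let $N_{n,r}$ be the number of points of the process in $D_{n,r}$, and let $Y^*_{n,r}$ be the largest ordinate of these points, with $Y^*_{n,r}=0$ if $N_{n,r}=0$. Let $e_0=1$, $e_{2k-1}(x)=\sqrt2\cos(2k\pi x)$, $e_{2k}(x)=\sqrt2\sin(2k\pi x)$ ($k\ge1$) be the trigonometric basis of $L^2([0,1])$, let $K_n(x,t)=\sum_{j=0}^{b_n}e_j(x)e_j(t)$ be the associated Dirichlet kernel, and let $$\widehat f_n(x)=\sum_{r=1}^{k_n}\Big(\int_{I_{n,r}}K_n(x,t)\,dt\Big)\Big(1+\frac1{N_{n,r}}\Big)Y^*_{n,r},$$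 where a summand with $N_{n,r}=0$ is $0$. Consider the conditions (i) $n^{-1}k_n\log n\to0$; (ii) $n^{-1}k_n^2\to\infty$; (iii) $(b_n\log b_n)^{-1}k_n\to\infty$; (iv) $n\,k_n^{-1/2}b_n^{-3/2}\to0$. Let $x_1,\dots,x_p\in[0,1]$ be pairwise distinct points which do not include both $0$ and $1$. (a) If (i)–(iv) hold then, as $n\to\infty$, the random vector $\big(v_n c\,(\widehat f_n(x_j)-f(x_j))\big)_{1\le j\le p}$ with $v_n=n(b_nk_n)^{-1/2}$ converges in distribution to the centered Gaussian law $N(0,I_p)$, where $I_p$ is the $p\times p$ identity matrix. (b) For example, let $u_n\to\infty$ slowly enough that $n^{-1/2}(\log n)^2u_n^2\to0$, and choose integers $b_n\sim n^{1/2}$ and $k_n\sim n^{1/2}\log(n)\,u_n^2$. Then $b_n\to\infty$ and (i)–(iv) hold, $n(b_nk_n)^{-1/2}\sim n^{1/2}(\log n)^{-1/2}u_n^{-1}$, and the convergence in (a) holds with $v_n=n^{1/2}(\log n)^{-1/2}u_n^{-1}$. -/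

import Mathlib

open MeasureTheory ProbabilityTheory Filter Topology

noncomputable section

namespace BoundaryEstimation

open Classical in
/-- Number of points (with multiplicity) of the finite configuration `z` lying in `D`. -/
def count {X : Type*} (z : Multiset X) (D : Set X) : ℕ :=
  (z.filter (fun a => a ∈ D)).card

/-- `N` is a Poisson point process on `X` with (finite) intensity measure `μ`, given as a random
finite configuration of points: every count is a random variable, the count of `D` is Poisson
distributed with mean `μ D`, and the counts of pairwise disjoint sets are independent. -/
structure IsPoissonProcess {Ω X : Type*} [MeasurableSpace Ω] [MeasurableSpace X]
    (P : Measure Ω) (μ : Measure X) (N : Ω → Multiset X) : Prop where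
  measurable_count : ∀ D : Set X, MeasurableSet D → Measurable (fun ω => count (N ω) D)
  law_count : ∀ D : Set X, MeasurableSet D → μ D ≠ ⊤ →
    P.map (fun ω => count (N ω) D) = poissonMeasure (μ D).toNNReal
  indep_count : ∀ (m : ℕ) (D : Fin m → Set X), (∀ i, MeasurableSet (D i)) →
    Pairwise (fun i j => Disjoint (D i) (D j)) →
    iIndepFun (fun i ω => count (N ω) (D i)) P

/-- The set `S = {(x, y) : x ∈ [0, 1], 0 ≤ y ≤ f x}`. -/
def subgraph (f : ℝ → ℝ) : Set (ℝ × ℝ) :=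
  {q | q.1 ∈ Set.Icc (0 : ℝ) 1 ∧ 0 ≤ q.2 ∧ q.2 ≤ f q.1}

/-- The intensity measure `n c (ν ⊗ λ) 1_S`, with `ν` the Lebesgue measure on `[0, 1]`. -/
def intensity (f : ℝ → ℝ) (c : ℝ) (n : ℕ) : Measure (ℝ × ℝ) :=
  ENNReal.ofReal ((n : ℝ) * c) • (volume : Measure (ℝ × ℝ)).restrict (subgraph f)

/-- The cells of the equidistant partition of `[0, 1]` into `k` intervals, numbered
`r = 0, …, k - 1`: half-open intervals, the last one being closed. -/
def cell (k r : ℕ) : Set ℝ :=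
  if r + 1 = k then Set.Icc ((r : ℝ) / k) 1 else Set.Ico ((r : ℝ) / k) (((r : ℝ) + 1) / k)

/-- The part of `S` above the `r`-th cell. -/
def column (f : ℝ → ℝ) (k r : ℕ) : Set (ℝ × ℝ) :=
  {q | q.1 ∈ cell k r ∧ 0 ≤ q.2 ∧ q.2 ≤ f q.1}

open Classical in
/-- The largest ordinate of the points of the configuration `z` in `D`, and `0` if there is no
such point. -/
def extreme (z : Multiset (ℝ × ℝ)) (D : Set (ℝ × ℝ)) : ℝ :=
  if count z D = 0 then 0 else sSup {y : ℝ | ∃ x : ℝ, (x, y) ∈ z ∧ (x, y) ∈ D}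

/-- The trigonometric basis of `L²([0, 1])`: `e 0 = 1`, `e (2k - 1) x = √2 cos (2kπx)` and
`e (2k) x = √2 sin (2kπx)` for `k ≥ 1`. -/
def trigBasis (j : ℕ) (x : ℝ) : ℝ :=
  if j = 0 then 1
  else if Even j then √2 * Real.sin ((j : ℝ) * Real.pi * x)
  else √2 * Real.cos (((j : ℝ) + 1) * Real.pi * x)

/-- The Dirichlet kernel of the trigonometric basis truncated at index `b`. -/
def dirichletKernel (b : ℕ) (x t : ℝ) : ℝ :=
  ∑ j ∈ Finset.range (b + 1), trigBasis j x * trigBasis j t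

/-- The projection estimate
`∑ r, (∫_{I_r} K_b(x, t) dt) (1 + 1 / N_r) Y*_r` computed from the configuration `z`; when
`N_r = 0` the summand is `0` since then `Y*_r = 0`. -/
def estimator (f : ℝ → ℝ) (k b : ℕ) (z : Multiset (ℝ × ℝ)) (x : ℝ) : ℝ :=
  ∑ r ∈ Finset.range k, (∫ t in cell k r, dirichletKernel b x t) *
    (1 + 1 / (count z (column f k r) : ℝ)) * extreme z (column f k r)

/-- The conditions on the number `k n` of cells and on the truncation index `b n`. -/
structure RateConditions (k b : ℕ → ℕ) : Prop where
  tendsto_b : Tendsto b atTop atTop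
  i : Tendsto (fun n : ℕ => (n : ℝ)⁻¹ * (k n : ℝ) * Real.log n) atTop (𝓝 0)
  ii : Tendsto (fun n : ℕ => (n : ℝ)⁻¹ * (k n : ℝ) ^ 2) atTop atTop
  iii : Tendsto (fun n : ℕ => ((b n : ℝ) * Real.log (b n))⁻¹ * (k n : ℝ)) atTop atTop
  iv : Tendsto (fun n : ℕ => (n : ℝ) * (k n : ℝ) ^ (-(1 / 2) : ℝ) * (b n : ℝ) ^ (-(3 / 2) : ℝ))
    atTop (𝓝 0)

/-- The normalized estimation errors `v c (f̂(x_j) - f(x_j))`, `1 ≤ j ≤ p`, as a vector of `ℝ^p`. -/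
def normalizedError {p : ℕ} (f : ℝ → ℝ) (c v : ℝ) (k b : ℕ) (x : Fin p → ℝ)
    (z : Multiset (ℝ × ℝ)) : EuclideanSpace ℝ (Fin p) :=
  WithLp.toLp 2 (fun j => v * c * (estimator f k b z (x j) - f (x j)))

end BoundaryEstimation

end

/-! Over a cell of width `1 / k` the boundary `f` is constant up to `O(1 / k)`, so each column is
compared with an inscribed rectangle of height `h = f (r / k) - L / k`, with `L` a Lipschitz
constant. On the rectangle everything is explicit. Given `m ≥ 1` points, the extreme `Y` is
distributed as the maximum of `m` uniform variables on `[0, h]`, so `(1 + 1 / m) Y` has mean `h` and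
variance `h ^ 2 / (m (m + 2))`. Let `lam = n c / k` be the mean number of points per unit of height.
The noise `lam * ((1 + 1 / K) Y - h)` then has mean `-lam h exp (-lam h)`, due to the empty sample
alone, second moment `1 + O(1 / (lam h))` and a bounded third moment. Noises of distinct cells are
independent.

Up to a remainder small in `L¹`, the normalized error at `x j` is a sum of these noises with weights
`(v k / n) ∫_{I_r} K_b(x j, t) dt`. By the reproducing property of `K_b`, the sum over `r` of the
products of the weights at `x i` and `x j` is close to `K_b(x i, x j) / b`. This tends to `1` for `i
= j`. Otherwise it tends to `0`, because the kernel stays bounded when `x i - x j` is not an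
integer, which is why `0` and `1` may not both occur. The weights tend to `0` uniformly, and an
expansion of characteristic functions (`tendstoInDistribution_of_weighted_sums`) yields the Gaussian
limit.

Condition (i) gives `lam h ≥ 2 log n` eventually, so the mean of a noise is at most `2 / n`.
Condition (ii) keeps the mean number of points between rectangle and column below one, so that the
exchange costs `O(1 / k)` in `L¹` (`IsPoissonProcess.integral_abs_column_sub_rectangle_le`).
Condition (iii) absorbs the Lebesgue constant `O(log b)` of the kernel and its Lipschitz constant
`O(b ^ 2)` when integrals are replaced by sums over cells. Condition (iv) says `v / b → 0`: the
truncation bias is `O(1 / b)` since the Fourier coefficients of `f` are `O(1 / j ^ 2)`, by two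
integrations by parts with periodic boundary values (`abs_integral_dirichletKernel_mul_sub_le`). -/

namespace BoundaryEstimation

/-! ### Counts and extremes of a finite configuration -/

section Configurations

variable {X : Type*}

lemma count_eq_zero_iff (z : Multiset X) (D : Set X) : count z D = 0 ↔ ∀ a ∈ z, a ∉ D := by
  classical
  unfold count
  rw [Multiset.card_eq_zero, Multiset.filter_eq_nil]

lemma count_union (z : Multiset X) {A B : Set X} (h : Disjoint A B) :
    count z (A ∪ B) = count z A + count z B := by
  classical
  unfold count
  rw [← Multiset.card_add, Multiset.filter_add_filter]
  have : Multiset.filter (fun a => a ∈ A ∧ a ∈ B) z = 0 := by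
    rw [Multiset.filter_eq_nil]
    exact fun a _ hab => Set.disjoint_left.1 h hab.1 hab.2
  rw [this, add_zero]
  simp only [Set.mem_union]

lemma extreme_set_eq (z : Multiset (ℝ × ℝ)) (D : Set (ℝ × ℝ)) :
    {y : ℝ | ∃ x : ℝ, (x, y) ∈ z ∧ (x, y) ∈ D} = Prod.snd '' {q | q ∈ z ∧ q ∈ D} := by
  ext y
  simp only [Set.mem_ofPred_eq, Set.mem_image, Prod.exists]
  constructor
  · rintro ⟨x, h⟩
    exact ⟨x, y, h, rfl⟩
  · rintro ⟨x, y', h, rfl⟩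
    exact ⟨x, h⟩

lemma extreme_set_finite (z : Multiset (ℝ × ℝ)) (D : Set (ℝ × ℝ)) :
    {y : ℝ | ∃ x : ℝ, (x, y) ∈ z ∧ (x, y) ∈ D}.Finite := by
  classical
  rw [extreme_set_eq]
  exact (z.toFinset.finite_toSet.subset fun q hq => by simpa using hq.1).image _

lemma extreme_set_nonempty {z : Multiset (ℝ × ℝ)} {D : Set (ℝ × ℝ)} (h : count z D ≠ 0) :
    {y : ℝ | ∃ x : ℝ, (x, y) ∈ z ∧ (x, y) ∈ D}.Nonempty := by
  rw [Ne, count_eq_zero_iff] at h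
  push Not at h
  obtain ⟨⟨x, y⟩, ha, hD⟩ := h
  exact ⟨y, x, ha, hD⟩

lemma extreme_of_count_eq_zero {z : Multiset (ℝ × ℝ)} {D : Set (ℝ × ℝ)} (h : count z D = 0) :
    extreme z D = 0 := by
  simp [extreme, h]

/-- The bridge from extremes to counts. The hypothesis `0 ≤ y` takes care of the default value `0`
when `D` holds no point. -/
lemma extreme_le_iff {z : Multiset (ℝ × ℝ)} {D : Set (ℝ × ℝ)} {y : ℝ} (hy : 0 ≤ y) :
    extreme z D ≤ y ↔ count z (D ∩ {q | y < q.2}) = 0 := by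
  rw [count_eq_zero_iff]
  by_cases h : count z D = 0
  · rw [extreme_of_count_eq_zero h]
    rw [count_eq_zero_iff] at h
    exact ⟨fun _ a ha hD => h a ha hD.1, fun _ => hy⟩
  · simp only [extreme, h, if_false]
    rw [csSup_le_iff (extreme_set_finite z D).bddAbove (extreme_set_nonempty h)]
    constructor
    · rintro H ⟨x, y'⟩ ha ⟨hD, hy'⟩
      exact absurd (H y' ⟨x, ha, hD⟩) (not_le.2 hy')
    · rintro H y' ⟨x, ha, hD⟩
      by_contra hlt
      exact H (x, y') ha ⟨hD, not_le.1 hlt⟩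

lemma extreme_nonneg {D : Set (ℝ × ℝ)} (hD : ∀ q ∈ D, 0 ≤ q.2) (z : Multiset (ℝ × ℝ)) :
    0 ≤ extreme z D := by
  by_cases h : count z D = 0
  · rw [extreme_of_count_eq_zero h]
  · simp only [extreme, h, if_false]
    obtain ⟨y, x, hz, hy⟩ := extreme_set_nonempty h
    exact (hD _ hy).trans (le_csSup (extreme_set_finite z D).bddAbove ⟨x, hz, hy⟩)

lemma extreme_le {D : Set (ℝ × ℝ)} {M : ℝ} (hM : 0 ≤ M) (hD : ∀ q ∈ D, q.2 ≤ M)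
    (z : Multiset (ℝ × ℝ)) : extreme z D ≤ M := by
  rw [extreme_le_iff hM, count_eq_zero_iff]
  exact fun a _ ha => absurd (hD a ha.1) (not_le.2 ha.2)

lemma extreme_union_of_count_eq_zero {A B : Set (ℝ × ℝ)} {z : Multiset (ℝ × ℝ)}
    (h : count z B = 0) : extreme z (A ∪ B) = extreme z A := by
  rw [count_eq_zero_iff] at h
  have hc : count z (A ∪ B) = 0 ↔ count z A = 0 := by
    simp only [count_eq_zero_iff, Set.mem_union, not_or]
    exact ⟨fun H a ha => (H a ha).1, fun H a ha => ⟨H a ha, h a ha⟩⟩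
  have hs : {y : ℝ | ∃ x : ℝ, (x, y) ∈ z ∧ (x, y) ∈ A ∪ B}
      = {y : ℝ | ∃ x : ℝ, (x, y) ∈ z ∧ (x, y) ∈ A} := by
    ext y
    refine exists_congr fun x => and_congr_right fun hz => ?_
    simp [h _ hz]
  unfold extreme
  simp only [hc, hs]

end Configurations

/-! ### Independence of counts and extremes over disjoint sets -/

section PoissonProcess

variable {Ω : Type*} {mΩ : MeasurableSpace Ω} {P : Measure Ω}

section General

variable {X : Type*} [MeasurableSpace X] {μ : Measure X} {N : Ω → Multiset X}

lemma IsPoissonProcess.iIndepFun_count (hN : IsPoissonProcess P μ N) {ι : Type*} [Fintype ι]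
    (D : ι → Set X) (hD : ∀ i, MeasurableSet (D i))
    (hdisj : Pairwise fun i j => Disjoint (D i) (D j)) :
    iIndepFun (fun i ω => count (N ω) (D i)) P := by
  let e := Fintype.equivFin ι
  have := hN.indep_count (Fintype.card ι) (fun i => D (e.symm i)) (fun i => hD _)
    (fun i j hij => hdisj (fun h => hij (e.symm.injective h)))
  have h2 := this.precomp e.injective
  have h3 : (fun i => D (e.symm (e i))) = D := funext fun i => by rw [e.symm_apply_apply]
  exact (congrArg (fun D' : ι → Set X => iIndepFun (fun i ω => count (N ω) (D' i)) P) h3).mp h2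

lemma IsPoissonProcess.prob_count [IsProbabilityMeasure P] (hN : IsPoissonProcess P μ N)
    {D : Set X} (hD : MeasurableSet D) {a : ℝ} (ha : 0 ≤ a) (hμ : μ D = ENNReal.ofReal a) (m : ℕ) :
    P.real {ω | count (N ω) D = m} = Real.exp (-a) * a ^ m / m.factorial := by
  have h := hN.law_count D hD (by rw [hμ]; exact ENNReal.ofReal_ne_top)
  have h2 : (P.map (fun ω => count (N ω) D)).real {m} = P.real {ω | count (N ω) D = m} := by
    rw [map_measureReal_apply (hN.measurable_count D hD) (measurableSet_singleton m)]
    rfl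
  rw [← h2, h, poissonMeasure_real_singleton, hμ, ENNReal.ofReal, ENNReal.toNNReal_coe,
    Real.coe_toNNReal a ha]

end General

variable {μ : Measure (ℝ × ℝ)} {N : Ω → Multiset (ℝ × ℝ)}

lemma IsPoissonProcess.measurable_extreme (hN : IsPoissonProcess P μ N) {D : Set (ℝ × ℝ)}
    (hD : MeasurableSet D) (hD0 : ∀ q ∈ D, 0 ≤ q.2) : Measurable fun ω => extreme (N ω) D := by
  refine measurable_of_Iic fun y => ?_
  rcases lt_or_ge y 0 with hy | hy
  · convert MeasurableSet.empty
    ext ω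
    simpa using hy.trans_le (extreme_nonneg hD0 (N ω))
  · have : (fun ω => extreme (N ω) D) ⁻¹' Set.Iic y
        = (fun ω => count (N ω) (D ∩ {q | y < q.2})) ⁻¹' {0} := by
      ext ω
      simpa using extreme_le_iff hy
    rw [this]
    exact hN.measurable_count _ (hD.inter (measurableSet_lt measurable_const measurable_snd))
      (measurableSet_singleton 0)

lemma disjoint_above_below (D : Set (ℝ × ℝ)) (y : ℝ) :
    Disjoint (D ∩ {q | y < q.2}) (D ∩ {q | q.2 ≤ y}) :=
  Set.disjoint_left.2 fun q hq hq' =>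
    absurd (show q.2 ≤ y from hq'.2) (not_le.2 (show y < q.2 from hq.2))

/-- If no point lies above `y`, all `m` points lie below it. A joint event for count and extreme
thus becomes one for two counts over disjoint sets, to which the Poisson property applies. -/
lemma setOf_count_eq_extreme_le (D : Set (ℝ × ℝ)) {y : ℝ} (hy : 0 ≤ y) (m : ℕ) :
    {ω | count (N ω) D = m ∧ extreme (N ω) D ≤ y}
      = (fun ω => count (N ω) (D ∩ {q | y < q.2})) ⁻¹' {0}
        ∩ (fun ω => count (N ω) (D ∩ {q | q.2 ≤ y})) ⁻¹' {m} := by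
  ext ω
  have h1 : D = (D ∩ {q | y < q.2}) ∪ (D ∩ {q | q.2 ≤ y}) := by
    ext q
    simp only [Set.mem_union, Set.mem_inter_iff, Set.mem_ofPred_eq, ← and_or_left, lt_or_ge, and_true]
  have h3 := count_union (N ω) (disjoint_above_below D y)
  rw [← h1] at h3
  simp only [Set.mem_ofPred_eq, Set.mem_inter_iff, Set.mem_preimage, Set.mem_singleton_iff,
    extreme_le_iff hy, h3]
  omega

/-- The σ-algebra `m` is kept arbitrary: taken as the one generated by these events, it shows that
they generate the σ-algebra of the pair. -/
lemma measurable_count_extreme_of_setOf {m : MeasurableSpace Ω} {D : Set (ℝ × ℝ)}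
    (hD0 : ∀ q ∈ D, 0 ≤ q.2) (h : ∀ (j : ℕ) (y : ℝ), 0 ≤ y →
      MeasurableSet {ω | count (N ω) D = j ∧ extreme (N ω) D ≤ y}) :
    Measurable fun ω => (count (N ω) D, extreme (N ω) D) := by
  refine Measurable.prodMk ?_ ?_
  · refine measurable_to_countable' fun j => ?_
    have : (fun ω => count (N ω) D) ⁻¹' {j}
        = ⋃ i : ℕ, {ω | count (N ω) D = j ∧ extreme (N ω) D ≤ i} := by
      ext ω
      obtain ⟨i, hi⟩ := exists_nat_ge (extreme (N ω) D)
      simp only [Set.mem_preimage, Set.mem_singleton_iff, Set.mem_iUnion, Set.mem_ofPred_eq]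
      exact ⟨fun h => ⟨i, h, hi⟩, fun ⟨_, h, _⟩ => h⟩
    rw [this]
    exact MeasurableSet.iUnion fun i => h j i (Nat.cast_nonneg i)
  · refine measurable_of_Iic fun y => ?_
    rcases lt_or_ge y 0 with hy | hy
    · convert MeasurableSet.empty
      ext ω
      simpa using hy.trans_le (extreme_nonneg hD0 (N ω))
    · have : (fun ω => extreme (N ω) D) ⁻¹' Set.Iic y
          = ⋃ j : ℕ, {ω | count (N ω) D = j ∧ extreme (N ω) D ≤ y} := by
        ext ω
        simp
      rw [this]
      exact MeasurableSet.iUnion fun j => h j y hy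

/-- Counts and extremes over pairwise disjoint sets are independent. -/
theorem IsPoissonProcess.iIndepFun_count_extreme (hN : IsPoissonProcess P μ N) {ι : Type*}
    [Fintype ι] (D : ι → Set (ℝ × ℝ)) (hD : ∀ i, MeasurableSet (D i))
    (hdisj : Pairwise fun i j => Disjoint (D i) (D j)) (hD0 : ∀ i, ∀ q ∈ D i, 0 ≤ q.2) :
    iIndepFun (fun i ω => (count (N ω) (D i), extreme (N ω) (D i))) P := by
  classical
  -- These events form a π-system generating the σ-algebra of the `i`-th pair, so independence need
  -- only be checked on them.
  let π : ι → Set (Set Ω) := fun i =>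
    {s | ∃ (m : ℕ) (y : ℝ), 0 ≤ y ∧ s = {ω | count (N ω) (D i) = m ∧ extreme (N ω) (D i) ≤ y}}
  have hup : ∀ y : ℝ, MeasurableSet {q : ℝ × ℝ | y < q.2} := fun y =>
    measurableSet_lt measurable_const measurable_snd
  have hdown : ∀ y : ℝ, MeasurableSet {q : ℝ × ℝ | q.2 ≤ y} := fun y =>
    measurableSet_le measurable_snd measurable_const
  have hπm : ∀ i, ∀ s ∈ π i, MeasurableSet s := by
    rintro i s ⟨m, y, hy, rfl⟩
    rw [setOf_count_eq_extreme_le _ hy]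
    exact (hN.measurable_count _ ((hD i).inter (hup y)) (measurableSet_singleton 0)).inter
      (hN.measurable_count _ ((hD i).inter (hdown y)) (measurableSet_singleton m))
  have hpi : ∀ i, IsPiSystem (π i) := by
    rintro i _ ⟨m, y, hy, rfl⟩ _ ⟨m', y', hy', rfl⟩ ⟨ω, hω, hω'⟩
    have hm : m = m' := hω.1.symm.trans hω'.1
    subst hm
    refine ⟨m, min y y', le_min hy hy', ?_⟩
    ext ω
    simp only [Set.mem_inter_iff, Set.mem_ofPred_eq, le_min_iff]
    tauto
  have hset : iIndepSets π P := by
    rw [iIndepSets_iff]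
    intro s g hg
    have : ∀ i, ∃ (m : ℕ) (y : ℝ), 0 ≤ y ∧ (i ∈ s →
        g i = {ω | count (N ω) (D i) = m ∧ extreme (N ω) (D i) ≤ y}) := by
      intro i
      by_cases hi : i ∈ s
      · obtain ⟨m, y, hy, h⟩ := hg i hi
        exact ⟨m, y, hy, fun _ => h⟩
      · exact ⟨0, 0, le_rfl, fun h => absurd h hi⟩
    choose m y hy hgi using this
    -- Every `D i` is cut at its own level `y i`. The pieces are pairwise disjoint over all pairs
    -- `(i, b)`, so their counts are jointly independent.
    let E : ι × Bool → Set (ℝ × ℝ) := fun p =>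
      if p.2 then D p.1 ∩ {q | y p.1 < q.2} else D p.1 ∩ {q | q.2 ≤ y p.1}
    have hE : ∀ p, MeasurableSet (E p) := by
      rintro ⟨i, b⟩
      cases b
      · exact (hD i).inter (hdown _)
      · exact (hD i).inter (hup _)
    have hEsub : ∀ p, E p ⊆ D p.1 := by
      rintro ⟨i, b⟩
      cases b <;> exact Set.inter_subset_left
    have hEd : Pairwise fun p p' => Disjoint (E p) (E p') := by
      rintro ⟨i, b⟩ ⟨j, b'⟩ hne
      by_cases hij : i = j
      · subst hij
        cases b <;> cases b' <;> simp only [ne_eq, not_true_eq_false] at hne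
        · exact (disjoint_above_below (D i) (y i)).symm
        · exact disjoint_above_below (D i) (y i)
      · exact (hdisj hij).mono (hEsub (i, b)) (hEsub (j, b'))
    have hI := hN.iIndepFun_count E hE hEd
    let T : ι × Bool → Set ℕ := fun p => if p.2 then {0} else {m p.1}
    have hgT : ∀ i ∈ s, g i = ⋂ p ∈ ({i} ×ˢ Finset.univ : Finset (ι × Bool)),
        (fun ω => count (N ω) (E p)) ⁻¹' T p := by
      intro i hi
      rw [hgi i hi, setOf_count_eq_extreme_le _ (hy i)]
      ext ω
      simp [E, T, and_comm]
    have hgP : ∀ i ∈ s, P (g i) = ∏ b : Bool, P ((fun ω => count (N ω) (E (i, b))) ⁻¹' T (i, b)) := by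
      intro i hi
      rw [hgT i hi, hI.measure_inter_preimage_eq_mul _ (fun _ _ => MeasurableSet.of_discrete),
        Finset.prod_product, Finset.prod_singleton]
    rw [Finset.prod_congr rfl hgP, ← Finset.prod_product', ← hI.measure_inter_preimage_eq_mul _
      (fun _ _ => MeasurableSet.of_discrete)]
    congr 1
    ext ω
    simp only [Set.mem_iInter]
    constructor
    · rintro H ⟨i, b⟩ hp
      have hi : i ∈ s := (Finset.mem_product.1 hp).1
      have := H i hi
      rw [hgT i hi] at this
      simp only [Set.mem_iInter] at this
      exact this (i, b) (by simp)
    · intro H i hi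
      rw [hgT i hi]
      simp only [Set.mem_iInter]
      rintro ⟨j, b⟩ hp
      have hj : j = i := Finset.mem_singleton.1 (Finset.mem_product.1 hp).1
      subst hj
      exact H (j, b) (by simp [hi])
  have hind : iIndep (fun i => MeasurableSpace.generateFrom (π i)) P :=
    iIndepSets.iIndep (fun i => MeasurableSpace.generateFrom_le (hπm i)) π hpi (fun _ => rfl) hset
  rw [iIndepFun_iff_iIndep]
  have hle : ∀ i, MeasurableSpace.comap (fun ω => (count (N ω) (D i), extreme (N ω) (D i)))
      inferInstance ≤ MeasurableSpace.generateFrom (π i) := by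
    intro i
    rw [← measurable_iff_comap_le]
    have hbase : ∀ (m : ℕ) (y : ℝ), 0 ≤ y → MeasurableSet[MeasurableSpace.generateFrom (π i)]
        {ω | count (N ω) (D i) = m ∧ extreme (N ω) (D i) ≤ y} := fun m y hy =>
      MeasurableSpace.measurableSet_generateFrom ⟨m, y, hy, rfl⟩
    exact measurable_count_extreme_of_setOf (hD0 i) (m := MeasurableSpace.generateFrom (π i)) hbase
  rw [iIndep_iff] at hind ⊢
  intro s g hg
  exact hind s fun i hi => hle i _ (hg i hi)

end PoissonProcess

/-! ### Moments through tail probabilities -/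

section Layercake

variable {Ω : Type*} {mΩ : MeasurableSpace Ω}

/-- Layer cake formula with `z ^ (p + 1) = ∫₀ᶻ (p + 1) t ^ p dt`. The measure `Q` is only finite
because the formula is also applied to the restriction of `P` to an event `{K = m}`. -/
lemma integral_pow_succ_eq_intervalIntegral (Q : Measure Ω) [IsFiniteMeasure Q] {Z : Ω → ℝ} {h : ℝ}
    (hZ : Measurable Z) (hZ0 : ∀ ω, 0 ≤ Z ω) (hZh : ∀ ω, Z ω ≤ h) (hh : 0 ≤ h) (p : ℕ) :
    ∫ ω, Z ω ^ (p + 1) ∂Q = ∫ t in (0 : ℝ)..h, Q.real {ω | t ≤ Z ω} * ((p + 1) * t ^ p) := by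
  have key := lintegral_comp_eq_lintegral_meas_le_mul (g := fun t : ℝ => ((p : ℝ) + 1) * t ^ p) Q
    (Eventually.of_forall hZ0) hZ.aemeasurable
    (fun t _ => (by fun_prop : Continuous fun t : ℝ => ((p : ℝ) + 1) * t ^ p).intervalIntegrable _ _)
    ((ae_restrict_iff' measurableSet_Ioi).2 (Eventually.of_forall fun t (ht : (0 : ℝ) < t) => by
      positivity))
  have hint : ∀ z : ℝ, ∫ t in (0 : ℝ)..z, ((p : ℝ) + 1) * t ^ p = z ^ (p + 1) := by
    intro z
    rw [intervalIntegral.integral_const_mul, integral_pow]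
    have : (p : ℝ) + 1 ≠ 0 := by positivity
    field_simp
    simp
  simp only [hint] at key
  rw [integral_eq_lintegral_of_nonneg_ae (Eventually.of_forall fun ω => by have := hZ0 ω; positivity)
    (hZ.pow_const _).aestronglyMeasurable, key]
  have hanti : Antitone fun t : ℝ => Q.real {ω | t ≤ Z ω} := fun s t hst =>
    measureReal_mono fun ω (hω : t ≤ Z ω) => hst.trans hω
  rw [intervalIntegral.integral_of_le hh, ← integral_indicator measurableSet_Ioc]
  -- Above `h` the level sets of `Z` are empty, so the integrals over `(0, h]` and `(0, ∞)`
  -- coincide.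
  have hEq : ∀ t : ℝ, (Set.Ioc 0 h).indicator
      (fun t => Q.real {ω | t ≤ Z ω} * (((p : ℝ) + 1) * t ^ p)) t
      = (Set.Ioi 0).indicator (fun t => Q.real {ω | t ≤ Z ω} * (((p : ℝ) + 1) * t ^ p)) t := by
    intro t
    by_cases h0 : 0 < t
    · by_cases hth : t ≤ h
      · rw [Set.indicator_of_mem (Set.mem_Ioc.2 ⟨h0, hth⟩), Set.indicator_of_mem (Set.mem_Ioi.2 h0)]
      · rw [Set.indicator_of_notMem (fun H => hth H.2), Set.indicator_of_mem (Set.mem_Ioi.2 h0)]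
        have : {ω | t ≤ Z ω} = ∅ := by
          ext ω
          simpa using (hZh ω).trans_lt (not_le.1 hth)
        simp [this]
    · rw [Set.indicator_of_notMem (fun H => h0 H.1), Set.indicator_of_notMem (fun H : t ∈ Set.Ioi 0 => h0 H)]
  simp only [hEq]
  rw [integral_indicator measurableSet_Ioi, integral_eq_lintegral_of_nonneg_ae]
  · congr 1
    refine setLIntegral_congr_fun measurableSet_Ioi fun t (ht : 0 < t) => ?_
    rw [ENNReal.ofReal_mul measureReal_nonneg, ofReal_measureReal]
  · refine (ae_restrict_iff' measurableSet_Ioi).2 (Eventually.of_forall fun t (ht : (0 : ℝ) < t) => ?_)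
    have : 0 ≤ Q.real {ω | t ≤ Z ω} := measureReal_nonneg
    change 0 ≤ _ * _
    positivity
  · exact (hanti.measurable.mul (by fun_prop)).aestronglyMeasurable

end Layercake

/-! ### Inverse moments of the Poisson distribution -/

section PoissonSums

/-- The weight `e^{-μ} μ^m / m!` of the Poisson distribution. -/
noncomputable def poissonWeight (μ : ℝ) (m : ℕ) : ℝ := Real.exp (-μ) * μ ^ m / m.factorial

lemma poissonWeight_nonneg {μ : ℝ} (hμ : 0 ≤ μ) (m : ℕ) : 0 ≤ poissonWeight μ m := by
  unfold poissonWeight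
  positivity

lemma hasSum_poissonWeight {μ : ℝ} (hμ : 0 ≤ μ) : HasSum (poissonWeight μ) 1 := by
  exact hasSum_one_poissonMeasure ⟨μ, hμ⟩

/-- Since `m! (m + 1) ⋯ (m + j) = (m + j)!`, each term is `μ ^ (-j)` times the weight of `m + j`,
and the shifted weights miss only the first `j` values. -/
lemma hasSum_poissonWeight_div_ascFactorial {μ : ℝ} (hμ : 0 < μ) (j : ℕ) :
    HasSum (fun m => poissonWeight μ m / ((m + 1).ascFactorial j : ℝ))
      ((1 - ∑ i ∈ Finset.range j, poissonWeight μ i) / μ ^ j) := by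
  have h := (hasSum_nat_add_iff (f := poissonWeight μ) (g := 1 - ∑ i ∈ Finset.range j,
    poissonWeight μ i) j).2 (by simpa using hasSum_poissonWeight hμ.le)
  have e : (fun m => poissonWeight μ m / ((m + 1).ascFactorial j : ℝ))
      = fun m => poissonWeight μ (m + j) / μ ^ j := by
    funext m
    have : ((m + j).factorial : ℝ) = m.factorial * (m + 1).ascFactorial j := by
      exact_mod_cast (Nat.factorial_mul_ascFactorial m j).symm
    have h1 : ((m + 1).ascFactorial j : ℝ) ≠ 0 := by exact_mod_cast (Nat.ascFactorial_pos m j).ne'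
    simp only [poissonWeight, this, pow_add]
    field_simp
  rw [e]
  exact h.div_const _

lemma hasSum_poissonWeight_div_ascFactorial_le {μ : ℝ} (hμ : 0 < μ) (j : ℕ) :
    (1 - ∑ i ∈ Finset.range j, poissonWeight μ i) / μ ^ j ≤ 1 / μ ^ j := by
  have : 0 ≤ ∑ i ∈ Finset.range j, poissonWeight μ i :=
    Finset.sum_nonneg fun i _ => poissonWeight_nonneg hμ.le i
  gcongr
  linarith

lemma exp_neg_mul_one_add_le {μ : ℝ} (hμ : 0 < μ) : Real.exp (-μ) * (1 + μ) ≤ 4 / μ := by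
  have h := Real.quadratic_le_exp_of_nonneg hμ.le
  rw [Real.exp_neg, inv_mul_le_iff₀ (Real.exp_pos μ), mul_div_assoc', le_div_iff₀ hμ]
  nlinarith

/-- The normalized conditional second moment: `1 / (m (m + 2))`, and `1` for `m = 0`. -/
noncomputable def secondMomentFactor (m : ℕ) : ℝ := if m = 0 then 1 else 1 / ((m : ℝ) * (m + 2))

/-- The factor `1 / (m (m + 2))` lies between `1 / ((m + 1) (m + 2))` and this plus `4 / ((m + 1) (m
+ 2) (m + 3))`, and both bounds have explicit Poisson means. The constant `4` gives equality at `m =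
1`; the value `1` at `m = 0` also fits, between `1 / 2` and `7 / 6`. -/
lemma abs_sq_mul_secondMoment_sub_one_le {μ s : ℝ} (hμ : 0 < μ)
    (hs : HasSum (fun m => poissonWeight μ m * secondMomentFactor m) s) :
    |μ ^ 2 * s - 1| ≤ 4 / μ := by
  have h2 := hasSum_poissonWeight_div_ascFactorial hμ 2
  have h3 := hasSum_poissonWeight_div_ascFactorial hμ 3
  have a2 : ∀ m : ℕ, ((m + 1).ascFactorial 2 : ℝ) = (m + 1) * (m + 2) := fun m => by
    simp [Nat.ascFactorial]; ring
  have a3 : ∀ m : ℕ, ((m + 1).ascFactorial 3 : ℝ) = (m + 1) * (m + 2) * (m + 3) := fun m => by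
    simp [Nat.ascFactorial]; ring
  have hlow : (1 - ∑ i ∈ Finset.range 2, poissonWeight μ i) / μ ^ 2 ≤ s := by
    refine hasSum_le (fun m => ?_) h2 hs
    rw [a2, div_eq_mul_one_div]
    refine mul_le_mul_of_nonneg_left ?_ (poissonWeight_nonneg hμ.le m)
    unfold secondMomentFactor
    split_ifs with hm
    · subst hm; norm_num
    · have : (0 : ℝ) < m := by positivity
      gcongr
      linarith
  have hup : s ≤ (1 - ∑ i ∈ Finset.range 2, poissonWeight μ i) / μ ^ 2
      + 4 * ((1 - ∑ i ∈ Finset.range 3, poissonWeight μ i) / μ ^ 3) := by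
    refine hasSum_le (fun m => ?_) hs (h2.add (h3.mul_left 4))
    rw [a2, a3, show ∀ w : ℝ, w / ((m + 1) * (m + 2)) + 4 * (w / (((m : ℝ) + 1) * (m + 2) * (m + 3)))
      = w * (1 / (((m : ℝ) + 1) * (m + 2)) + 4 / (((m : ℝ) + 1) * (m + 2) * (m + 3))) by
        intro w; ring]
    refine mul_le_mul_of_nonneg_left ?_ (poissonWeight_nonneg hμ.le m)
    unfold secondMomentFactor
    split_ifs with hm
    · subst hm; norm_num
    · have h1 : (1 : ℝ) ≤ m := by exact_mod_cast Nat.one_le_iff_ne_zero.2 hm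
      rw [div_add_div _ _ (by positivity) (by positivity), div_le_div_iff₀ (by positivity)
        (by positivity)]
      have : 0 ≤ ((m : ℝ) + 1) * (m + 2) ^ 2 := by positivity
      nlinarith [mul_nonneg this (sub_nonneg.2 h1), mul_nonneg this (by positivity : (0:ℝ) ≤ m)]
  have h3' := hasSum_poissonWeight_div_ascFactorial_le hμ 3
  have hw : ∑ i ∈ Finset.range 2, poissonWeight μ i = Real.exp (-μ) * (1 + μ) := by
    simp [Finset.sum_range_succ, poissonWeight]; ring
  rw [hw] at hlow hup
  have hb := exp_neg_mul_one_add_le hμ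
  have hb0 : 0 ≤ Real.exp (-μ) * (1 + μ) := by positivity
  rw [abs_le]
  constructor
  · rw [div_le_iff₀ (by positivity)] at hlow
    linarith
  · have hup2 := mul_le_mul_of_nonneg_left (hup.trans (add_le_add_right
      (mul_le_mul_of_nonneg_left h3' (by norm_num : (0:ℝ) ≤ 4)) _)) (sq_nonneg μ)
    have : μ ^ 2 * ((1 - Real.exp (-μ) * (1 + μ)) / μ ^ 2 + 4 * (1 / μ ^ 3))
        = 1 - Real.exp (-μ) * (1 + μ) + 4 / μ := by field_simp
    linarith

end PoissonSums

/-- `K` is Poisson distributed with mean `lam * h` and, given `K`, the variable `Y` is distributed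
as the maximum of `K` independent uniform variables on `[0, h]`, with `Y = 0` if `K = 0`. -/
structure IsPoissonMaximum {Ω : Type*} [MeasurableSpace Ω] (P : Measure Ω) (lam h : ℝ)
    (K : Ω → ℕ) (Y : Ω → ℝ) : Prop where
  measurable_count : Measurable K
  measurable_max : Measurable Y
  nonneg : ∀ ω, 0 ≤ Y ω
  le : ∀ ω, Y ω ≤ h
  eq_zero : ∀ ω, K ω = 0 → Y ω = 0
  law : ∀ (m : ℕ) (y : ℝ), 0 ≤ y → y ≤ h →
    P.real {ω | K ω = m ∧ Y ω ≤ y} = Real.exp (-(lam * h)) * (lam * y) ^ m / m.factorial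

/-! ### Joint law of count and extreme on a rectangle -/

section Law

variable {Ω : Type*} {mΩ : MeasurableSpace Ω} {P : Measure Ω} [IsProbabilityMeasure P]
  {μ : Measure (ℝ × ℝ)} {N : Ω → Multiset (ℝ × ℝ)}

/-- The event `K = m`, `Y ≤ y` says that no point lies above `y` and `m` points lie below. These are
independent Poisson counts with means `lam * (h - y)` and `lam * y`. -/
theorem IsPoissonProcess.isPoissonMaximum (hN : IsPoissonProcess P μ N) {R : Set (ℝ × ℝ)}
    (hR : MeasurableSet R) {lam h : ℝ} (hlam : 0 ≤ lam) (hh : 0 ≤ h)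
    (hR0 : ∀ q ∈ R, 0 ≤ q.2) (hRh : ∀ q ∈ R, q.2 ≤ h)
    (hup : ∀ y, 0 ≤ y → y ≤ h → μ (R ∩ {q | y < q.2}) = ENNReal.ofReal (lam * (h - y)))
    (hdown : ∀ y, 0 ≤ y → y ≤ h → μ (R ∩ {q | q.2 ≤ y}) = ENNReal.ofReal (lam * y)) :
    IsPoissonMaximum P lam h (fun ω => count (N ω) R) (fun ω => extreme (N ω) R) where
  measurable_count := hN.measurable_count R hR
  measurable_max := hN.measurable_extreme hR hR0
  nonneg ω := extreme_nonneg hR0 _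
  le ω := extreme_le hh hRh _
  eq_zero ω := extreme_of_count_eq_zero
  law m y hy hyh := by
    have hmu : MeasurableSet (R ∩ {q : ℝ × ℝ | y < q.2}) :=
      hR.inter (measurableSet_lt measurable_const measurable_snd)
    have hmd : MeasurableSet (R ∩ {q : ℝ × ℝ | q.2 ≤ y}) :=
      hR.inter (measurableSet_le measurable_snd measurable_const)
    let E : Bool → Set (ℝ × ℝ) := fun b => if b then R ∩ {q | y < q.2} else R ∩ {q | q.2 ≤ y}
    have hE : ∀ b, MeasurableSet (E b) := by
      intro b
      cases b
      · exact hmd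
      · exact hmu
    have hd : Pairwise fun b b' => Disjoint (E b) (E b') := by
      intro b b' hne
      cases b <;> cases b'
      · exact absurd rfl hne
      · exact (disjoint_above_below R y).symm
      · exact disjoint_above_below R y
      · exact absurd rfl hne
    have hI := (hN.iIndepFun_count E hE hd).indepFun (i := true) (j := false) (by simp)
    rw [setOf_count_eq_extreme_le R hy]
    have h1 := hI.measure_inter_preimage_eq_mul {0} {m} (measurableSet_singleton _)
      (measurableSet_singleton _)
    have h2 := congrArg ENNReal.toReal h1
    rw [ENNReal.toReal_mul] at h2
    have hu0 := hN.prob_count hmu (mul_nonneg hlam (sub_nonneg.2 hyh)) (hup y hy hyh) 0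
    have hdm := hN.prob_count hmd (mul_nonneg hlam hy) (hdown y hy hyh) m
    refine h2.trans ?_
    change P.real {ω | count (N ω) (R ∩ {q | y < q.2}) = 0}
      * P.real {ω | count (N ω) (R ∩ {q | q.2 ≤ y}) = m} = _
    rw [hu0, hdm, show -(lam * h) = -(lam * (h - y)) + -(lam * y) by ring, Real.exp_add]
    simp
    ring

end Law

/-- The bias-corrected maximum `(1 + 1 / K) Y`. -/
noncomputable def correctedMaximum (m : ℕ) (y : ℝ) : ℝ :=
  (1 + 1 / (m : ℝ)) * y

/-- Expresses the error through the gap `h - y`, whose moments on `{K = m}` are explicit. -/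
lemma correctedMaximum_sub_eq (h : ℝ) {m : ℕ} (hm : m ≠ 0) (y : ℝ) :
    correctedMaximum m y - h = h / m - (1 + 1 / m) * (h - y) := by
  have : (m : ℝ) ≠ 0 := by exact_mod_cast hm
  rw [correctedMaximum]
  field_simp
  ring

/-! ### Moments of the bias-corrected maximum -/

namespace IsPoissonMaximum

variable {Ω : Type*} {mΩ : MeasurableSpace Ω} {P : Measure Ω} {lam h : ℝ} {K : Ω → ℕ} {Y : Ω → ℝ}

lemma measurableSet_count_eq (H : IsPoissonMaximum P lam h K Y) (m : ℕ) :
    MeasurableSet {ω | K ω = m} :=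
  H.measurable_count (measurableSet_singleton m)

lemma measurable_correctedMaximum (H : IsPoissonMaximum P lam h K Y) :
    Measurable fun ω => correctedMaximum (K ω) (Y ω) :=
  (measurable_const.add ((measurable_from_nat (f := fun m : ℕ => 1 / (m : ℝ))).comp
    H.measurable_count)).mul H.measurable_max

lemma correctedMaximum_sub_eq_zero (H : IsPoissonMaximum P lam h K Y) {ω : Ω}
    (hω : K ω = 0) : correctedMaximum (K ω) (Y ω) - h = -h := by
  rw [correctedMaximum, H.eq_zero ω hω, mul_zero, zero_sub]

lemma hasSum_setIntegral (H : IsPoissonMaximum P lam h K Y) {F : Ω → ℝ} (hF : Integrable F P) :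
    HasSum (fun m => ∫ ω in {ω | K ω = m}, F ω ∂P) (∫ ω, F ω ∂P) := by
  have hU : (⋃ m, {ω | K ω = m}) = Set.univ := by
    ext ω
    simp
  have := hasSum_integral_iUnion (μ := P) (f := F) H.measurableSet_count_eq
    (fun i j hij => Set.disjoint_left.2 fun ω (hω : K ω = i) (hω' : K ω = j) =>
      hij (hω.symm.trans hω')) (by rw [hU]; exact hF.integrableOn)
  rwa [hU, Measure.restrict_univ] at this

variable [IsProbabilityMeasure P]

lemma nonneg_height (H : IsPoissonMaximum P lam h K Y) : 0 ≤ h := by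
  have : Nonempty Ω := by
    by_contra hn
    rw [not_nonempty_iff] at hn
    have := IsProbabilityMeasure.measure_univ (μ := P)
    rw [Set.univ_eq_empty_iff.2 hn] at this
    simp at this
  exact (H.nonneg this.some).trans (H.le this.some)

lemma prob_count (H : IsPoissonMaximum P lam h K Y) (m : ℕ) :
    P.real {ω | K ω = m} = poissonWeight (lam * h) m := by
  rw [poissonWeight, ← H.law m h H.nonneg_height le_rfl]
  congr 1
  ext ω
  simp [H.le ω]

lemma integral_comp_count_hasSum (H : IsPoissonMaximum P lam h K Y) {g : ℕ → ℝ}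
    (hg : Integrable (fun ω => g (K ω)) P) :
    HasSum (fun m => poissonWeight (lam * h) m * g m) (∫ ω, g (K ω) ∂P) := by
  convert H.hasSum_setIntegral hg using 1
  funext m
  rw [setIntegral_congr_fun (g := fun _ => g m) (H.measurableSet_count_eq m)
    (fun ω (hω : K ω = m) => by rw [hω]), setIntegral_const, H.prob_count, smul_eq_mul]

lemma integrable_of_bounded {F : Ω → ℝ} (hF : Measurable F) {C : ℝ} (hC : ∀ ω, |F ω| ≤ C) :
    Integrable F P :=
  Integrable.of_bound hF.aestronglyMeasurable C (Eventually.of_forall hC)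

lemma integral_inv_ascFactorial_le (H : IsPoissonMaximum P lam h K Y) (hμ : 0 < lam * h) (j : ℕ) :
    ∫ ω, 1 / ((K ω + 1).ascFactorial j : ℝ) ∂P ≤ 1 / (lam * h) ^ j := by
  have hint : Integrable (fun ω => 1 / ((K ω + 1).ascFactorial j : ℝ)) P := by
    refine integrable_of_bounded ((measurable_from_nat (f := fun m : ℕ =>
      1 / ((m + 1).ascFactorial j : ℝ))).comp H.measurable_count) (C := 1) fun ω => ?_
    have : (1 : ℝ) ≤ ((K ω + 1).ascFactorial j : ℝ) := by
      exact_mod_cast Nat.ascFactorial_pos _ j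
    rw [abs_of_nonneg (by positivity)]
    exact div_le_one_of_le₀ this (by positivity)
  have h1 := H.integral_comp_count_hasSum (g := fun m => 1 / ((m + 1).ascFactorial j : ℝ)) hint
  have h2 := hasSum_poissonWeight_div_ascFactorial hμ j
  simp only [mul_one_div] at h1
  rw [h1.unique h2]
  exact hasSum_poissonWeight_div_ascFactorial_le hμ j

lemma integral_inv_count_succ_le (H : IsPoissonMaximum P lam h K Y) (hμ : 0 < lam * h) :
    ∫ ω, 1 / ((K ω : ℝ) + 1) ∂P ≤ 1 / (lam * h) := by
  simpa [Nat.ascFactorial] using H.integral_inv_ascFactorial_le hμ 1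

lemma setIntegral_gap_pow (H : IsPoissonMaximum P lam h K Y) (m p : ℕ) :
    ∫ ω in {ω | K ω = m}, (h - Y ω) ^ (p + 1) ∂P
      = ∫ t in (0 : ℝ)..h, Real.exp (-(lam * h)) * (lam * (h - t)) ^ m / m.factorial
        * ((p + 1) * t ^ p) := by
  rw [integral_pow_succ_eq_intervalIntegral _ (H.measurable_max.const_sub h)
    (fun ω => sub_nonneg.2 (H.le ω)) (fun ω => sub_le_self _ (H.nonneg ω)) H.nonneg_height]
  refine intervalIntegral.integral_congr fun t ht => ?_
  rw [Set.uIcc_of_le H.nonneg_height] at ht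
  rw [← H.law m (h - t) (sub_nonneg.2 ht.2) (sub_le_self _ ht.1),
    measureReal_restrict_apply (measurableSet_le measurable_const
      (H.measurable_max.const_sub h))]
  congr 2
  ext ω
  simp only [Set.mem_inter_iff, Set.mem_ofPred_eq]
  rw [and_comm, le_sub_comm]

lemma setIntegral_gap (H : IsPoissonMaximum P lam h K Y) (m : ℕ) :
    ∫ ω in {ω | K ω = m}, (h - Y ω) ∂P = poissonWeight (lam * h) m * (h / (m + 1)) := by
  have h1 := H.setIntegral_gap_pow m 0
  simp only [zero_add, pow_one, CharP.cast_eq_zero, pow_zero, mul_one] at h1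
  rw [h1, poissonWeight]
  have h2 : ∀ t : ℝ, Real.exp (-(lam * h)) * (lam * (h - t)) ^ m / m.factorial
      = (Real.exp (-(lam * h)) * lam ^ m / m.factorial) * (h - t) ^ m := fun t => by
    rw [mul_pow]; ring
  simp only [h2]
  rw [intervalIntegral.integral_const_mul,
    intervalIntegral.integral_comp_sub_left (fun u : ℝ => u ^ m) h]
  simp only [sub_self, sub_zero, integral_pow, mul_pow]
  have : (m : ℝ) + 1 ≠ 0 := by positivity
  field_simp
  simp
  ring

lemma setIntegral_gap_sq (H : IsPoissonMaximum P lam h K Y) (m : ℕ) :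
    ∫ ω in {ω | K ω = m}, (h - Y ω) ^ 2 ∂P
      = poissonWeight (lam * h) m * (2 * h ^ 2 / ((m + 1) * (m + 2))) := by
  have h1 := H.setIntegral_gap_pow m 1
  rw [h1, poissonWeight]
  have h2 : ∀ t : ℝ, Real.exp (-(lam * h)) * (lam * (h - t)) ^ m / m.factorial
        * ((((1 : ℕ) : ℝ) + 1) * t ^ 1)
      = (2 * Real.exp (-(lam * h)) * lam ^ m / m.factorial)
        * (h * (h - t) ^ m - (h - t) ^ (m + 1)) := fun t => by
    rw [mul_pow]; push_cast; ring
  simp only [h2]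
  rw [intervalIntegral.integral_const_mul,
    intervalIntegral.integral_comp_sub_left (fun u : ℝ => h * u ^ m - u ^ (m + 1)) h]
  rw [intervalIntegral.integral_sub
    ((by fun_prop : Continuous fun u : ℝ => h * u ^ m).intervalIntegrable _ _)
    ((by fun_prop : Continuous fun u : ℝ => u ^ (m + 1)).intervalIntegrable _ _)]
  simp only [sub_self, sub_zero, integral_pow, mul_pow, intervalIntegral.integral_const_mul]
  have : (m : ℝ) + 1 ≠ 0 := by positivity
  have : (m : ℝ) + 2 ≠ 0 := by positivity
  have : (m : ℝ) + 1 + 1 ≠ 0 := by positivity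
  push_cast
  field_simp
  simp
  ring

/-- The gap is an exponential variable of rate `lam` cut off at `h`: when `law` is summed over the
count, the total mass of a Poisson law of mean `lam * (h - t)` factors out. -/
lemma measureReal_gap_ge (H : IsPoissonMaximum P lam h K Y) {t : ℝ} (ht : 0 ≤ t) (hth : t ≤ h)
    (hlam : 0 ≤ lam) :
    P.real {ω | t ≤ h - Y ω} = Real.exp (-(lam * t)) := by
  have hS : MeasurableSet {ω | t ≤ h - Y ω} :=
    measurableSet_le measurable_const (H.measurable_max.const_sub h)
  have h1 := H.hasSum_setIntegral (F := {ω | t ≤ h - Y ω}.indicator 1)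
    ((integrable_const 1).indicator hS)
  rw [integral_indicator_one hS] at h1
  have h2 : ∀ m, ∫ ω in {ω | K ω = m}, {ω | t ≤ h - Y ω}.indicator (1 : Ω → ℝ) ω ∂P
      = Real.exp (-(lam * t)) * poissonWeight (lam * (h - t)) m := by
    intro m
    rw [integral_indicator_one hS, measureReal_restrict_apply hS, poissonWeight]
    have h3 := H.law m (h - t) (sub_nonneg.2 hth) (sub_le_self _ ht)
    have h4 : {ω | t ≤ h - Y ω} ∩ {ω | K ω = m} = {ω | K ω = m ∧ Y ω ≤ h - t} := by
      ext ω
      simp only [Set.mem_inter_iff, Set.mem_ofPred_eq]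
      rw [and_comm, le_sub_comm]
    rw [h4, h3, show -(lam * h) = -(lam * t) + -(lam * (h - t)) by ring, Real.exp_add]
    ring
  simp only [h2] at h1
  have h5 := (hasSum_poissonWeight (mul_nonneg hlam (sub_nonneg.2 hth))).mul_left
    (Real.exp (-(lam * t)))
  rw [mul_one] at h5
  exact h1.unique h5

lemma integral_gap_pow_le (H : IsPoissonMaximum P lam h K Y) (hlam : 0 < lam) (p : ℕ) :
    ∫ ω, (h - Y ω) ^ (p + 1) ∂P ≤ (p + 1).factorial / lam ^ (p + 1) := by
  rw [integral_pow_succ_eq_intervalIntegral _ (H.measurable_max.const_sub h)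
    (fun ω => sub_nonneg.2 (H.le ω)) (fun ω => sub_le_self _ (H.nonneg ω)) H.nonneg_height]
  have hgam := Real.integral_rpow_mul_exp_neg_mul_Ioi (a := p + 1) (r := lam) (by positivity) hlam
  rw [add_sub_cancel_right, Real.Gamma_nat_eq_factorial] at hgam
  have hgam' : ∫ t in Set.Ioi (0 : ℝ), t ^ p * Real.exp (-(lam * t))
      = (1 / lam) ^ (p + 1) * p.factorial := by
    rw [← Real.rpow_natCast, Nat.cast_add, Nat.cast_one, ← hgam]
    simp only [Real.rpow_natCast]
  -- The Gamma integral has a positive value, whereas a non-integrable function would have integral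
  -- `0`.
  have hint : IntegrableOn (fun t : ℝ => t ^ p * Real.exp (-(lam * t))) (Set.Ioi 0) := by
    by_contra hn
    rw [integral_undef hn] at hgam'
    have : 0 < (1 / lam) ^ (p + 1) * (p.factorial : ℝ) := by positivity
    exact this.ne hgam'
  calc ∫ t in (0 : ℝ)..h, P.real {ω | t ≤ h - Y ω} * ((p + 1) * t ^ p)
      = ∫ t in (0 : ℝ)..h, (p + 1) * (t ^ p * Real.exp (-(lam * t))) := by
        refine intervalIntegral.integral_congr fun t ht => ?_
        rw [Set.uIcc_of_le H.nonneg_height] at ht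
        rw [H.measureReal_gap_ge ht.1 ht.2 hlam.le]
        ring
    _ = (p + 1) * ∫ t in Set.Ioc (0 : ℝ) h, t ^ p * Real.exp (-(lam * t)) := by
        rw [intervalIntegral.integral_const_mul, intervalIntegral.integral_of_le H.nonneg_height]
    _ ≤ (p + 1) * ∫ t in Set.Ioi (0 : ℝ), t ^ p * Real.exp (-(lam * t)) := by
        refine mul_le_mul_of_nonneg_left ?_ (by positivity)
        refine setIntegral_mono_set hint ((ae_restrict_iff' measurableSet_Ioi).2
          (Eventually.of_forall fun t (ht : 0 < t) => ?_)) (Eventually.of_forall fun t ht => ht.1)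
        change (0 : ℝ) ≤ _ * _
        positivity
    _ = (p + 1).factorial / lam ^ (p + 1) := by
        rw [hgam', Nat.factorial_succ]
        push_cast
        rw [div_pow, one_pow]
        ring

/-- The bound `2 h / (K + 1)` for the correction `Y / K` uses `K + 1 ≤ 2 K` when `K ≥ 1`, and it
still makes sense at `K = 0`, where the error is `-h`. -/
lemma abs_correctedMaximum_sub_le (H : IsPoissonMaximum P lam h K Y) (ω : Ω) :
    |correctedMaximum (K ω) (Y ω) - h| ≤ (h - Y ω) + 2 * h / (K ω + 1) := by
  have h0 := H.nonneg_height
  have hY := H.nonneg ω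
  have hYh := H.le ω
  unfold correctedMaximum
  by_cases hK : K ω = 0
  · rw [H.eq_zero ω hK, mul_zero, zero_sub, abs_neg, abs_of_nonneg h0]
    have : 0 ≤ 2 * h / ((K ω : ℝ) + 1) := by positivity
    linarith
  · have hK1 : (1 : ℝ) ≤ K ω := by exact_mod_cast Nat.one_le_iff_ne_zero.2 hK
    have h1 : 1 / (K ω : ℝ) * Y ω ≤ 2 * h / ((K ω : ℝ) + 1) := by
      rw [one_div_mul_eq_div, div_le_div_iff₀ (by linarith) (by linarith)]
      nlinarith [mul_nonneg (sub_nonneg.2 hK1) hY, mul_nonneg (sub_nonneg.2 hYh)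
        (by linarith : (0 : ℝ) ≤ K ω)]
    have h2 : 0 ≤ 1 / (K ω : ℝ) * Y ω := by positivity
    rw [abs_le]
    constructor <;> nlinarith

lemma abs_correctedMaximum_sub_le_const (H : IsPoissonMaximum P lam h K Y) (ω : Ω) :
    |correctedMaximum (K ω) (Y ω) - h| ≤ 3 * h := by
  refine (H.abs_correctedMaximum_sub_le ω).trans ?_
  have h0 := H.nonneg_height
  have h1 : 2 * h / ((K ω : ℝ) + 1) ≤ 2 * h := div_le_self (by positivity) (by simp)
  linarith [H.nonneg ω]

lemma integrable_correctedMaximum_sub_pow (H : IsPoissonMaximum P lam h K Y) (j : ℕ) :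
    Integrable (fun ω => (correctedMaximum (K ω) (Y ω) - h) ^ j) P := by
  refine integrable_of_bounded ((H.measurable_correctedMaximum.sub_const h).pow_const j)
    (C := (3 * h) ^ j) fun ω => ?_
  rw [abs_pow]
  exact pow_le_pow_left₀ (abs_nonneg _) (H.abs_correctedMaximum_sub_le_const ω) j

lemma integrable_gap_pow (H : IsPoissonMaximum P lam h K Y) (j : ℕ) :
    Integrable (fun ω => (h - Y ω) ^ j) P := by
  refine integrable_of_bounded ((H.measurable_max.const_sub h).pow_const j)
    (C := h ^ j) fun ω => ?_
  rw [abs_pow, abs_of_nonneg (sub_nonneg.2 (H.le ω))]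
  exact pow_le_pow_left₀ (sub_nonneg.2 (H.le ω)) (sub_le_self _ (H.nonneg ω)) j

/-- The bias-corrected maximum is unbiased up to the probability of an empty sample. -/
lemma integral_correctedMaximum_sub (H : IsPoissonMaximum P lam h K Y) :
    ∫ ω, (correctedMaximum (K ω) (Y ω) - h) ∂P = -(h * Real.exp (-(lam * h))) := by
  have h1 := H.hasSum_setIntegral (by simpa using H.integrable_correctedMaximum_sub_pow 1)
  refine h1.unique ?_
  have h2 : ∀ m, ∫ ω in {ω | K ω = m}, (correctedMaximum (K ω) (Y ω) - h) ∂P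
      = if m = 0 then -(h * Real.exp (-(lam * h))) else 0 := by
    intro m
    split_ifs with hm
    · subst hm
      rw [setIntegral_congr_fun (H.measurableSet_count_eq 0)
        (fun ω hω => H.correctedMaximum_sub_eq_zero hω), setIntegral_const, H.prob_count]
      simp [poissonWeight, mul_comm]
    · have : (m : ℝ) ≠ 0 := by exact_mod_cast hm
      have : (m : ℝ) + 1 ≠ 0 := by positivity
      have hint : Integrable (fun ω => h - Y ω) P := by simpa using H.integrable_gap_pow 1
      -- Given `K = m ≥ 1` the gap has mean `h / (m + 1)`, and `(1 + 1 / m) * (h / (m + 1)) = h /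
      -- m`, so nonempty samples contribute nothing.
      rw [setIntegral_congr_fun (H.measurableSet_count_eq m)
        (g := fun ω => h / m - (1 + 1 / m) * (h - Y ω))
        (fun ω (hω : K ω = m) => by simp only [hω, correctedMaximum_sub_eq h hm]), integral_sub (integrable_const _)
        (hint.integrableOn.const_mul _), setIntegral_const, integral_const_mul, H.setIntegral_gap,
        H.prob_count]
      simp only [smul_eq_mul]
      field_simp
      ring
  simp only [h2]
  exact hasSum_ite_eq 0 _

/-- Given `K = m ≥ 1` the conditional second moments of the gap combine to `h ^ 2 / (m (m + 2))`; an
empty sample has error `-h`. -/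
lemma integral_correctedMaximum_sub_sq_hasSum (H : IsPoissonMaximum P lam h K Y) :
    HasSum (fun m => h ^ 2 * (poissonWeight (lam * h) m * secondMomentFactor m))
      (∫ ω, (correctedMaximum (K ω) (Y ω) - h) ^ 2 ∂P) := by
  convert H.hasSum_setIntegral (H.integrable_correctedMaximum_sub_pow 2) using 1
  funext m
  unfold secondMomentFactor
  split_ifs with hm
  · subst hm
    rw [setIntegral_congr_fun (g := fun _ => h ^ 2) (H.measurableSet_count_eq 0)
      (fun ω hω => by simp only [H.correctedMaximum_sub_eq_zero hω, neg_sq]), setIntegral_const,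
      H.prob_count]
    simp [mul_comm]
  · have : (m : ℝ) ≠ 0 := by exact_mod_cast hm
    have : (m : ℝ) + 1 ≠ 0 := by positivity
    have : (m : ℝ) + 2 ≠ 0 := by positivity
    have hint : Integrable (fun ω => h - Y ω) P := by simpa using H.integrable_gap_pow 1
    have hint2 : IntegrableOn (fun ω => (h / m) ^ 2 - 2 * (h / m) * (1 + 1 / m) * (h - Y ω))
        {ω | K ω = m} P := (integrable_const _).sub (hint.integrableOn.const_mul _)
    rw [setIntegral_congr_fun (g := fun ω => (h / m) ^ 2
        - 2 * (h / m) * (1 + 1 / m) * (h - Y ω) + (1 + 1 / (m : ℝ)) ^ 2 * (h - Y ω) ^ 2)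
        (H.measurableSet_count_eq m)
        (fun ω (hω : K ω = m) => by simp only [hω, correctedMaximum_sub_eq h hm]; ring),
      integral_add hint2 ((H.integrable_gap_pow 2).integrableOn.const_mul _),
      integral_sub (integrable_const _) (hint.integrableOn.const_mul _), setIntegral_const,
      integral_const_mul, integral_const_mul, H.setIntegral_gap, H.setIntegral_gap_sq, H.prob_count]
    simp only [smul_eq_mul]
    field_simp
    ring

lemma abs_normalized_secondMoment_sub_one_le (H : IsPoissonMaximum P lam h K Y)
    (hlam : 0 < lam) (hh : 0 < h) :
    |∫ ω, (lam * (correctedMaximum (K ω) (Y ω) - h)) ^ 2 ∂P - 1| ≤ 4 / (lam * h) := by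
  have h1 := H.integral_correctedMaximum_sub_sq_hasSum
  have h2 := h1.mul_left (1 / h ^ 2)
  have h3 : (fun m => 1 / h ^ 2 * (h ^ 2 * (poissonWeight (lam * h) m * secondMomentFactor m)))
      = fun m => poissonWeight (lam * h) m * secondMomentFactor m := by
    funext m
    field_simp
  rw [h3] at h2
  have h4 := abs_sq_mul_secondMoment_sub_one_le (mul_pos hlam hh) h2
  simp only [mul_pow, integral_const_mul]
  convert h4 using 3
  field_simp

lemma abs_integral_normalized_le (H : IsPoissonMaximum P lam h K Y) :
    |∫ ω, lam * (correctedMaximum (K ω) (Y ω) - h) ∂P|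
      = |lam * h| * Real.exp (-(lam * h)) := by
  rw [integral_const_mul, H.integral_correctedMaximum_sub, mul_neg, abs_neg, ← mul_assoc, abs_mul,
    abs_of_pos (Real.exp_pos _)]

/-- By `(a + b) ^ 3 ≤ 4 (a ^ 3 + b ^ 3)` the gap contributes `4 * 3! = 24`. The correction
contributes `4 * 8 * 6 = 192`, where `6` is the price of replacing `(K + 1) ^ 3` by `(K + 1) (K + 2)
(K + 3)`. -/
lemma normalized_thirdMoment_le (H : IsPoissonMaximum P lam h K Y)
    (hlam : 0 < lam) (hh : 0 < h) :
    ∫ ω, |lam * (correctedMaximum (K ω) (Y ω) - h)| ^ 3 ∂P ≤ 216 := by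
  have hμ : 0 < lam * h := mul_pos hlam hh
  have h1 : ∀ ω, |lam * (correctedMaximum (K ω) (Y ω) - h)| ^ 3
      ≤ 4 * lam ^ 3 * (h - Y ω) ^ 3
        + 192 * (lam * h) ^ 3 * (1 / ((K ω + 1).ascFactorial 3 : ℝ)) := by
    intro ω
    have ha := H.abs_correctedMaximum_sub_le ω
    have hz : 0 ≤ h - Y ω := sub_nonneg.2 (H.le ω)
    have hw : 0 ≤ 2 * h / ((K ω : ℝ) + 1) := by positivity
    have hb : (2 * h / ((K ω : ℝ) + 1)) ^ 3 ≤ 48 * h ^ 3 * (1 / ((K ω + 1).ascFactorial 3 : ℝ)) := by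
      have : ((K ω + 1).ascFactorial 3 : ℝ) = (K ω + 1) * (K ω + 2) * (K ω + 3) := by
        simp [Nat.ascFactorial]; ring
      have hKn : (0 : ℝ) ≤ K ω := Nat.cast_nonneg _
      rw [this, div_pow, mul_one_div, div_le_div_iff₀ (by positivity) (by positivity), mul_pow]
      have : ((K ω : ℝ) + 1) * (K ω + 2) * (K ω + 3) ≤ 6 * (K ω + 1) ^ 3 := by
        nlinarith [mul_nonneg hKn hKn, mul_nonneg hKn (mul_nonneg hKn hKn)]
      have h3 : 0 ≤ h ^ 3 := by positivity
      nlinarith [mul_le_mul_of_nonneg_left this h3]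
    rw [abs_mul, mul_pow, abs_of_pos hlam]
    calc lam ^ 3 * |correctedMaximum (K ω) (Y ω) - h| ^ 3
        ≤ lam ^ 3 * ((h - Y ω) + 2 * h / (K ω + 1)) ^ 3 := by gcongr
      _ ≤ lam ^ 3 * (4 * ((h - Y ω) ^ 3 + (2 * h / ((K ω : ℝ) + 1)) ^ 3)) := by
          gcongr
          have := add_pow_le hz hw 3
          norm_num at this
          linarith
      _ ≤ lam ^ 3 * (4 * ((h - Y ω) ^ 3
            + 48 * h ^ 3 * (1 / ((K ω + 1).ascFactorial 3 : ℝ)))) := by gcongr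
      _ = _ := by ring
  have hi2 : Integrable (fun ω => 1 / ((K ω + 1).ascFactorial 3 : ℝ)) P := by
    refine integrable_of_bounded ((measurable_from_nat (f := fun m : ℕ =>
      1 / ((m + 1).ascFactorial 3 : ℝ))).comp H.measurable_count) (C := 1) fun ω => ?_
    have : (1 : ℝ) ≤ ((K ω + 1).ascFactorial 3 : ℝ) := by
      exact_mod_cast Nat.ascFactorial_pos _ 3
    rw [abs_of_nonneg (by positivity)]
    exact div_le_one_of_le₀ this (by positivity)
  have hi1 := H.integrable_gap_pow 3
  have hL : Integrable (fun ω => |lam * (correctedMaximum (K ω) (Y ω) - h)| ^ 3) P := by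
    have := (H.integrable_correctedMaximum_sub_pow 3).norm.const_mul (lam ^ 3)
    refine this.congr (Eventually.of_forall fun ω => ?_)
    simp [abs_mul, mul_pow, abs_of_pos hlam]
  have hR : Integrable (fun ω => 4 * lam ^ 3 * (h - Y ω) ^ 3
        + 192 * (lam * h) ^ 3 * (1 / ((K ω + 1).ascFactorial 3 : ℝ))) P :=
    (hi1.const_mul _).add (hi2.const_mul _)
  refine (integral_mono hL hR h1).trans ?_
  rw [integral_add (hi1.const_mul _) (hi2.const_mul _), integral_const_mul, integral_const_mul]
  have e1 := H.integral_gap_pow_le hlam 2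
  have e2 := H.integral_inv_ascFactorial_le hμ 3
  have e1' := mul_le_mul_of_nonneg_left e1 (by positivity : 0 ≤ 4 * lam ^ 3)
  have e2' := mul_le_mul_of_nonneg_left e2 (by positivity : 0 ≤ 192 * (lam * h) ^ 3)
  have f1 : 4 * lam ^ 3 * (((2 + 1).factorial : ℝ) / lam ^ (2 + 1)) = 24 := by
    simp [Nat.factorial]; field_simp; norm_num
  have f2 : 192 * (lam * h) ^ 3 * (1 / (lam * h) ^ 3) = 192 := by field_simp
  rw [f1] at e1'
  rw [f2] at e2'
  norm_num at e1' e2' ⊢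
  linarith

end IsPoissonMaximum

/-! ### Effect of enlarging the observation set -/

lemma count_mono {X : Type*} (z : Multiset X) {A B : Set X} (h : A ⊆ B) :
    count z A ≤ count z B := by
  classical
  exact Multiset.card_le_card (Multiset.monotone_filter_right z fun a ha => h ha)

lemma extreme_mono {A B : Set (ℝ × ℝ)} (h : A ⊆ B) (hB : ∀ q ∈ B, 0 ≤ q.2)
    (z : Multiset (ℝ × ℝ)) : extreme z A ≤ extreme z B := by
  have h0 := extreme_nonneg hB z
  rw [extreme_le_iff h0]
  have := (extreme_le_iff (D := B) h0).1 le_rfl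
  exact Nat.eq_zero_of_le_zero ((count_mono z (Set.inter_subset_inter_left _ h)).trans this.le)

/-- Nothing changes unless `B` contains a point. If it does, the extreme grows by at most `M -
extreme z R`, and the two correction terms are at most `M / (K + 1)` and `2 M / (K + 1)`. The bound
is a function of `R` times a function of `B`, ready for independence. -/
lemma abs_correctedMaximum_union_sub_le {R B : Set (ℝ × ℝ)} (hd : Disjoint R B) {M : ℝ}
    (h0 : ∀ q ∈ R ∪ B, 0 ≤ q.2) (hM : ∀ q ∈ R ∪ B, q.2 ≤ M) (hM0 : 0 ≤ M) (z : Multiset (ℝ × ℝ)) :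
    |correctedMaximum (count z (R ∪ B)) (extreme z (R ∪ B))
        - correctedMaximum (count z R) (extreme z R)|
      ≤ ((M - extreme z R) + 3 * M / (count z R + 1)) * (if count z B = 0 then 0 else 1) := by
  split_ifs with hB
  · rw [extreme_union_of_count_eq_zero hB, count_union z hd, hB]
    simp
  · rw [mul_one]
    have hmono := extreme_mono (A := R) Set.subset_union_left h0 z
    have hle := extreme_le hM0 hM z
    have hR0 := extreme_nonneg (fun q hq => h0 q (Or.inl hq)) z
    have hc := count_union z hd
    have hN : (count z R : ℝ) + 1 ≤ count z (R ∪ B) := by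
      rw [hc]
      exact_mod_cast Nat.add_le_add_left (Nat.one_le_iff_ne_zero.2 hB) _
    have hK : (0 : ℝ) ≤ count z R := Nat.cast_nonneg _
    set K : ℝ := (count z R : ℝ)
    set Y := extreme z R
    set Y' := extreme z (R ∪ B)
    have e1 : 1 / (count z (R ∪ B) : ℝ) * Y' ≤ M / (K + 1) := by
      rw [one_div_mul_eq_div]
      exact div_le_div₀ hM0 hle (by positivity) hN
    have e1' : 0 ≤ 1 / (count z (R ∪ B) : ℝ) * Y' :=
      mul_nonneg (by positivity) (hR0.trans hmono)
    have e2 : 1 / K * Y ≤ 2 * M / (K + 1) := by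
      by_cases hK0 : count z R = 0
      · have : Y = 0 := extreme_of_count_eq_zero hK0
        rw [this, mul_zero]
        positivity
      · have hK1 : (1 : ℝ) ≤ K := Nat.one_le_cast.2 (Nat.one_le_iff_ne_zero.2 hK0)
        rw [one_div_mul_eq_div, div_le_div_iff₀ (by linarith) (by linarith)]
        nlinarith [mul_nonneg (sub_nonneg.2 hK1) hR0, mul_nonneg hK (sub_nonneg.2 (hmono.trans hle))]
    have e2' : 0 ≤ 1 / K * Y := mul_nonneg (by positivity) hR0
    have e3 : 3 * M / (K + 1) = M / (K + 1) + 2 * M / (K + 1) := by ring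
    unfold correctedMaximum
    rw [e3, abs_le]
    constructor <;> nlinarith

section Comparison

variable {Ω : Type*} {mΩ : MeasurableSpace Ω} {P : Measure Ω}
  {μ : Measure (ℝ × ℝ)} {N : Ω → Multiset (ℝ × ℝ)}

lemma IsPoissonProcess.measurable_correctedMaximum (hN : IsPoissonProcess P μ N) {D : Set (ℝ × ℝ)}
    (hD : MeasurableSet D) (hD0 : ∀ q ∈ D, 0 ≤ q.2) :
    Measurable fun ω => correctedMaximum (count (N ω) D) (extreme (N ω) D) :=
  (measurable_const.add ((measurable_from_nat (f := fun m : ℕ => 1 / (m : ℝ))).comp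
    (hN.measurable_count D hD))).mul (hN.measurable_extreme hD hD0)

lemma abs_correctedMaximum_le {M y : ℝ} (hy : 0 ≤ y) (hyM : y ≤ M) (m : ℕ) :
    |correctedMaximum m y| ≤ 2 * M := by
  unfold correctedMaximum
  have h1 : 1 / (m : ℝ) ≤ 1 := by
    rcases Nat.eq_zero_or_pos m with rfl | hm
    · simp
    · exact div_le_one_of_le₀ (by exact_mod_cast hm) (by positivity)
  rw [abs_of_nonneg (by positivity)]
  have h2 : (0 : ℝ) ≤ 1 / m := by positivity
  nlinarith

/-- Independence of `R` and `B` factors the expectation of the pointwise bound. The factor of `R`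
has mean at most `M - h + 1 / lam + 3 M / (lam h)`, and `B` contains a point with probability at
most `lam * (M - h)`, so `lam` cancels in the leading terms. -/
theorem IsPoissonProcess.integral_abs_correctedMaximum_union_sub_le [IsProbabilityMeasure P]
    (hN : IsPoissonProcess P μ N)
    {R B : Set (ℝ × ℝ)} (hR : MeasurableSet R) (hB : MeasurableSet B) (hd : Disjoint R B)
    {lam h M : ℝ} (hlam : 0 < lam) (hh : 0 < h) (hhM : h ≤ M)
    (h0 : ∀ q ∈ R ∪ B, 0 ≤ q.2) (hM : ∀ q ∈ R ∪ B, q.2 ≤ M)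
    (H : IsPoissonMaximum P lam h (fun ω => count (N ω) R) (fun ω => extreme (N ω) R))
    (hμB : μ B ≤ ENNReal.ofReal (lam * (M - h))) :
    Integrable (fun ω => correctedMaximum (count (N ω) (R ∪ B)) (extreme (N ω) (R ∪ B))
        - correctedMaximum (count (N ω) R) (extreme (N ω) R)) P ∧
    ∫ ω, |correctedMaximum (count (N ω) (R ∪ B)) (extreme (N ω) (R ∪ B))
        - correctedMaximum (count (N ω) R) (extreme (N ω) R)| ∂P
      ≤ (M - h) * (lam * (M - h) + 1 + 3 * M / h) := by
  have hM0 : 0 ≤ M := hh.le.trans hhM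
  have hR0 : ∀ q ∈ R, 0 ≤ q.2 := fun q hq => h0 q (Or.inl hq)
  have hB0 : ∀ q ∈ B, 0 ≤ q.2 := fun q hq => h0 q (Or.inr hq)
  have hint : Integrable (fun ω => correctedMaximum (count (N ω) (R ∪ B)) (extreme (N ω) (R ∪ B))
        - correctedMaximum (count (N ω) R) (extreme (N ω) R)) P := by
    refine Integrable.sub ?_ ?_
    · exact IsPoissonMaximum.integrable_of_bounded (hN.measurable_correctedMaximum (hR.union hB) h0)
        fun ω => abs_correctedMaximum_le (extreme_nonneg h0 _) (extreme_le hM0 hM _) _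
    · exact IsPoissonMaximum.integrable_of_bounded (hN.measurable_correctedMaximum hR hR0)
        fun ω => abs_correctedMaximum_le (extreme_nonneg hR0 _)
          (extreme_le hM0 (fun q hq => hM q (Or.inl hq)) _) _
  refine ⟨hint, ?_⟩
  let φ : ℕ × ℝ → ℝ := fun p => (M - p.2) + 3 * M / (p.1 + 1)
  let ψ : ℕ × ℝ → ℝ := fun p => if p.1 = 0 then 0 else 1
  have hφ : Measurable φ := by
    have h1 : Measurable fun p : ℕ × ℝ => 3 * M / ((p.1 : ℝ) + 1) :=
      (measurable_from_nat (f := fun m : ℕ => 3 * M / ((m : ℝ) + 1))).comp measurable_fst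
    exact (measurable_snd.const_sub M).add h1
  have hψ : Measurable ψ :=
    (measurable_from_nat (f := fun m : ℕ => if m = 0 then (0 : ℝ) else 1)).comp measurable_fst
  have hind : IndepFun (fun ω => (count (N ω) R, extreme (N ω) R))
      (fun ω => (count (N ω) B, extreme (N ω) B)) P := by
    have := hN.iIndepFun_count_extreme (fun b : Bool => if b then R else B)
      (by intro b; cases b <;> simpa) (by
        intro b b' hne
        cases b <;> cases b'
        · exact absurd rfl hne
        · exact hd.symm
        · exact hd
        · exact absurd rfl hne) (by
        intro b
        cases b
        · exact hB0
        · exact hR0)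
    exact this.indepFun (i := true) (j := false) (by simp)
  have hind2 := hind.comp hφ hψ
  have mR : Measurable fun ω => (count (N ω) R, extreme (N ω) R) :=
    (hN.measurable_count R hR).prodMk (hN.measurable_extreme hR hR0)
  have mB : Measurable fun ω => (count (N ω) B, extreme (N ω) B) :=
    (hN.measurable_count B hB).prodMk (hN.measurable_extreme hB hB0)
  have hprod := hind2.integral_mul_eq_mul_integral (hφ.comp mR).aestronglyMeasurable
    (hψ.comp mB).aestronglyMeasurable
  have hφb : ∀ ω, 0 ≤ φ (count (N ω) R, extreme (N ω) R) := fun ω =>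
    add_nonneg (sub_nonneg.2 (extreme_le hM0 (fun q hq => hM q (Or.inl hq)) _)) (by positivity)
  have hφC : ∀ ω, |φ (count (N ω) R, extreme (N ω) R)| ≤ M + 3 * M := fun ω => by
    rw [abs_of_nonneg (hφb ω)]
    refine add_le_add (sub_le_self _ (extreme_nonneg hR0 _)) (div_le_self (by positivity) (by simp))
  have hψb : ∀ p, 0 ≤ ψ p ∧ ψ p ≤ 1 := fun p => by
    by_cases hp : p.1 = 0 <;> simp [ψ, hp]
  have hiR : Integrable (fun ω => 1 / ((count (N ω) R : ℝ) + 1)) P := by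
    refine IsPoissonMaximum.integrable_of_bounded ((measurable_from_nat (f := fun m : ℕ =>
      1 / ((m : ℝ) + 1))).comp (hN.measurable_count R hR)) (C := 1) fun ω => ?_
    rw [abs_of_nonneg (by positivity)]
    exact div_le_one_of_le₀ (by simp) (by positivity)
  have hiG : Integrable (fun ω => h - extreme (N ω) R) P := by simpa using H.integrable_gap_pow 1
  have hEφ : ∫ ω, φ (count (N ω) R, extreme (N ω) R) ∂P ≤ (M - h) + 1 / lam + 3 * M / (lam * h) := by
    have e : (fun ω => φ (count (N ω) R, extreme (N ω) R))
        = fun ω => ((M - h) + (h - extreme (N ω) R)) + 3 * M * (1 / ((count (N ω) R : ℝ) + 1)) := by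
      funext ω
      simp only [φ]
      ring
    have hi1 : Integrable (fun ω => (M - h) + (h - extreme (N ω) R)) P :=
      (integrable_const _).add hiG
    rw [e, integral_add hi1 (hiR.const_mul _), integral_add (integrable_const _) hiG,
      integral_const_mul]
    have g1 := H.integral_gap_pow_le hlam 0
    have g2 := H.integral_inv_count_succ_le (mul_pos hlam hh)
    have g3 := mul_le_mul_of_nonneg_left g2 (by positivity : 0 ≤ 3 * M)
    simp only [zero_add, pow_one, Nat.factorial_one, Nat.cast_one] at g1
    simp only [integral_const, probReal_univ, one_smul]
    have : 3 * M * (1 / (lam * h)) = 3 * M / (lam * h) := by ring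
    linarith
  have hq : 0 ≤ lam * (M - h) := mul_nonneg hlam.le (sub_nonneg.2 hhM)
  have hEψ : ∫ ω, ψ (count (N ω) B, extreme (N ω) B) ∂P ≤ lam * (M - h) := by
    have hfin : μ B ≠ ⊤ := ne_top_of_le_ne_top ENNReal.ofReal_ne_top hμB
    have hS : MeasurableSet {ω | count (N ω) B = 0} :=
      hN.measurable_count B hB (measurableSet_singleton 0)
    have e : (fun ω => ψ (count (N ω) B, extreme (N ω) B))
        = {ω | count (N ω) B = 0}ᶜ.indicator (1 : Ω → ℝ) := by
      funext ω
      by_cases hω : count (N ω) B = 0 <;> simp [ψ, hω]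
    have hp := hN.prob_count hB (ENNReal.toReal_nonneg) (ENNReal.ofReal_toReal hfin).symm 0
    rw [e, integral_indicator_one hS.compl, probReal_compl_eq_one_sub hS, hp]
    have h1 : (μ B).toReal ≤ lam * (M - h) := ENNReal.toReal_le_of_le_ofReal hq hμB
    have h2 := Real.add_one_le_exp (-(μ B).toReal)
    simp
    linarith
  calc ∫ ω, |correctedMaximum (count (N ω) (R ∪ B)) (extreme (N ω) (R ∪ B))
        - correctedMaximum (count (N ω) R) (extreme (N ω) R)| ∂P
      ≤ ∫ ω, φ (count (N ω) R, extreme (N ω) R) * ψ (count (N ω) B, extreme (N ω) B) ∂P := by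
        refine integral_mono hint.abs ?_ fun ω =>
          abs_correctedMaximum_union_sub_le hd h0 hM hM0 (N ω)
        refine IsPoissonMaximum.integrable_of_bounded ((hφ.comp mR).mul (hψ.comp mB))
          (C := (M + 3 * M) * 1) fun ω => ?_
        rw [abs_mul]
        refine mul_le_mul (hφC ω) ?_ (abs_nonneg _) (by positivity)
        rw [abs_of_nonneg (hψb _).1]
        exact (hψb _).2
    _ = (∫ ω, φ (count (N ω) R, extreme (N ω) R) ∂P)
          * ∫ ω, ψ (count (N ω) B, extreme (N ω) B) ∂P := hprod
    _ ≤ ((M - h) + 1 / lam + 3 * M / (lam * h)) * (lam * (M - h)) := by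
        refine mul_le_mul hEφ hEψ (integral_nonneg fun ω => (hψb _).1) ?_
        have := sub_nonneg.2 hhM
        positivity
    _ = (M - h) * (lam * (M - h) + 1 + 3 * M / h) := by field_simp

end Comparison

/-! ### Cells, rectangles and columns -/

section Geometry

lemma cell_subset_Icc (k r : ℕ) :
    cell k r ⊆ Set.Icc ((r : ℝ) / k) (((r : ℝ) + 1) / k) := by
  unfold cell
  split_ifs with h
  · have : ((r : ℝ) + 1) / k = 1 := by
      rw [← h]; push_cast; exact div_self (by positivity)
    rw [this]
  · exact Set.Ico_subset_Icc_self

lemma cell_subset_unitInterval {k r : ℕ} (hr : r < k) : cell k r ⊆ Set.Icc (0 : ℝ) 1 := by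
  have hk : (0 : ℝ) < k := by exact_mod_cast (Nat.zero_le r).trans_lt hr
  refine (cell_subset_Icc k r).trans (Set.Icc_subset_Icc (by positivity) ?_)
  rw [div_le_one hk]
  exact_mod_cast hr

lemma Ico_subset_cell (k r : ℕ) :
    Set.Ico ((r : ℝ) / k) (((r : ℝ) + 1) / k) ⊆ cell k r := by
  unfold cell
  split_ifs with h
  · have : ((r : ℝ) + 1) / k = 1 := by
      rw [← h]; push_cast; exact div_self (by positivity)
    rw [this]
    exact Set.Ico_subset_Icc_self
  · exact subset_rfl

lemma measurableSet_cell (k r : ℕ) : MeasurableSet (cell k r) := by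
  unfold cell
  split_ifs
  · exact measurableSet_Icc
  · exact measurableSet_Ico

lemma cell_ae_eq (k r : ℕ) :
    cell k r =ᵐ[volume] Set.Ioc ((r : ℝ) / k) (((r : ℝ) + 1) / k) := by
  refine Filter.EventuallyEq.trans ?_ Ico_ae_eq_Ioc
  exact ((cell_subset_Icc k r).eventuallyLE.trans Ico_ae_eq_Icc.symm.le).antisymm
    (Ico_subset_cell k r).eventuallyLE

lemma volume_cell (k r : ℕ) : volume (cell k r) = ENNReal.ofReal (1 / k) := by
  rw [measure_congr (cell_ae_eq k r), Real.volume_Ioc]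
  congr 1
  ring

lemma setIntegral_cell (k r : ℕ) (g : ℝ → ℝ) :
    ∫ t in cell k r, g t = ∫ t in ((r : ℝ) / k)..(((r : ℝ) + 1) / k), g t := by
  rw [setIntegral_congr_set (cell_ae_eq k r), intervalIntegral.integral_of_le]
  gcongr
  linarith

lemma disjoint_cell {k r s : ℕ} (hr : r < k) (hs : s < k) (hrs : r ≠ s) :
    Disjoint (cell k r) (cell k s) := by
  wlog hlt : r < s generalizing r s
  · exact (this hs hr hrs.symm (lt_of_le_of_ne (not_lt.1 hlt) hrs.symm)).symm
  have hk : (0 : ℝ) < k := by exact_mod_cast (Nat.zero_le r).trans_lt hr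
  rw [Set.disjoint_left]
  intro t ht ht'
  have h1 : t < ((r : ℝ) + 1) / k := by
    unfold cell at ht
    rw [if_neg (by omega)] at ht
    exact ht.2
  have h2 := (cell_subset_Icc k s ht').1
  have h3 : ((r : ℝ) + 1) / k ≤ (s : ℝ) / k := by
    gcongr
    exact_mod_cast hlt
  linarith

/-- The part of the strip above a cell that lies below the level `h`. -/
def rectangle (k r : ℕ) (h : ℝ) : Set (ℝ × ℝ) := cell k r ×ˢ Set.Icc 0 h

lemma measurableSet_rectangle (k r : ℕ) (h : ℝ) : MeasurableSet (rectangle k r h) :=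
  (measurableSet_cell k r).prod measurableSet_Icc

lemma column_congr {f g : ℝ → ℝ} {k r : ℕ} (h : ∀ t ∈ cell k r, f t = g t) :
    column f k r = column g k r := by
  ext q
  simp only [column, Set.mem_ofPred_eq]
  refine and_congr_right fun hq => ?_
  rw [h _ hq]

lemma measurableSet_column {f : ℝ → ℝ} (hf : ContinuousOn f (Set.Icc 0 1)) {k r : ℕ} (hr : r < k) :
    MeasurableSet (column f k r) := by
  -- Nothing is assumed about `f` outside `[0, 1]`, so it is replaced by a continuous extension that
  -- agrees with it on the cell.
  have hc : Continuous (Set.IccExtend zero_le_one ((Set.Icc (0 : ℝ) 1).domRestrict f)) :=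
    hf.domRestrict.Icc_extend'
  rw [column_congr (g := Set.IccExtend zero_le_one ((Set.Icc (0 : ℝ) 1).domRestrict f)) fun t ht => by
    rw [Set.IccExtend_of_mem _ _ (cell_subset_unitInterval hr ht)]; rfl]
  exact (measurable_fst (measurableSet_cell k r)).inter
    ((measurableSet_le measurable_const measurable_snd).inter
      (measurableSet_le measurable_snd (hc.measurable.comp measurable_fst)))

lemma volume_cell_prod (k r : ℕ) (s : Set ℝ) :
    (volume : Measure (ℝ × ℝ)) (cell k r ×ˢ s) = ENNReal.ofReal (1 / k) * volume s := by
  rw [Measure.volume_eq_prod, Measure.prod_prod, volume_cell k r]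

lemma intensity_apply {f : ℝ → ℝ} {D : Set (ℝ × ℝ)} (hD : MeasurableSet D)
    (hsub : D ⊆ subgraph f) (c : ℝ) (n : ℕ) :
    intensity f c n D = ENNReal.ofReal (n * c) * volume D := by
  rw [intensity, Measure.smul_apply, smul_eq_mul, Measure.restrict_apply hD,
    Set.inter_eq_self_of_subset_left hsub]

end Geometry

/-! ### Replacing a column by a rectangle -/

section Columns

variable {f : ℝ → ℝ} {k r : ℕ} {h M : ℝ}

lemma rectangle_subset_column (hf : ∀ t ∈ cell k r, h ≤ f t) :
    rectangle k r h ⊆ column f k r :=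
  fun _ hq => ⟨hq.1, hq.2.1, hq.2.2.trans (hf _ hq.1)⟩

lemma column_subset_subgraph (hr : r < k) : column f k r ⊆ subgraph f :=
  fun _ hq => ⟨cell_subset_unitInterval hr hq.1, hq.2⟩

variable {Ω : Type*} {mΩ : MeasurableSpace Ω} {P : Measure Ω} {c : ℝ} {n : ℕ}
  {N : Ω → Multiset (ℝ × ℝ)}

lemma IsPoissonProcess.iIndepFun_rectangle (hN : IsPoissonProcess P (intensity f c n) N)
    (h : Fin k → ℝ) :
    iIndepFun (fun (r : Fin k) ω => correctedMaximum (count (N ω) (rectangle k r (h r)))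
      (extreme (N ω) (rectangle k r (h r)))) P := by
  have h1 := hN.iIndepFun_count_extreme (fun r : Fin k => rectangle k r (h r))
    (fun r => measurableSet_rectangle k r (h r)) (fun r s hrs => by
      refine Set.disjoint_left.2 fun q hq hq' => ?_
      exact Set.disjoint_left.1 (disjoint_cell r.2 s.2 fun h => hrs (Fin.ext h)) hq.1 hq'.1)
    (fun r q hq => hq.2.1)
  refine h1.comp (fun _ p => correctedMaximum p.1 p.2) fun _ => ?_
  exact (measurable_const.add ((measurable_from_nat (f := fun m : ℕ => 1 / (m : ℝ))).comp
    measurable_fst)).mul measurable_snd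

variable [IsProbabilityMeasure P]

lemma IsPoissonProcess.isPoissonMaximum_rectangle (hN : IsPoissonProcess P (intensity f c n) N)
    (hr : r < k) (hf : ∀ t ∈ cell k r, h ≤ f t) (hc : 0 ≤ c) (hh : 0 ≤ h) :
    IsPoissonMaximum P (n * c / k) h (fun ω => count (N ω) (rectangle k r h))
      (fun ω => extreme (N ω) (rectangle k r h)) := by
  have hsub : rectangle k r h ⊆ subgraph f :=
    (rectangle_subset_column hf).trans (column_subset_subgraph hr)
  have hR := measurableSet_rectangle k r h
  have hvol : ∀ s : Set ℝ, ∀ a : ℝ, volume s = ENNReal.ofReal a → 0 ≤ a →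
      ENNReal.ofReal (n * c) * (volume : Measure (ℝ × ℝ)) (cell k r ×ˢ s)
        = ENNReal.ofReal (n * c / k * a) := by
    intro s a hs ha
    rw [volume_cell_prod, hs, ← ENNReal.ofReal_mul (by positivity),
      ← ENNReal.ofReal_mul (by positivity)]
    congr 1
    ring
  refine hN.isPoissonMaximum hR (by positivity) hh (fun q hq => hq.2.1) (fun q hq => hq.2.2) ?_ ?_
  · intro y hy hyh
    have e : rectangle k r h ∩ {q | y < q.2} = cell k r ×ˢ Set.Ioc y h := by
      ext q
      simp only [rectangle, Set.mem_inter_iff, Set.mem_prod, Set.mem_Icc, Set.mem_ofPred_eq,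
        Set.mem_Ioc]
      constructor
      · rintro ⟨⟨h1, h2, h3⟩, h4⟩
        exact ⟨h1, h4, h3⟩
      · rintro ⟨h1, h2, h3⟩
        exact ⟨⟨h1, hy.trans h2.le, h3⟩, h2⟩
    rw [intensity_apply (hR.inter (measurableSet_lt measurable_const measurable_snd))
      (Set.inter_subset_left.trans hsub), e]
    exact hvol _ _ Real.volume_Ioc (sub_nonneg.2 hyh)
  · intro y hy hyh
    have e : rectangle k r h ∩ {q | q.2 ≤ y} = cell k r ×ˢ Set.Icc 0 y := by
      ext q
      simp only [rectangle, Set.mem_inter_iff, Set.mem_prod, Set.mem_Icc, Set.mem_ofPred_eq]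
      constructor
      · rintro ⟨⟨h1, h2, h3⟩, h4⟩
        exact ⟨h1, h2, h4⟩
      · rintro ⟨h1, h2, h3⟩
        exact ⟨⟨h1, h2, h3.trans hyh⟩, h3⟩
    rw [intensity_apply (hR.inter (measurableSet_le measurable_snd measurable_const))
      (Set.inter_subset_left.trans hsub), e]
    exact hvol _ _ (by rw [Real.volume_Icc, sub_zero]) hy

/-- Replacing a column by an inscribed rectangle changes the bias-corrected maximum, on average,
by at most the oscillation of the boundary function up to a constant. -/
theorem IsPoissonProcess.integral_abs_column_sub_rectangle_le
    (hN : IsPoissonProcess P (intensity f c n) N) (hfc : ContinuousOn f (Set.Icc 0 1))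
    (hr : r < k) (hf : ∀ t ∈ cell k r, h ≤ f t) (hfM : ∀ t ∈ cell k r, f t ≤ M)
    (hc : 0 < c) (hn : 0 < n) (hh : 0 < h) (hhM : h ≤ M) :
    Integrable (fun ω => correctedMaximum (count (N ω) (column f k r)) (extreme (N ω) (column f k r))
        - correctedMaximum (count (N ω) (rectangle k r h)) (extreme (N ω) (rectangle k r h))) P ∧
    ∫ ω, |correctedMaximum (count (N ω) (column f k r)) (extreme (N ω) (column f k r))
        - correctedMaximum (count (N ω) (rectangle k r h)) (extreme (N ω) (rectangle k r h))| ∂P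
      ≤ (M - h) * (n * c / k * (M - h) + 1 + 3 * M / h) := by
  have hk : (0 : ℝ) < k := by exact_mod_cast (Nat.zero_le r).trans_lt hr
  have hn' : (0 : ℝ) < n := by exact_mod_cast hn
  have hR := measurableSet_rectangle k r h
  have hD := measurableSet_column hfc hr
  have hsub := rectangle_subset_column hf
  have hU : rectangle k r h ∪ (column f k r \ rectangle k r h) = column f k r :=
    Set.union_sdiff_cancel hsub
  -- The leftover part lies between the levels `h` and `M`, hence has mass at most `n c / k * (M -
  -- h)`.
  have hB : column f k r \ rectangle k r h ⊆ cell k r ×ˢ Set.Ioc h M := by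
    rintro q ⟨⟨h1, h2, h3⟩, h4⟩
    refine ⟨h1, ?_, h3.trans (hfM _ h1)⟩
    by_contra hlt
    exact h4 ⟨h1, h2, not_lt.1 hlt⟩
  have key := hN.integral_abs_correctedMaximum_union_sub_le (lam := n * c / k) (h := h) (M := M)
    hR (hD.diff hR) Set.disjoint_sdiff_right (by positivity) hh hhM
    (by rw [hU]; exact fun q hq => hq.2.1)
    (by rw [hU]; exact fun q hq => hq.2.2.trans (hfM _ hq.1))
    (hN.isPoissonMaximum_rectangle hr hf hc.le hh.le) (by
      rw [intensity_apply (hD.diff hR) (Set.sdiff_subset.trans (column_subset_subgraph hr))]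
      refine (mul_le_mul_right (measure_mono hB) _).trans ?_
      rw [volume_cell_prod, Real.volume_Ioc, ← ENNReal.ofReal_mul (by positivity),
        ← ENNReal.ofReal_mul (by positivity)]
      refine ENNReal.ofReal_le_ofReal (le_of_eq ?_)
      ring)
  rwa [hU] at key

end Columns

/-! ### Characteristic function estimates -/

section CharacteristicFunctions

open Complex in
lemma norm_cexp_I_sub_taylor_le (x : ℝ) :
    ‖cexp (x * I) - (1 + x * I - x ^ 2 / 2)‖ ≤ 4 * |x| ^ 3 := by
  rcases le_or_gt |x| 1 with hx | hx
  · have h := Complex.norm_exp_sub_sum_le_norm_mul_exp (x * I) 3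
    have hn : ‖(x : ℂ) * I‖ = |x| := by simp
    rw [hn] at h
    have e : ∑ m ∈ Finset.range 3, ((x : ℂ) * I) ^ m / (m.factorial : ℂ)
        = 1 + x * I - x ^ 2 / 2 := by
      simp [Finset.sum_range_succ, mul_pow]
      ring
    rw [e] at h
    refine h.trans ?_
    have h3 : Real.exp |x| ≤ 4 := by
      have := Real.exp_one_lt_three
      have := Real.exp_le_exp.2 hx
      linarith
    have : 0 ≤ |x| ^ 3 := by positivity
    nlinarith
  · have h1 : ‖cexp (x * I)‖ = 1 := Complex.norm_exp_ofReal_mul_I x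
    have h2 : ‖(1 : ℂ) + x * I - x ^ 2 / 2‖ ≤ 1 + |x| + |x| ^ 2 / 2 := by
      refine (norm_sub_le _ _).trans (add_le_add ((norm_add_le _ _).trans ?_) ?_)
      · simp
      · simp
    refine (norm_sub_le _ _).trans ?_
    rw [h1]
    nlinarith [mul_pos (sub_pos.2 hx) (sub_pos.2 hx), pow_pos (sub_pos.2 hx) 3]

lemma abs_exp_neg_sub_one_sub_le {s : ℝ} (hs : 0 ≤ s) : |Real.exp (-s) - (1 - s)| ≤ s ^ 2 := by
  have h1 := Real.add_one_le_exp (-s)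
  rw [abs_of_nonneg (by linarith)]
  rcases le_or_gt s 1 with h | h
  · have := Real.abs_exp_sub_one_sub_id_le (x := -s) (by rwa [abs_neg, abs_of_nonneg hs])
    rw [abs_of_nonneg (by linarith)] at this
    nlinarith
  · have : Real.exp (-s) ≤ 1 := Real.exp_le_one_iff.2 (by linarith)
    nlinarith

/-- Telescoping: one factor is exchanged at a time, and the remaining factors have norm at most `1`.
-/
lemma norm_prod_sub_prod_le {ι : Type*} (s : Finset ι) (z w : ι → ℂ) (hz : ∀ i ∈ s, ‖z i‖ ≤ 1)
    (hw : ∀ i ∈ s, ‖w i‖ ≤ 1) : ‖∏ i ∈ s, z i - ∏ i ∈ s, w i‖ ≤ ∑ i ∈ s, ‖z i - w i‖ := by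
  classical
  induction s using Finset.induction_on with
  | empty => simp
  | insert a s ha ih =>
    rw [Finset.prod_insert ha, Finset.prod_insert ha, Finset.sum_insert ha]
    have hz' : ‖z a‖ ≤ 1 := hz a (Finset.mem_insert_self a s)
    have hw' : ‖∏ i ∈ s, w i‖ ≤ 1 := by
      rw [norm_prod]
      exact Finset.prod_le_one (fun i _ => norm_nonneg _)
        fun i hi => hw i (Finset.mem_insert_of_mem hi)
    have h := ih (fun i hi => hz i (Finset.mem_insert_of_mem hi))
      (fun i hi => hw i (Finset.mem_insert_of_mem hi))
    calc ‖z a * ∏ i ∈ s, z i - w a * ∏ i ∈ s, w i‖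
        = ‖(z a - w a) * ∏ i ∈ s, w i + z a * (∏ i ∈ s, z i - ∏ i ∈ s, w i)‖ := by
          congr 1; ring
      _ ≤ ‖z a - w a‖ * ‖∏ i ∈ s, w i‖ + ‖z a‖ * ‖∏ i ∈ s, z i - ∏ i ∈ s, w i‖ := by
          refine (norm_add_le _ _).trans ?_
          rw [norm_mul, norm_mul]
      _ ≤ ‖z a - w a‖ * 1 + 1 * ‖∏ i ∈ s, z i - ∏ i ∈ s, w i‖ := by gcongr
      _ ≤ _ := by linarith

variable {Ω : Type*} {mΩ : MeasurableSpace Ω} {P : Measure Ω} [IsProbabilityMeasure P]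

open Complex in
-- Both sides are compared with `1 - θ ^ 2 / 2`. The terms of the bound are the defects of the first
-- two moments, the cubic Taylor remainder, and `exp (-s) - (1 - s) ≤ s ^ 2` at `s = θ ^ 2 / 2`.
lemma norm_integral_cexp_sub_gaussian_le {ξ : Ω → ℝ} (hξ : Measurable ξ)
    (h1 : Integrable ξ P) (h2 : Integrable (fun ω => ξ ω ^ 2) P)
    (h3 : Integrable (fun ω => |ξ ω| ^ 3) P) (θ : ℝ) :
    ‖(∫ ω, cexp (((θ * ξ ω : ℝ) : ℂ) * I) ∂P) - ((Real.exp (-(θ ^ 2 / 2)) : ℝ) : ℂ)‖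
      ≤ |θ| * |∫ ω, ξ ω ∂P| + θ ^ 2 / 2 * |∫ ω, ξ ω ^ 2 ∂P - 1|
        + 4 * |θ| ^ 3 * ∫ ω, |ξ ω| ^ 3 ∂P + θ ^ 4 / 4 := by
  have hc1 : Integrable (fun ω => (ξ ω : ℂ)) P := h1.ofReal
  have hc2 : Integrable (fun ω => ((ξ ω ^ 2 : ℝ) : ℂ)) P := h2.ofReal
  have hE : Integrable (fun ω => cexp (((θ * ξ ω : ℝ) : ℂ) * I)) P := by
    refine Integrable.of_bound (by fun_prop) 1 (Eventually.of_forall fun ω => ?_)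
    rw [Complex.norm_exp_ofReal_mul_I]
  have hT0 : Integrable (fun ω => (1 : ℂ) + θ * I * (ξ ω : ℂ)) P :=
    (integrable_const _).add (hc1.const_mul _)
  have hT : Integrable (fun ω => ((1 : ℂ) + θ * I * (ξ ω : ℂ))
      - θ ^ 2 / 2 * ((ξ ω ^ 2 : ℝ) : ℂ)) P := hT0.sub (hc2.const_mul _)
  have hTi : ∫ ω, (((1 : ℂ) + θ * I * (ξ ω : ℂ)) - θ ^ 2 / 2 * ((ξ ω ^ 2 : ℝ) : ℂ)) ∂P
      = 1 + θ * I * ((∫ ω, ξ ω ∂P : ℝ) : ℂ) - θ ^ 2 / 2 * ((∫ ω, ξ ω ^ 2 ∂P : ℝ) : ℂ) := by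
    rw [integral_sub hT0 (hc2.const_mul _), integral_add (integrable_const _) (hc1.const_mul _),
      integral_const_mul, integral_const_mul, integral_complex_ofReal, integral_complex_ofReal]
    simp
  have hd : ‖(∫ ω, cexp (((θ * ξ ω : ℝ) : ℂ) * I) ∂P)
      - (1 + θ * I * ((∫ ω, ξ ω ∂P : ℝ) : ℂ) - θ ^ 2 / 2 * ((∫ ω, ξ ω ^ 2 ∂P : ℝ) : ℂ))‖
      ≤ 4 * |θ| ^ 3 * ∫ ω, |ξ ω| ^ 3 ∂P := by
    rw [← hTi, ← integral_sub hE hT, ← integral_const_mul]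
    refine norm_integral_le_of_norm_le (h3.const_mul _) (Eventually.of_forall fun ω => ?_)
    have := norm_cexp_I_sub_taylor_le (θ * ξ ω)
    rw [abs_mul, mul_pow, ← mul_assoc] at this
    refine le_trans (le_of_eq ?_) this
    congr 2
    push_cast
    ring
  have hg : ‖((Real.exp (-(θ ^ 2 / 2)) : ℝ) : ℂ) - ((1 - θ ^ 2 / 2 : ℝ) : ℂ)‖ ≤ θ ^ 4 / 4 := by
    rw [← Complex.ofReal_sub, Complex.norm_real, Real.norm_eq_abs]
    refine (abs_exp_neg_sub_one_sub_le (by positivity)).trans (le_of_eq ?_)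
    ring
  have hm : ‖(1 + θ * I * ((∫ ω, ξ ω ∂P : ℝ) : ℂ) - θ ^ 2 / 2 * ((∫ ω, ξ ω ^ 2 ∂P : ℝ) : ℂ))
      - ((1 - θ ^ 2 / 2 : ℝ) : ℂ)‖
      ≤ |θ| * |∫ ω, ξ ω ∂P| + θ ^ 2 / 2 * |∫ ω, ξ ω ^ 2 ∂P - 1| := by
    have e : (1 + θ * I * ((∫ ω, ξ ω ∂P : ℝ) : ℂ) - θ ^ 2 / 2 * ((∫ ω, ξ ω ^ 2 ∂P : ℝ) : ℂ))
      - ((1 - θ ^ 2 / 2 : ℝ) : ℂ)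
      = ((θ * ∫ ω, ξ ω ∂P : ℝ) : ℂ) * I - ((θ ^ 2 / 2 * (∫ ω, ξ ω ^ 2 ∂P - 1) : ℝ) : ℂ) := by
      push_cast
      ring
    rw [e]
    refine (norm_sub_le _ _).trans (le_of_eq ?_)
    rw [norm_mul, Complex.norm_I, mul_one, Complex.norm_real, Complex.norm_real, Real.norm_eq_abs,
      Real.norm_eq_abs, abs_mul, abs_mul, abs_of_nonneg (by positivity : 0 ≤ θ ^ 2 / 2)]
  set A := ∫ ω, cexp (((θ * ξ ω : ℝ) : ℂ) * I) ∂P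
  set B := 1 + θ * I * ((∫ ω, ξ ω ∂P : ℝ) : ℂ) - θ ^ 2 / 2 * ((∫ ω, ξ ω ^ 2 ∂P : ℝ) : ℂ)
  set D := ((1 - θ ^ 2 / 2 : ℝ) : ℂ)
  set G := ((Real.exp (-(θ ^ 2 / 2)) : ℝ) : ℂ)
  calc ‖A - G‖ = ‖(A - B) + (B - D) - (G - D)‖ := by congr 1; ring
    _ ≤ ‖A - B‖ + ‖B - D‖ + ‖G - D‖ :=
        (norm_sub_le _ _).trans (add_le_add_left (norm_add_le _ _) _)
    _ ≤ _ := by linarith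

open Complex in
lemma norm_cexp_I_sub_cexp_I_le (x y : ℝ) : ‖cexp (x * I) - cexp (y * I)‖ ≤ |x - y| := by
  have e : cexp (x * I) - cexp (y * I) = cexp (y * I) * (cexp (I * ((x - y : ℝ) : ℂ)) - 1) := by
    rw [mul_sub, ← Complex.exp_add]
    push_cast
    ring_nf
  rw [e, norm_mul, Complex.norm_exp_ofReal_mul_I, one_mul]
  exact Real.norm_exp_I_mul_ofReal_sub_one_le

end CharacteristicFunctions

/-! ### Central limit theorem for weighted triangular arrays -/

section ArrayCentralLimit

open Complex in
/-- Bound on the distance between the characteristic function of a weighted sum of independent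
variables and the Gaussian one, in terms of bounds on the moments and the weights. -/
lemma norm_integral_cexp_sum_sub_le {Ω : Type*} {mΩ : MeasurableSpace Ω} {P : Measure Ω}
    [IsProbabilityMeasure P] {ι : Type*} [Fintype ι] {ξ : ι → Ω → ℝ} (hξ : ∀ r, Measurable (ξ r))
    (hind : iIndepFun ξ P) (h1 : ∀ r, Integrable (ξ r) P)
    (h2 : ∀ r, Integrable (fun ω => ξ r ω ^ 2) P) (h3 : ∀ r, Integrable (fun ω => |ξ r ω| ^ 3) P)
    {δ ε C η : ℝ} (hδ : ∀ r, |∫ ω, ξ r ω ∂P| ≤ δ) (hε : ∀ r, |∫ ω, ξ r ω ^ 2 ∂P - 1| ≤ ε)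
    (hC : ∀ r, ∫ ω, |ξ r ω| ^ 3 ∂P ≤ C) (θ : ι → ℝ) (hη : ∀ r, |θ r| ≤ η) :
    ‖(∫ ω, cexp (((∑ r, θ r * ξ r ω : ℝ) : ℂ) * I) ∂P)
      - ((Real.exp (-((∑ r, θ r ^ 2) / 2)) : ℝ) : ℂ)‖
      ≤ (∑ r, |θ r|) * δ + (∑ r, θ r ^ 2) * (ε / 2 + 4 * η * C + η ^ 2 / 4) := by
  have hprod : ∫ ω, cexp (((∑ r, θ r * ξ r ω : ℝ) : ℂ) * I) ∂P
      = ∏ r, ∫ ω, cexp (((θ r * ξ r ω : ℝ) : ℂ) * I) ∂P := by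
    have := hind.integral_prod_comp (𝕜 := ℂ) (f := fun r x => cexp (((θ r * x : ℝ) : ℂ) * I))
      (fun r => (hξ r).aemeasurable) (fun r => by fun_prop)
    simp only [Function.comp_def] at this
    rw [← this]
    congr 1
    funext ω
    rw [Finset.prod_apply, ← Complex.exp_sum, ← Finset.sum_mul]
    push_cast
    rfl
  have hgauss : ((Real.exp (-((∑ r, θ r ^ 2) / 2)) : ℝ) : ℂ)
      = ∏ r, ((Real.exp (-(θ r ^ 2 / 2)) : ℝ) : ℂ) := by
    rw [← Complex.ofReal_prod, ← Real.exp_sum, Finset.sum_neg_distrib, Finset.sum_div]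
  rw [hprod, hgauss]
  refine (norm_prod_sub_prod_le _ _ _ (fun r _ => ?_) (fun r _ => ?_)).trans ?_
  · refine (norm_integral_le_of_norm_le (integrable_const (1 : ℝ)) (Eventually.of_forall fun ω => ?_)).trans
      (by simp)
    rw [Complex.norm_exp_ofReal_mul_I]
  · rw [Complex.norm_real, Real.norm_eq_abs, abs_of_pos (Real.exp_pos _)]
    exact Real.exp_le_one_iff.2 (by have := sq_nonneg (θ r); linarith)
  · rw [Finset.sum_mul, Finset.sum_mul, ← Finset.sum_add_distrib]
    refine Finset.sum_le_sum fun r _ => ?_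
    refine (norm_integral_cexp_sub_gaussian_le (hξ r) (h1 r) (h2 r) (h3 r) (θ r)).trans ?_
    have a0 := abs_nonneg (θ r)
    have aη := hη r
    have b3 : 0 ≤ ∫ ω, |ξ r ω| ^ 3 ∂P := integral_nonneg fun ω => by positivity
    have c1 : |θ r| * |∫ ω, ξ r ω ∂P| ≤ |θ r| * δ := mul_le_mul_of_nonneg_left (hδ r) a0
    have c2 : θ r ^ 2 / 2 * |∫ ω, ξ r ω ^ 2 ∂P - 1| ≤ θ r ^ 2 / 2 * ε :=
      mul_le_mul_of_nonneg_left (hε r) (by positivity)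
    have c3 : 4 * |θ r| ^ 3 * ∫ ω, |ξ r ω| ^ 3 ∂P ≤ θ r ^ 2 * (4 * η * C) := by
      have e : 4 * |θ r| ^ 3 * ∫ ω, |ξ r ω| ^ 3 ∂P
          = θ r ^ 2 * (4 * |θ r| * ∫ ω, |ξ r ω| ^ 3 ∂P) := by
        rw [← sq_abs]; ring
      rw [e]
      have := hC r
      have hη0 : 0 ≤ η := a0.trans aη
      gcongr
    have c4 : θ r ^ 4 / 4 ≤ θ r ^ 2 * (η ^ 2 / 4) := by
      have : θ r ^ 2 ≤ η ^ 2 := sq_le_sq' (by linarith [neg_abs_le (θ r)]) ((le_abs_self _).trans aη)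
      nlinarith [sq_nonneg (θ r)]
    nlinarith

variable {Ω : ℕ → Type*} {mΩ : ∀ n, MeasurableSpace (Ω n)} {P : (n : ℕ) → Measure (Ω n)}
  [∀ n, IsProbabilityMeasure (P n)] {p : ℕ}

open Complex in
/-- A central limit theorem for weighted sums of a triangular array with approximately standardized
entries, up to a remainder that tends to zero in `L¹`. -/
theorem tendstoInDistribution_of_weighted_sums {X : (n : ℕ) → Ω n → EuclideanSpace ℝ (Fin p)}
    (hX : ∀ n, AEMeasurable (X n) (P n)) {k : ℕ → ℕ} {ξ : (n : ℕ) → Fin (k n) → Ω n → ℝ}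
    {w : (n : ℕ) → Fin (k n) → Fin p → ℝ} {δ ε η ρ : ℕ → ℝ} {C : ℝ}
    (hξ : ∀ᶠ n in atTop, (∀ r, Measurable (ξ n r)) ∧ iIndepFun (ξ n) (P n) ∧
      (∀ r, Integrable (ξ n r) (P n)) ∧ (∀ r, Integrable (fun ω => ξ n r ω ^ 2) (P n)) ∧
      (∀ r, Integrable (fun ω => |ξ n r ω| ^ 3) (P n)))
    (hmom : ∀ᶠ n in atTop, ∀ r, |∫ ω, ξ n r ω ∂(P n)| ≤ δ n ∧
      |∫ ω, ξ n r ω ^ 2 ∂(P n) - 1| ≤ ε n ∧ ∫ ω, |ξ n r ω| ^ 3 ∂(P n) ≤ C)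
    (hε : Tendsto ε atTop (𝓝 0))
    (hwη : ∀ᶠ n in atTop, ∀ r j, |w n r j| ≤ η n) (hη : Tendsto η atTop (𝓝 0))
    (hwδ : ∀ j, Tendsto (fun n => (∑ r, |w n r j|) * δ n) atTop (𝓝 0))
    (hww : ∀ i j, Tendsto (fun n => ∑ r, w n r i * w n r j) atTop (𝓝 (if i = j then 1 else 0)))
    (hrem : ∀ᶠ n in atTop, ∀ j, Integrable (fun ω => X n ω j - ∑ r, w n r j * ξ n r ω) (P n) ∧
      ∫ ω, |X n ω j - ∑ r, w n r j * ξ n r ω| ∂(P n) ≤ ρ n)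
    (hρ : Tendsto ρ atTop (𝓝 0)) :
    TendstoInDistribution X atTop id P (multivariateGaussian 0 (1 : Matrix (Fin p) (Fin p) ℝ)) := by
  refine ⟨hX, by fun_prop, ?_⟩
  refine ProbabilityMeasure.tendsto_iff_tendsto_charFun.2 fun t => ?_
  simp only [ProbabilityMeasure.coe_mk, Measure.map_id]
  rw [charFun_multivariateGaussian Matrix.PosSemidef.one]
  -- The projection onto `t` turns the vector into one scalar weighted sum with weights `θ`, whose
  -- sum of squares tends to `∑ j, t j ^ 2`.
  let θ : (n : ℕ) → Fin (k n) → ℝ := fun n r => ∑ j, t j * w n r j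
  let T : ℝ := ∑ j, |t j|
  have hlim : Tendsto (fun n => ∑ r, θ n r ^ 2) atTop (𝓝 (∑ j, t j ^ 2)) := by
    have e : ∀ n, ∑ r, θ n r ^ 2 = ∑ i, ∑ j, t i * t j * ∑ r, w n r i * w n r j := by
      intro n
      have e1 : ∀ r, θ n r ^ 2 = ∑ i, ∑ j, t i * t j * (w n r i * w n r j) := by
        intro r
        rw [sq, Finset.sum_mul_sum]
        refine Finset.sum_congr rfl fun i _ => Finset.sum_congr rfl fun j _ => ?_
        ring
      simp only [e1, Finset.mul_sum]
      rw [Finset.sum_comm]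
      exact Finset.sum_congr rfl fun i _ => Finset.sum_comm
    have e2 : ∑ j, t j ^ 2 = ∑ i, ∑ j, t i * t j * (if i = j then 1 else 0) := by
      refine Finset.sum_congr rfl fun i _ => ?_
      simp [sq]
    simp only [e, e2]
    exact tendsto_finsetSum _ fun i _ => tendsto_finsetSum _ fun j _ => (hww i j).const_mul _
  have hgauss : Tendsto (fun n => ((Real.exp (-((∑ r, θ n r ^ 2) / 2)) : ℝ) : ℂ)) atTop
      (𝓝 (cexp (((inner ℝ t (0 : EuclideanSpace ℝ (Fin p)) : ℝ) : ℂ) * I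
        - ((t.ofLp ⬝ᵥ (1 : Matrix (Fin p) (Fin p) ℝ).mulVec t.ofLp : ℝ) : ℂ) / 2))) := by
    have e : cexp (((inner ℝ t (0 : EuclideanSpace ℝ (Fin p)) : ℝ) : ℂ) * I
        - ((t.ofLp ⬝ᵥ (1 : Matrix (Fin p) (Fin p) ℝ).mulVec t.ofLp : ℝ) : ℂ) / 2)
        = ((Real.exp (-((∑ j, t j ^ 2) / 2)) : ℝ) : ℂ) := by
      rw [Matrix.one_mulVec, inner_zero_right]
      simp only [dotProduct, ← sq]
      push_cast
      simp
    rw [e]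
    exact (Complex.continuous_ofReal.tendsto _).comp
      ((Real.continuous_exp.tendsto _).comp (hlim.div_const 2).neg)
  refine tendsto_of_tendsto_of_dist hgauss ?_
  have hbound : Tendsto (fun n => (∑ j, |t j| * ((∑ r, |w n r j|) * δ n))
      + (∑ r, θ n r ^ 2) * (ε n / 2 + 4 * (T * η n) * C + (T * η n) ^ 2 / 4) + T * ρ n)
      atTop (𝓝 0) := by
    have h1 : Tendsto (fun n => ∑ j, |t j| * ((∑ r, |w n r j|) * δ n)) atTop
        (𝓝 (∑ j, |t j| * 0)) :=
      tendsto_finsetSum _ fun j _ => (hwδ j).const_mul _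
    have h2 := hlim.mul (((hε.div_const 2).add (((hη.const_mul T).const_mul 4).mul_const C)).add
      (((hη.const_mul T).pow 2).div_const 4))
    have h3 := (h1.add h2).add (hρ.const_mul T)
    simpa using h3
  refine squeeze_zero' (Eventually.of_forall fun n => dist_nonneg) ?_ hbound
  filter_upwards [hξ, hmom, hwη, hrem] with n ⟨g1, g2, g3, g4, g5⟩ gm gw gr
  have hθη : ∀ r, |θ n r| ≤ T * η n := by
    intro r
    refine (Finset.abs_sum_le_sum_abs _ _).trans ?_
    rw [Finset.sum_mul]
    refine Finset.sum_le_sum fun j _ => ?_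
    rw [abs_mul]
    exact mul_le_mul_of_nonneg_left (gw r j) (abs_nonneg _)
  have hmain := norm_integral_cexp_sum_sub_le g1 g2 g3 g4 g5 (fun r => (gm r).1)
    (fun r => (gm r).2.1) (fun r => (gm r).2.2) (θ n) hθη
  have hchar : charFun ((P n).map (X n)) t
      = ∫ ω, cexp (((∑ j, t j * X n ω j : ℝ) : ℂ) * I) ∂(P n) := by
    rw [charFun_apply, integral_map (hX n) (by fun_prop)]
    rfl
  have hsum : ∀ ω, ∑ r, θ n r * ξ n r ω = ∑ j, t j * ∑ r, w n r j * ξ n r ω := by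
    intro ω
    simp only [θ, Finset.sum_mul, Finset.mul_sum]
    rw [Finset.sum_comm]
    refine Finset.sum_congr rfl fun j _ => Finset.sum_congr rfl fun r _ => ?_
    ring
  have hXm : ∀ j, AEMeasurable (fun ω => X n ω j) (P n) := fun j =>
    (measurable_pi_apply j).comp_aemeasurable
      ((WithLp.measurable_ofLp 2 (Fin p → ℝ)).comp_aemeasurable (hX n))
  -- Since `x ↦ exp (i x)` is 1-Lipschitz, an `L¹` remainder moves the characteristic function by no
  -- more than its norm.
  have hdiff : ‖(∫ ω, cexp (((∑ j, t j * X n ω j : ℝ) : ℂ) * I) ∂(P n))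
      - ∫ ω, cexp (((∑ r, θ n r * ξ n r ω : ℝ) : ℂ) * I) ∂(P n)‖ ≤ T * ρ n := by
    have hbd : ∀ {g : Ω n → ℝ}, AEMeasurable g (P n) →
        Integrable (fun ω => cexp ((g ω : ℂ) * I)) (P n) := by
      intro g hg
      refine Integrable.of_bound (by fun_prop) 1 (Eventually.of_forall fun ω => ?_)
      rw [Complex.norm_exp_ofReal_mul_I]
    rw [← integral_sub (hbd (Finset.aemeasurable_fun_sum _ fun j _ => (hXm j).const_mul _))
      (hbd (Finset.measurable_fun_sum _ fun r _ => (g1 r).const_mul _).aemeasurable)]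
    have hI : Integrable (fun ω => ∑ j, |t j| * |X n ω j - ∑ r, w n r j * ξ n r ω|) (P n) :=
      integrable_finsetSum _ fun j _ => (gr j).1.abs.const_mul _
    refine (norm_integral_le_of_norm_le hI (Eventually.of_forall fun ω => ?_)).trans ?_
    · refine (norm_cexp_I_sub_cexp_I_le _ _).trans ?_
      rw [hsum, ← Finset.sum_sub_distrib]
      refine (Finset.abs_sum_le_sum_abs _ _).trans (Finset.sum_le_sum fun j _ => ?_)
      rw [← mul_sub, abs_mul]
    · rw [integral_finsetSum _ fun j _ => (gr j).1.abs.const_mul _, Finset.sum_mul]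
      refine Finset.sum_le_sum fun j _ => ?_
      rw [integral_const_mul]
      exact mul_le_mul_of_nonneg_left (gr j).2 (abs_nonneg _)
  have hδθ : (∑ r, |θ n r|) * δ n ≤ ∑ j, |t j| * ((∑ r, |w n r j|) * δ n) := by
    have e : ∑ j, |t j| * ((∑ r, |w n r j|) * δ n) = ∑ r, ∑ j, |t j| * |w n r j| * δ n := by
      rw [Finset.sum_comm]
      refine Finset.sum_congr rfl fun j _ => ?_
      rw [Finset.sum_mul, Finset.mul_sum]
      refine Finset.sum_congr rfl fun r _ => ?_
      ring
    rw [e, Finset.sum_mul]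
    refine Finset.sum_le_sum fun r _ => ?_
    rw [← Finset.sum_mul]
    refine mul_le_mul_of_nonneg_right ?_ ((abs_nonneg _).trans (gm r).1)
    refine (Finset.abs_sum_le_sum_abs _ _).trans (Finset.sum_le_sum fun j _ => ?_)
    rw [abs_mul]
  rw [dist_comm, hchar, dist_eq_norm]
  calc _ ≤ ‖(∫ ω, cexp (((∑ j, t j * X n ω j : ℝ) : ℂ) * I) ∂(P n))
      - ∫ ω, cexp (((∑ r, θ n r * ξ n r ω : ℝ) : ℂ) * I) ∂(P n)‖
      + ‖(∫ ω, cexp (((∑ r, θ n r * ξ n r ω : ℝ) : ℂ) * I) ∂(P n))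
        - ((Real.exp (-((∑ r, θ n r ^ 2) / 2)) : ℝ) : ℂ)‖ := norm_sub_le_norm_sub_add_norm_sub _ _ _
    _ ≤ _ := by linarith

end ArrayCentralLimit

/-! ### Orthonormality of the trigonometric basis -/

section Trigonometric

open Real

lemma trigBasis_zero (x : ℝ) : trigBasis 0 x = 1 := by simp [trigBasis]

lemma trigBasis_odd (k : ℕ) (x : ℝ) :
    trigBasis (2 * k + 1) x = √2 * cos (2 * π * ((k + 1 : ℕ) : ℝ) * x) := by
  have h : ¬ Even (2 * k + 1) := Nat.not_even_iff_odd.2 ⟨k, rfl⟩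
  simp only [trigBasis, Nat.add_eq_zero_iff, one_ne_zero, and_false, if_false, h]
  congr 2
  push_cast
  ring

lemma trigBasis_even (k : ℕ) (x : ℝ) :
    trigBasis (2 * k + 2) x = √2 * sin (2 * π * ((k + 1 : ℕ) : ℝ) * x) := by
  have h : Even (2 * k + 2) := ⟨k + 1, by ring⟩
  simp only [trigBasis, Nat.add_eq_zero_iff, two_ne_zero, and_false, if_false, h, if_true]
  congr 2
  push_cast
  ring

lemma eq_zero_or_odd_or_even (j : ℕ) : j = 0 ∨ (∃ k, j = 2 * k + 1) ∨ ∃ k, j = 2 * k + 2 := by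
  rcases Nat.even_or_odd' j with ⟨k, rfl | rfl⟩
  · rcases k with _ | k
    · exact Or.inl rfl
    · exact Or.inr (Or.inr ⟨k, by ring⟩)
  · exact Or.inr (Or.inl ⟨k, rfl⟩)

lemma abs_trigBasis_le (j : ℕ) (x : ℝ) : |trigBasis j x| ≤ √2 := by
  have h2 : (1 : ℝ) ≤ √2 := by rw [Real.one_le_sqrt]; norm_num
  rcases eq_zero_or_odd_or_even j with rfl | ⟨k, rfl⟩ | ⟨k, rfl⟩
  · rw [trigBasis_zero, abs_one]; exact h2
  · rw [trigBasis_odd, abs_mul, abs_of_nonneg (by positivity)]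
    exact mul_le_of_le_one_right (by positivity) (abs_cos_le_one _)
  · rw [trigBasis_even, abs_mul, abs_of_nonneg (by positivity)]
    exact mul_le_of_le_one_right (by positivity) (abs_sin_le_one _)

lemma continuous_trigBasis (j : ℕ) : Continuous (trigBasis j) := by
  unfold trigBasis
  split_ifs <;> fun_prop

lemma abs_trigBasis_sub_le (j : ℕ) (x y : ℝ) :
    |trigBasis j x - trigBasis j y| ≤ √2 * (π * (j + 1)) * |x - y| := by
  have hlip : ∀ (a : ℝ), 0 ≤ a → |sin (a * x) - sin (a * y)| ≤ a * |x - y| ∧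
      |cos (a * x) - cos (a * y)| ≤ a * |x - y| := by
    intro a ha
    have e : |a * x - a * y| = a * |x - y| := by rw [← mul_sub, abs_mul, abs_of_nonneg ha]
    rw [← e]
    refine ⟨?_, ?_⟩
    · simpa [Real.dist_eq] using Real.lipschitzWith_sin.dist_le_mul (a * x) (a * y)
    · simpa [Real.dist_eq] using Real.lipschitzWith_cos.dist_le_mul (a * x) (a * y)
  have hpi := pi_pos
  have hj : (0 : ℝ) ≤ j := Nat.cast_nonneg j
  have hd := abs_nonneg (x - y)
  have h2 : 0 ≤ √2 := Real.sqrt_nonneg 2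
  unfold trigBasis
  split_ifs with h0 he
  · rw [sub_self, abs_zero]
    positivity
  · rw [← mul_sub, abs_mul, abs_of_nonneg h2, mul_assoc √2]
    have h3 := (hlip ((j : ℝ) * π) (by positivity)).1
    refine mul_le_mul_of_nonneg_left (h3.trans ?_) h2
    exact mul_le_mul_of_nonneg_right (by linarith) hd
  · rw [← mul_sub, abs_mul, abs_of_nonneg h2, mul_assoc √2]
    have h3 := (hlip (((j : ℝ) + 1) * π) (by positivity)).2
    refine mul_le_mul_of_nonneg_left (h3.trans ?_) h2
    exact mul_le_mul_of_nonneg_right (by linarith) hd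

lemma integral_cos_two_pi (z : ℤ) :
    ∫ t in (0 : ℝ)..1, cos (2 * π * z * t) = if z = 0 then 1 else 0 := by
  split_ifs with h
  · simp [h]
  · have hz : 2 * π * (z : ℝ) ≠ 0 := by
      have : (z : ℝ) ≠ 0 := by exact_mod_cast h
      positivity
    rw [intervalIntegral.integral_comp_mul_left (fun u => cos u) hz, integral_cos]
    have : sin (2 * π * z) = 0 := by
      rw [show 2 * π * (z : ℝ) = ((2 * z : ℤ) : ℝ) * π by push_cast; ring]
      exact sin_int_mul_pi _
    simp [this]

lemma integral_sin_two_pi (z : ℤ) : ∫ t in (0 : ℝ)..1, sin (2 * π * z * t) = 0 := by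
  by_cases h : z = 0
  · simp [h]
  · have hz : 2 * π * (z : ℝ) ≠ 0 := by
      have : (z : ℝ) ≠ 0 := by exact_mod_cast h
      positivity
    rw [intervalIntegral.integral_comp_mul_left (fun u => sin u) hz, integral_sin]
    have : cos (2 * π * z) = 1 := by
      rw [mul_comm]
      exact cos_int_mul_two_pi z
    simp [this]

lemma integral_trig_products (i j : ℕ) :
    (∫ t in (0 : ℝ)..1, (√2 * cos (2 * π * ((i + 1 : ℕ) : ℝ) * t))
        * (√2 * cos (2 * π * ((j + 1 : ℕ) : ℝ) * t)) = if i = j then 1 else 0) ∧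
    (∫ t in (0 : ℝ)..1, (√2 * sin (2 * π * ((i + 1 : ℕ) : ℝ) * t))
        * (√2 * sin (2 * π * ((j + 1 : ℕ) : ℝ) * t)) = if i = j then 1 else 0) ∧
    (∫ t in (0 : ℝ)..1, (√2 * sin (2 * π * ((i + 1 : ℕ) : ℝ) * t))
        * (√2 * cos (2 * π * ((j + 1 : ℕ) : ℝ) * t)) = 0) := by
  have hs : √2 * √2 = (2 : ℝ) := Real.mul_self_sqrt (by norm_num)
  -- Product-to-sum formulas leave the difference and the sum of the frequencies `i + 1` and `j +
  -- 1`; the sum never vanishes.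
  let u : ℤ := (i : ℤ) - j
  let v : ℤ := (i : ℤ) + j + 2
  have hc : ∀ z : ℤ, IntervalIntegrable (fun t => cos (2 * π * z * t)) volume 0 1 := fun z =>
    (by fun_prop : Continuous fun t => cos (2 * π * z * t)).intervalIntegrable _ _
  have hsn : ∀ z : ℤ, IntervalIntegrable (fun t => sin (2 * π * z * t)) volume 0 1 := fun z =>
    (by fun_prop : Continuous fun t => sin (2 * π * z * t)).intervalIntegrable _ _
  have hu : u = 0 ↔ i = j := by simp only [u]; omega
  have hv : v ≠ 0 := by simp only [v]; omega
  have eu : ∀ t : ℝ, 2 * π * (u : ℝ) * t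
      = 2 * π * ((i + 1 : ℕ) : ℝ) * t - 2 * π * ((j + 1 : ℕ) : ℝ) * t := fun t => by
    simp only [u]; push_cast; ring
  have ev : ∀ t : ℝ, 2 * π * (v : ℝ) * t
      = 2 * π * ((i + 1 : ℕ) : ℝ) * t + 2 * π * ((j + 1 : ℕ) : ℝ) * t := fun t => by
    simp only [v]; push_cast; ring
  refine ⟨?_, ?_, ?_⟩
  · have e : ∀ t : ℝ, (√2 * cos (2 * π * ((i + 1 : ℕ) : ℝ) * t))
        * (√2 * cos (2 * π * ((j + 1 : ℕ) : ℝ) * t))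
        = cos (2 * π * u * t) + cos (2 * π * v * t) := fun t => by
      rw [eu, ev, cos_sub, cos_add, mul_mul_mul_comm, hs]; ring
    simp only [e]
    rw [intervalIntegral.integral_add (hc u) (hc v), integral_cos_two_pi, integral_cos_two_pi,
      if_neg hv, add_zero]
    simp only [hu]
  · have e : ∀ t : ℝ, (√2 * sin (2 * π * ((i + 1 : ℕ) : ℝ) * t))
        * (√2 * sin (2 * π * ((j + 1 : ℕ) : ℝ) * t))
        = cos (2 * π * u * t) - cos (2 * π * v * t) := fun t => by
      rw [eu, ev, cos_sub, cos_add, mul_mul_mul_comm, hs]; ring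
    simp only [e]
    rw [intervalIntegral.integral_sub (hc u) (hc v), integral_cos_two_pi, integral_cos_two_pi,
      if_neg hv, sub_zero]
    simp only [hu]
  · have e : ∀ t : ℝ, (√2 * sin (2 * π * ((i + 1 : ℕ) : ℝ) * t))
        * (√2 * cos (2 * π * ((j + 1 : ℕ) : ℝ) * t))
        = sin (2 * π * u * t) + sin (2 * π * v * t) := fun t => by
      rw [eu, ev, sin_sub, sin_add, mul_mul_mul_comm, hs]; ring
    simp only [e]
    rw [intervalIntegral.integral_add (hsn u) (hsn v), integral_sin_two_pi, integral_sin_two_pi,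
      add_zero]

lemma integral_trigBasis_succ (j : ℕ) : ∫ t in (0 : ℝ)..1, trigBasis (j + 1) t = 0 := by
  rcases eq_zero_or_odd_or_even (j + 1) with h | ⟨k, h⟩ | ⟨k, h⟩
  · omega
  · rw [h]
    simp only [trigBasis_odd, intervalIntegral.integral_const_mul]
    have := integral_cos_two_pi ((k + 1 : ℕ) : ℤ)
    rw [if_neg (by omega)] at this
    simp only [Int.cast_natCast] at this
    rw [this, mul_zero]
  · rw [h]
    simp only [trigBasis_even, intervalIntegral.integral_const_mul]
    have := integral_sin_two_pi ((k + 1 : ℕ) : ℤ)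
    simp only [Int.cast_natCast] at this
    rw [this, mul_zero]

theorem integral_trigBasis_mul (i j : ℕ) :
    ∫ t in (0 : ℝ)..1, trigBasis i t * trigBasis j t = if i = j then 1 else 0 := by
  rcases eq_zero_or_odd_or_even i with rfl | ⟨k, rfl⟩ | ⟨k, rfl⟩ <;>
    rcases eq_zero_or_odd_or_even j with rfl | ⟨l, rfl⟩ | ⟨l, rfl⟩
  · simp [trigBasis_zero]
  · simpa [trigBasis_zero] using integral_trigBasis_succ (2 * l)
  · simpa [trigBasis_zero] using integral_trigBasis_succ (2 * l + 1)
  · simpa [trigBasis_zero] using integral_trigBasis_succ (2 * k)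
  · simp only [trigBasis_odd]
    rw [(integral_trig_products k l).1]
    exact if_congr (by omega) rfl rfl
  · rw [if_neg (by omega)]
    simp only [trigBasis_odd, trigBasis_even]
    refine Eq.trans ?_ (integral_trig_products l k).2.2
    exact intervalIntegral.integral_congr fun t _ => mul_comm (_ : ℝ) _
  · simpa [trigBasis_zero] using integral_trigBasis_succ (2 * k + 1)
  · rw [if_neg (by omega)]
    simp only [trigBasis_odd, trigBasis_even]
    exact (integral_trig_products k l).2.2
  · simp only [trigBasis_even]
    rw [(integral_trig_products k l).2.1]
    exact if_congr (by omega) rfl rfl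

end Trigonometric

/-! ### The Dirichlet kernel -/

section Kernel

open Real

lemma continuous_dirichletKernel (b : ℕ) (x : ℝ) : Continuous (dirichletKernel b x) :=
  continuous_finsetSum _ fun j _ => continuous_const.mul (continuous_trigBasis j)

lemma abs_dirichletKernel_le (b : ℕ) (x t : ℝ) : |dirichletKernel b x t| ≤ 2 * (b + 1) := by
  refine (Finset.abs_sum_le_sum_abs _ _).trans ?_
  have : ∀ j ∈ Finset.range (b + 1), |trigBasis j x * trigBasis j t| ≤ 2 := fun j _ => by
    rw [abs_mul, ← Real.mul_self_sqrt (by norm_num : (0 : ℝ) ≤ 2)]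
    exact mul_le_mul (abs_trigBasis_le j x) (abs_trigBasis_le j t) (abs_nonneg _) (by positivity)
  refine (Finset.sum_le_sum this).trans (le_of_eq ?_)
  simp [mul_comm]

lemma abs_dirichletKernel_sub_le (b : ℕ) (x s t : ℝ) :
    |dirichletKernel b x s - dirichletKernel b x t| ≤ 2 * π * (b + 1) ^ 2 * |s - t| := by
  unfold dirichletKernel
  rw [← Finset.sum_sub_distrib]
  refine (Finset.abs_sum_le_sum_abs _ _).trans ?_
  have : ∀ j ∈ Finset.range (b + 1), |trigBasis j x * trigBasis j s - trigBasis j x * trigBasis j t|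
      ≤ 2 * π * (b + 1) * |s - t| := fun j hj => by
    have hj' : (j : ℝ) ≤ b := by exact_mod_cast Nat.lt_succ_iff.1 (Finset.mem_range.1 hj)
    rw [← mul_sub, abs_mul]
    calc |trigBasis j x| * |trigBasis j s - trigBasis j t|
        ≤ √2 * (√2 * (π * (j + 1)) * |s - t|) :=
          mul_le_mul (abs_trigBasis_le j x) (abs_trigBasis_sub_le j s t) (abs_nonneg _)
            (by positivity)
      _ = (√2 * √2) * π * (j + 1) * |s - t| := by ring
      _ = 2 * π * (j + 1) * |s - t| := by rw [Real.mul_self_sqrt (by norm_num)]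
      _ ≤ 2 * π * (b + 1) * |s - t| := by gcongr
  refine (Finset.sum_le_sum this).trans (le_of_eq ?_)
  rw [Finset.sum_const, Finset.card_range, nsmul_eq_mul]
  push_cast
  ring

/-- The reproducing property, a consequence of orthonormality. It is what turns the covariance of
the estimates at `x` and `y` into a single value of the kernel. -/
lemma integral_dirichletKernel_mul (b : ℕ) (x y : ℝ) :
    ∫ t in (0 : ℝ)..1, dirichletKernel b x t * dirichletKernel b y t = dirichletKernel b x y := by
  have hi : ∀ i j, IntervalIntegrable (fun t => (trigBasis i x * trigBasis i t)
      * (trigBasis j y * trigBasis j t)) volume 0 1 := fun i j =>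
    ((continuous_const.mul (continuous_trigBasis i)).mul
      (continuous_const.mul (continuous_trigBasis j))).intervalIntegrable _ _
  have hi2 : ∀ i, IntervalIntegrable (fun t => ∑ j ∈ Finset.range (b + 1),
      (trigBasis i x * trigBasis i t) * (trigBasis j y * trigBasis j t)) volume 0 1 := fun i =>
    (continuous_finsetSum _ fun j _ => (continuous_const.mul (continuous_trigBasis i)).mul
      (continuous_const.mul (continuous_trigBasis j))).intervalIntegrable _ _
  simp only [dirichletKernel, Finset.sum_mul_sum]
  rw [intervalIntegral.integral_finsetSum fun i _ => hi2 i]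
  refine Finset.sum_congr rfl fun i hi' => ?_
  rw [intervalIntegral.integral_finsetSum fun j _ => hi i j]
  have e : ∀ j, ∫ t in (0 : ℝ)..1, (trigBasis i x * trigBasis i t) * (trigBasis j y * trigBasis j t)
      = if i = j then trigBasis i x * trigBasis j y else 0 := fun j => by
    have : ∀ t, (trigBasis i x * trigBasis i t) * (trigBasis j y * trigBasis j t)
        = (trigBasis i x * trigBasis j y) * (trigBasis i t * trigBasis j t) := fun t => by ring
    simp only [this, intervalIntegral.integral_const_mul, integral_trigBasis_mul]
    simp
  simp only [e]
  rw [Finset.sum_ite_eq, if_pos hi']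

/-- The periodic Dirichlet kernel `1 + 2 ∑_{j ≤ m} cos (2 π j u)`. -/
noncomputable def periodicDirichlet (m : ℕ) (u : ℝ) : ℝ :=
  1 + ∑ j ∈ Finset.range m, 2 * cos (2 * π * ((j + 1 : ℕ) : ℝ) * u)

lemma dirichletKernel_even (m : ℕ) (x t : ℝ) :
    dirichletKernel (2 * m) x t = periodicDirichlet m (x - t) := by
  have hs : √2 * √2 = (2 : ℝ) := Real.mul_self_sqrt (by norm_num)
  unfold dirichletKernel periodicDirichlet
  induction m with
  | zero => simp [trigBasis_zero]
  | succ m ih =>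
    rw [show 2 * (m + 1) + 1 = 2 * m + 1 + 1 + 1 by ring, Finset.sum_range_succ,
      Finset.sum_range_succ, ih, Finset.sum_range_succ (n := m), trigBasis_odd, trigBasis_odd,
      show 2 * m + 1 + 1 = 2 * m + 2 by ring, trigBasis_even, trigBasis_even, mul_sub, cos_sub,
      mul_mul_mul_comm, hs, mul_mul_mul_comm (√2), hs]
    ring

lemma dirichletKernel_odd (m : ℕ) (x t : ℝ) :
    dirichletKernel (2 * m + 1) x t = periodicDirichlet m (x - t)
      + 2 * (cos (2 * π * ((m + 1 : ℕ) : ℝ) * x) * cos (2 * π * ((m + 1 : ℕ) : ℝ) * t)) := by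
  have hs : √2 * √2 = (2 : ℝ) := Real.mul_self_sqrt (by norm_num)
  rw [← dirichletKernel_even]
  unfold dirichletKernel
  rw [Finset.sum_range_succ _ (2 * m + 1), trigBasis_odd, trigBasis_odd, mul_mul_mul_comm, hs]

lemma abs_cos_mul_cos_le (a b : ℝ) : |2 * (cos a * cos b)| ≤ 2 := by
  rw [abs_mul, abs_mul, abs_of_pos (by norm_num : (0 : ℝ) < 2)]
  have := mul_le_one₀ (abs_cos_le_one a) (abs_nonneg _) (abs_cos_le_one b)
  linarith

/-- For odd `b` the last cosine lacks its sine partner. This bounded term is the only obstacle to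
the kernel being a function of `x - t`. -/
lemma abs_dirichletKernel_sub_periodicDirichlet_le (b : ℕ) (x t : ℝ) :
    |dirichletKernel b x t - periodicDirichlet (b / 2) (x - t)| ≤ 2 := by
  rcases Nat.even_or_odd' b with ⟨m, rfl | rfl⟩
  · rw [dirichletKernel_even, Nat.mul_div_cancel_left m (by norm_num), sub_self, abs_zero]
    norm_num
  · rw [dirichletKernel_odd, show (2 * m + 1) / 2 = m by omega, add_sub_cancel_left]
    exact abs_cos_mul_cos_le _ _

lemma abs_periodicDirichlet_le (m : ℕ) (u : ℝ) : |periodicDirichlet m u| ≤ 2 * m + 1 := by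
  unfold periodicDirichlet
  refine (abs_add_le _ _).trans ?_
  have : |∑ j ∈ Finset.range m, 2 * cos (2 * π * ((j + 1 : ℕ) : ℝ) * u)| ≤ 2 * m := by
    refine (Finset.abs_sum_le_sum_abs _ _).trans ?_
    have : ∀ j ∈ Finset.range m, |2 * cos (2 * π * ((j + 1 : ℕ) : ℝ) * u)| ≤ 2 := fun j _ => by
      rw [abs_mul, abs_of_pos (by norm_num : (0 : ℝ) < 2)]
      have := abs_cos_le_one (2 * π * ((j + 1 : ℕ) : ℝ) * u)
      linarith
    refine (Finset.sum_le_sum this).trans (le_of_eq ?_)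
    simp [mul_comm]
  rw [abs_one]
  linarith

lemma sin_mul_periodicDirichlet (m : ℕ) (u : ℝ) :
    sin (π * u) * periodicDirichlet m u = sin (π * (2 * m + 1) * u) := by
  unfold periodicDirichlet
  induction m with
  | zero => simp
  | succ m ih =>
    rw [Finset.sum_range_succ, ← add_assoc, mul_add, ih]
    have e1 : π * (2 * m + 1) * u = 2 * π * ((m + 1 : ℕ) : ℝ) * u - π * u := by push_cast; ring
    have e2 : π * (2 * ((m + 1 : ℕ) : ℝ) + 1) * u = 2 * π * ((m + 1 : ℕ) : ℝ) * u + π * u := by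
      push_cast; ring
    rw [e1, e2, sin_sub, sin_add]
    ring

lemma abs_sin_mul_abs_periodicDirichlet_le (m : ℕ) (u : ℝ) :
    |sin (π * u)| * |periodicDirichlet m u| ≤ 1 := by
  rw [← abs_mul, sin_mul_periodicDirichlet]
  exact abs_sin_le_one _

lemma periodicDirichlet_periodic (m : ℕ) : Function.Periodic (periodicDirichlet m) 1 := by
  intro u
  unfold periodicDirichlet
  congr 1
  refine Finset.sum_congr rfl fun j _ => ?_
  rw [show 2 * π * ((j + 1 : ℕ) : ℝ) * (u + 1)
    = 2 * π * ((j + 1 : ℕ) : ℝ) * u + ((j + 1 : ℕ) : ℝ) * (2 * π) by ring, cos_add_nat_mul_two_pi]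

lemma periodicDirichlet_neg (m : ℕ) (u : ℝ) : periodicDirichlet m (-u) = periodicDirichlet m u := by
  simp [periodicDirichlet]

lemma continuous_periodicDirichlet (m : ℕ) : Continuous (periodicDirichlet m) := by
  unfold periodicDirichlet
  fun_prop

/-- The interval is cut at `1 / (2 A)` with `A = 2 m + 1`. To the left the kernel is at most `A`; to
the right `sin (π u) ≥ 2 u` bounds it by `1 / (2 u)`, which integrates to `log A / 2`. -/
lemma integral_abs_periodicDirichlet_half_le (m : ℕ) :
    ∫ u in (0 : ℝ)..(1 / 2), |periodicDirichlet m u| ≤ 1 / 2 + log (2 * m + 1) / 2 := by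
  have hA : (1 : ℝ) ≤ 2 * m + 1 := by linarith [(Nat.cast_nonneg m : (0 : ℝ) ≤ m)]
  set A : ℝ := 2 * m + 1
  have hA0 : 0 < A := by linarith
  set a : ℝ := 1 / (2 * A)
  have ha0 : 0 < a := by positivity
  have ha : a ≤ 1 / 2 := by
    rw [div_le_div_iff₀ (by positivity) (by norm_num)]
    linarith
  have hi : ∀ c d : ℝ, IntervalIntegrable (fun u => |periodicDirichlet m u|) volume c d := fun c d =>
    (continuous_periodicDirichlet m).abs.intervalIntegrable _ _
  rw [← intervalIntegral.integral_add_adjacent_intervals (hi 0 a) (hi a (1 / 2))]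
  have h1 : ∫ u in (0 : ℝ)..a, |periodicDirichlet m u| ≤ 1 / 2 := by
    refine (intervalIntegral.integral_mono_on ha0.le (hi 0 a) intervalIntegrable_const
      fun u _ => abs_periodicDirichlet_le m u).trans (le_of_eq ?_)
    rw [intervalIntegral.integral_const, sub_zero, smul_eq_mul]
    simp only [a]
    change 1 / (2 * A) * A = 1 / 2
    field_simp
  have hpos : ∀ u ∈ Set.Icc a (1 / 2), 0 < u := fun u hu => ha0.trans_le hu.1
  have hcont : IntervalIntegrable (fun u : ℝ => (1 / 2) * u⁻¹) volume a (1 / 2) := by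
    refine ContinuousOn.intervalIntegrable ?_
    rw [Set.uIcc_of_le ha]
    exact continuousOn_const.mul (continuousOn_inv₀.mono fun u hu => (hpos u hu).ne')
  have h2 : ∫ u in a..(1 / 2), |periodicDirichlet m u| ≤ log A / 2 := by
    refine (intervalIntegral.integral_mono_on ha (hi a _) hcont fun u hu => ?_).trans
      (le_of_eq ?_)
    · have hu0 := hpos u hu
      have hs : 2 * u ≤ |sin (π * u)| := by
        have := mul_le_sin (x := π * u) (by positivity) (by nlinarith [pi_pos, hu.2])
        have e : 2 / π * (π * u) = 2 * u := by field_simp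
        rw [e] at this
        exact this.trans (le_abs_self _)
      have h3 := abs_sin_mul_abs_periodicDirichlet_le m u
      rw [← div_eq_mul_inv, le_div_iff₀ hu0]
      nlinarith [mul_le_mul_of_nonneg_right hs (abs_nonneg (periodicDirichlet m u))]
    · rw [intervalIntegral.integral_const_mul, integral_inv_of_pos ha0 (by norm_num)]
      have : 1 / 2 / a = A := by simp only [a]; field_simp
      rw [this]
      ring
  linarith

/-- The logarithmic growth of the Lebesgue constant. Passing to the periodic kernel costs `2`;
periodicity and evenness then reduce the integral to twice a half period. -/
theorem integral_abs_dirichletKernel_le (b : ℕ) (x : ℝ) :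
    ∫ t in (0 : ℝ)..1, |dirichletKernel b x t| ≤ 3 + log (b + 1) := by
  set m := b / 2
  have hi : ∀ c d : ℝ, IntervalIntegrable (fun u => |periodicDirichlet m u|) volume c d := fun c d =>
    (continuous_periodicDirichlet m).abs.intervalIntegrable _ _
  have h1 : ∫ t in (0 : ℝ)..1, |dirichletKernel b x t|
      ≤ ∫ t in (0 : ℝ)..1, (|periodicDirichlet m (x - t)| + 2) := by
    refine intervalIntegral.integral_mono_on zero_le_one
      ((continuous_dirichletKernel b x).abs.intervalIntegrable _ _)
      (((continuous_periodicDirichlet m).comp (continuous_const.sub continuous_id)).abs.add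
        continuous_const |>.intervalIntegrable _ _) fun t _ => ?_
    have := abs_dirichletKernel_sub_periodicDirichlet_le b x t
    have h2 := abs_sub_abs_le_abs_sub (dirichletKernel b x t) (periodicDirichlet (b / 2) (x - t))
    change _ ≤ |periodicDirichlet (b / 2) (x - t)| + 2
    linarith
  have h2 : ∫ t in (0 : ℝ)..1, |periodicDirichlet m (x - t)|
      = 2 * ∫ u in (0 : ℝ)..(1 / 2), |periodicDirichlet m u| := by
    rw [intervalIntegral.integral_comp_sub_left (fun u => |periodicDirichlet m u|) x]
    have hper : Function.Periodic (fun u => |periodicDirichlet m u|) 1 := fun u => by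
      simp only [periodicDirichlet_periodic m u]
    have := hper.intervalIntegral_add_eq (x - 1) (-(1 / 2))
    rw [sub_add_cancel, show -(1 / 2 : ℝ) + 1 = 1 / 2 by norm_num] at this
    rw [sub_zero, this, ← intervalIntegral.integral_add_adjacent_intervals (hi _ 0) (hi 0 _)]
    have h3 := intervalIntegral.integral_comp_neg (a := 0) (b := 1 / 2)
      (fun u => |periodicDirichlet m u|)
    simp only [periodicDirichlet_neg, neg_zero] at h3
    rw [← h3]
    ring
  have hi3 : IntervalIntegrable (fun t => |periodicDirichlet m (x - t)|) volume 0 1 :=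
    ((continuous_periodicDirichlet m).comp (continuous_const.sub continuous_id)).abs.intervalIntegrable
      _ _
  rw [intervalIntegral.integral_add hi3 intervalIntegrable_const, h2,
    intervalIntegral.integral_const] at h1
  have h3 := integral_abs_periodicDirichlet_half_le m
  have h4 : log (2 * m + 1) ≤ log (b + 1) := by
    refine log_le_log (by positivity) ?_
    have : 2 * m ≤ b := Nat.mul_div_le b 2
    have : (2 : ℝ) * m ≤ b := by exact_mod_cast this
    linarith
  simp at h1
  linarith

lemma abs_dirichletKernel_self_sub_le (b : ℕ) (x : ℝ) : |dirichletKernel b x x - b| ≤ 3 := by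
  have h := abs_dirichletKernel_sub_periodicDirichlet_le b x x
  have e : periodicDirichlet (b / 2) (x - x) = 1 + 2 * ((b / 2 : ℕ) : ℝ) := by
    simp [periodicDirichlet, mul_comm]
  rw [e] at h
  have h1 : 2 * (b / 2) ≤ b := Nat.mul_div_le b 2
  have h2 : b ≤ 2 * (b / 2) + 1 := by omega
  have h1' : 2 * ((b / 2 : ℕ) : ℝ) ≤ b := by exact_mod_cast h1
  have h2' : (b : ℝ) ≤ 2 * ((b / 2 : ℕ) : ℝ) + 1 := by exact_mod_cast h2
  rw [abs_le] at h ⊢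
  constructor <;> linarith

/-- On the diagonal the kernel is `b + O(1)`. Off the diagonal it is bounded by `2 + 1 / |sin (π (x
- y))|`, independently of `b`. -/
lemma tendsto_dirichletKernel_div {b : ℕ → ℕ} (hb : Tendsto b atTop atTop) {x y : ℝ}
    (hx : x ∈ Set.Icc (0 : ℝ) 1) (hy : y ∈ Set.Icc (0 : ℝ) 1) (h01 : ¬(x = 0 ∧ y = 1))
    (h10 : ¬(x = 1 ∧ y = 0)) :
    Tendsto (fun n => dirichletKernel (b n) x y / b n) atTop (𝓝 (if x = y then 1 else 0)) := by
  have hbr : Tendsto (fun n => (b n : ℝ)) atTop atTop := tendsto_natCast_atTop_atTop.comp hb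
  have hpos : ∀ᶠ n in atTop, (0 : ℝ) < b n := hbr.eventually_gt_atTop 0
  have hC : ∀ C : ℝ, Tendsto (fun n => C / (b n : ℝ)) atTop (𝓝 0) := fun C =>
    hbr.const_div_atTop C
  rw [tendsto_iff_norm_sub_tendsto_zero]
  split_ifs with hxy
  · subst hxy
    refine squeeze_zero' (Eventually.of_forall fun n => norm_nonneg _) ?_ (hC 3)
    filter_upwards [hpos] with n hn
    rw [div_sub_one hn.ne', norm_div, Real.norm_eq_abs, Real.norm_eq_abs, abs_of_pos hn]
    gcongr
    exact abs_dirichletKernel_self_sub_le _ _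
  -- Excluding the two pairs of opposite endpoints puts `x - y` strictly between `-1` and `1`, so
  -- `0` is the only integer it could equal.
  · have hs : sin (π * (x - y)) ≠ 0 := by
      rw [Ne, sin_eq_zero_iff]
      rintro ⟨z, hz⟩
      have hz' : (z : ℝ) = x - y := by
        rw [mul_comm] at hz
        exact mul_left_cancel₀ pi_ne_zero hz
      have hlt : x - y < 1 := by
        refine lt_of_le_of_ne (by linarith [hx.2, hy.1]) fun h => h10 ⟨?_, ?_⟩
        · linarith [hx.2, hy.1]
        · linarith [hx.2, hy.1]
      have hgt : -1 < x - y := by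
        refine lt_of_le_of_ne (by linarith [hx.1, hy.2]) fun h => h01 ⟨?_, ?_⟩
        · linarith [hx.1, hy.2]
        · linarith [hx.1, hy.2]
      rw [← hz'] at hlt hgt
      have h1 : z < 1 := by exact_mod_cast hlt
      have h2 : -1 < z := by exact_mod_cast hgt
      have h0 : z = 0 := by omega
      rw [h0, Int.cast_zero] at hz'
      exact hxy (by linarith)
    refine squeeze_zero' (Eventually.of_forall fun n => norm_nonneg _) ?_
      (hC (2 + 1 / |sin (π * (x - y))|))
    filter_upwards [hpos] with n hn
    rw [sub_zero, norm_div, Real.norm_eq_abs, Real.norm_eq_abs, abs_of_pos hn]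
    gcongr
    have h1 := abs_dirichletKernel_sub_periodicDirichlet_le (b n) x y
    have h2 := abs_sub_abs_le_abs_sub (dirichletKernel (b n) x y)
      (periodicDirichlet (b n / 2) (x - y))
    have h3 : |periodicDirichlet (b n / 2) (x - y)| ≤ 1 / |sin (π * (x - y))| := by
      rw [le_div_iff₀ (abs_pos.2 hs), mul_comm]
      exact abs_sin_mul_abs_periodicDirichlet_le _ _
    linarith

end Kernel

/-! ### Decay of Fourier coefficients and truncation error -/

section FourierDecay

lemma norm_fourierCoeffOn_le {H : ℝ → ℂ} {M : ℝ} (hH : ∀ t ∈ Set.Icc (0 : ℝ) 1, ‖H t‖ ≤ M) (n : ℤ) :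
    ‖fourierCoeffOn (zero_lt_one (α := ℝ)) H n‖ ≤ M := by
  rw [fourierCoeffOn_eq_integral]
  simp only [sub_zero, div_one, one_smul]
  have := intervalIntegral.norm_integral_le_of_norm_le_const (a := (0 : ℝ)) (b := 1) (C := M)
    (f := fun t : ℝ => (fourier (-n) (t : AddCircle ((1 : ℝ) - 0))) • H t) fun t ht => by
      rw [Set.uIoc_of_le zero_le_one] at ht
      rw [norm_smul, fourier_apply, Circle.norm_coe, one_mul]
      exact hH t ⟨ht.1.le, ht.2⟩
  simpa using this

/-- One integration by parts, whose boundary term vanishes by `h01`; the gain `2 π |n|` is weakened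
to `|n|`. -/
lemma norm_fourierCoeffOn_le_deriv {G G' : ℝ → ℂ} {n : ℤ} (hn : n ≠ 0)
    (hG : ContinuousOn G (Set.Icc 0 1)) (hGG' : ∀ t ∈ Set.Ioo (0 : ℝ) 1, HasDerivAt G (G' t) t)
    (hG' : ContinuousOn G' (Set.Icc 0 1)) (h01 : G 0 = G 1) :
    ‖fourierCoeffOn (zero_lt_one (α := ℝ)) G n‖
      ≤ ‖fourierCoeffOn (zero_lt_one (α := ℝ)) G' n‖ / |(n : ℝ)| := by
  have hi : IntervalIntegrable G' volume 0 1 :=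
    ContinuousOn.intervalIntegrable (by rwa [Set.uIcc_of_le zero_le_one])
  rw [fourierCoeffOn_of_hasDerivAt_Ioo (zero_lt_one (α := ℝ)) hn
    (by rwa [Set.uIcc_of_le zero_le_one]) (by simpa using hGG') hi, h01]
  have hn' : 0 < |(n : ℝ)| := abs_pos.2 (by exact_mod_cast hn)
  have hnn : ‖(n : ℂ)‖ = |(n : ℝ)| := by
    rw [← Complex.ofReal_intCast, Complex.norm_real, Real.norm_eq_abs]
  simp only [sub_self, mul_zero, zero_sub, Complex.ofReal_one, Complex.ofReal_zero, sub_zero,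
    one_mul, norm_mul, norm_neg, norm_div, norm_one, hnn, Complex.norm_I, mul_one,
    Complex.norm_real, Real.norm_eq_abs, abs_of_pos Real.pi_pos, Complex.norm_ofNat]
  rw [one_div_mul_eq_div]
  refine div_le_div_of_nonneg_left (norm_nonneg _) hn' ?_
  have := Real.pi_gt_three
  nlinarith

lemma norm_fourierCoeffOn_le_div_sq {f f' f'' : ℝ → ℝ} {M : ℝ} {n : ℤ} (hn : n ≠ 0)
    (hf : ContinuousOn f (Set.Icc 0 1)) (hf' : ContinuousOn f' (Set.Icc 0 1))
    (hf'' : ContinuousOn f'' (Set.Icc 0 1))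
    (hd : ∀ t ∈ Set.Ioo (0 : ℝ) 1, HasDerivAt f (f' t) t)
    (hd' : ∀ t ∈ Set.Ioo (0 : ℝ) 1, HasDerivAt f' (f'' t) t)
    (h01 : f 0 = f 1) (h01' : f' 0 = f' 1) (hM : ∀ t ∈ Set.Icc (0 : ℝ) 1, |f'' t| ≤ M) :
    ‖fourierCoeffOn (zero_lt_one (α := ℝ)) (fun t => (f t : ℂ)) n‖ ≤ M / (n : ℝ) ^ 2 := by
  have hc : ∀ {g : ℝ → ℝ}, ContinuousOn g (Set.Icc 0 1) →
      ContinuousOn (fun t => (g t : ℂ)) (Set.Icc 0 1) := fun hg =>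
    Complex.continuous_ofReal.comp_continuousOn hg
  have hn' : 0 < |(n : ℝ)| := abs_pos.2 (by exact_mod_cast hn)
  have h1 := norm_fourierCoeffOn_le_deriv hn (hc hf) (G' := fun t => (f' t : ℂ))
    (fun t ht => (hd t ht).ofReal_comp) (hc hf') (by simp only [h01])
  have h2 := norm_fourierCoeffOn_le_deriv hn (hc hf') (G' := fun t => (f'' t : ℂ))
    (fun t ht => (hd' t ht).ofReal_comp) (hc hf'') (by simp only [h01'])
  have h3 := norm_fourierCoeffOn_le (H := fun t => (f'' t : ℂ)) (M := M) (fun t ht => by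
    rw [Complex.norm_real]; exact hM t ht) n
  rw [← sq_abs, sq, ← div_div]
  refine h1.trans ?_
  gcongr
  refine h2.trans ?_
  gcongr

/-- The `j`-th term of the trigonometric series of `f`. -/
noncomputable def fourierTerm (f : ℝ → ℝ) (j : ℕ) (x : ℝ) : ℝ :=
  ∫ t in (0 : ℝ)..1, 2 * Real.cos (2 * Real.pi * (j : ℝ) * (x - t)) * f t

open Complex in
-- Pairs the frequencies `j` and `-j`. At `j = 0` the mean of `f` is counted twice, hence the extra
-- integral in `hasSum_fourierTerm`.
lemma fourierCoeffOn_mul_add {f : ℝ → ℝ} (hf : ContinuousOn f (Set.Icc 0 1)) (j : ℕ) (x : ℝ) :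
    fourierCoeffOn (zero_lt_one (α := ℝ)) (fun t => (f t : ℂ)) j
        * fourier (j : ℤ) (x : AddCircle (1 : ℝ))
      + fourierCoeffOn (zero_lt_one (α := ℝ)) (fun t => (f t : ℂ)) (-j)
        * fourier (-j : ℤ) (x : AddCircle (1 : ℝ)) = (fourierTerm f j x : ℂ) := by
  have hi : ∀ n : ℤ, IntervalIntegrable (fun t : ℝ =>
      (fourier (-n) (t : AddCircle ((1 : ℝ) - 0)) • (f t : ℂ)) * fourier n (x : AddCircle (1 : ℝ)))
      volume 0 1 := by
    intro n
    refine ContinuousOn.intervalIntegrable ?_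
    rw [Set.uIcc_of_le zero_le_one]
    simp only [smul_eq_mul]
    exact (((map_continuous (fourier (-n))).comp (AddCircle.continuous_mk' _)).continuousOn.mul
      (Complex.continuous_ofReal.comp_continuousOn hf)).mul continuousOn_const
  rw [fourierCoeffOn_eq_integral, fourierCoeffOn_eq_integral]
  simp only [sub_zero, div_one, one_smul]
  rw [← intervalIntegral.integral_mul_const, ← intervalIntegral.integral_mul_const,
    ← intervalIntegral.integral_add (by simpa using hi j) (by simpa using hi (-j)), fourierTerm,
    ← intervalIntegral.integral_ofReal]
  refine intervalIntegral.integral_congr fun t _ => ?_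
  simp only [fourier_coe_apply, smul_eq_mul]
  push_cast
  have key : ∀ a b c : ℂ, cexp a * c * cexp b = cexp (a + b) * c := fun a b c => by
    rw [Complex.exp_add]; ring
  rw [Complex.cos, key, key]
  have e1 : 2 * (Real.pi : ℂ) * I * -j * t / 1 + 2 * Real.pi * I * j * x / 1
      = 2 * Real.pi * j * (x - t) * I := by ring
  have e2 : 2 * (Real.pi : ℂ) * I * - -j * t / 1 + 2 * Real.pi * I * -j * x / 1
      = -(2 * Real.pi * j * (x - t)) * I := by ring
  simp only [sub_zero]
  rw [e1, e2]
  ring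

lemma abs_fourierTerm_le {f : ℝ → ℝ} (hf : ContinuousOn f (Set.Icc 0 1)) {M : ℝ}
    (hM : ∀ n : ℤ, n ≠ 0 →
      ‖fourierCoeffOn (zero_lt_one (α := ℝ)) (fun t => (f t : ℂ)) n‖ ≤ M / (n : ℝ) ^ 2)
    {j : ℕ} (hj : j ≠ 0) (x : ℝ) : |fourierTerm f j x| ≤ 2 * M * ((j : ℝ) ^ 2)⁻¹ := by
  have h1 := hM j (by exact_mod_cast hj)
  have h2 := hM (-j) (by simpa using hj)
  rw [← Real.norm_eq_abs, ← Complex.norm_real, ← fourierCoeffOn_mul_add hf]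
  refine (norm_add_le _ _).trans ?_
  rw [norm_mul, norm_mul, fourier_apply, fourier_apply, Circle.norm_coe, Circle.norm_coe, mul_one,
    mul_one]
  refine (add_le_add h1 h2).trans (le_of_eq ?_)
  push_cast
  ring

/-- With `f 0 = f 1` the periodic extension is continuous, and summable coefficients make its
Fourier series converge at every point. -/
lemma hasSum_fourierTerm {f : ℝ → ℝ} (hf : ContinuousOn f (Set.Icc 0 1)) {M : ℝ}
    (hM : ∀ n : ℤ, n ≠ 0 →
      ‖fourierCoeffOn (zero_lt_one (α := ℝ)) (fun t => (f t : ℂ)) n‖ ≤ M / (n : ℝ) ^ 2)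
    (h01 : f 0 = f 1) {x : ℝ} (hx : x ∈ Set.Ico (0 : ℝ) 1) :
    HasSum (fun j => fourierTerm f j x) (f x + ∫ t in (0 : ℝ)..1, f t) := by
  let F : C(AddCircle (1 : ℝ), ℂ) := ⟨AddCircle.liftIco 1 0 (fun t => (f t : ℂ)),
    AddCircle.liftIco_continuous (by simp [h01])
      (Complex.continuous_ofReal.comp_continuousOn (by simpa using hf))⟩
  have hcoef : ∀ n, fourierCoeff F n
      = fourierCoeffOn (zero_lt_one (α := ℝ)) (fun t => (f t : ℂ)) n := by
    intro n
    have := fourierCoeff_liftIco_eq (T := 1) (a := 0) (fun t => (f t : ℂ)) n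
    simp only [zero_add] at this
    exact this
  have hsq : Summable fun n : ℕ => M * ((n : ℝ) ^ 2)⁻¹ :=
    (Real.summable_nat_pow_inv.2 (by norm_num)).mul_left _
  have hsum : Summable (fourierCoeff F) := by
    have hnat : Summable fun n : ℕ => fourierCoeff F n := by
      refine Summable.of_norm_bounded_eventually_nat hsq ?_
      filter_upwards [eventually_ne_atTop 0] with n hn
      rw [hcoef]
      exact hM n (by exact_mod_cast hn)
    have hneg : Summable fun n : ℕ => fourierCoeff F (-n) := by
      refine Summable.of_norm_bounded_eventually_nat hsq ?_
      filter_upwards [eventually_ne_atTop 0] with n hn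
      rw [hcoef]
      simpa [div_eq_mul_inv] using hM (-n) (by simpa using hn)
    exact Summable.of_nat_of_neg hnat hneg
  have h := (has_pointwise_sum_fourier_series_of_summable hsum (x : AddCircle (1 : ℝ))).nat_add_neg
  have hFx : F (x : AddCircle (1 : ℝ)) = (f x : ℂ) :=
    AddCircle.liftIco_coe_apply (p := (1 : ℝ)) (a := 0) (f := fun t => (f t : ℂ)) (by simpa using hx)
  have h0 : fourierCoeff F 0 = ((∫ t in (0 : ℝ)..1, f t : ℝ) : ℂ) := by
    rw [hcoef, fourierCoeffOn_eq_integral, ← intervalIntegral.integral_ofReal]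
    simp
  simp only [hFx, h0, fourier_zero, smul_eq_mul, mul_one, hcoef, fourierCoeffOn_mul_add hf] at h
  rw [← Complex.ofReal_add] at h
  exact Complex.hasSum_ofReal.1 h

lemma integral_periodicDirichlet_mul {f : ℝ → ℝ} (hf : ContinuousOn f (Set.Icc 0 1)) (m : ℕ)
    (x : ℝ) : ∫ t in (0 : ℝ)..1, periodicDirichlet m (x - t) * f t
      = (∑ j ∈ Finset.range (m + 1), fourierTerm f j x) - ∫ t in (0 : ℝ)..1, f t := by
  have hfi : IntervalIntegrable f volume 0 1 :=
    ContinuousOn.intervalIntegrable (by rwa [Set.uIcc_of_le zero_le_one])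
  have hi : ∀ j : ℕ, IntervalIntegrable (fun t => 2 * Real.cos (2 * Real.pi * (j : ℝ) * (x - t)) * f t)
      volume 0 1 := fun j =>
    hfi.continuousOn_mul (Continuous.continuousOn (by fun_prop))
  have h0 : fourierTerm f 0 x = 2 * ∫ t in (0 : ℝ)..1, f t := by
    simp [fourierTerm]
  rw [Finset.sum_range_succ', h0]
  have e : ∀ t, periodicDirichlet m (x - t) * f t = f t + ∑ j ∈ Finset.range m,
      2 * Real.cos (2 * Real.pi * ((j + 1 : ℕ) : ℝ) * (x - t)) * f t := fun t => by
    rw [periodicDirichlet, add_mul, one_mul, Finset.sum_mul]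
  simp only [e]
  have hs : IntervalIntegrable (fun t => ∑ j ∈ Finset.range m,
      2 * Real.cos (2 * Real.pi * ((j + 1 : ℕ) : ℝ) * (x - t)) * f t) volume 0 1 := by
    simpa [Finset.sum_fn] using IntervalIntegrable.sum (Finset.range m) fun j _ => hi (j + 1)
  rw [intervalIntegral.integral_add hfi hs, intervalIntegral.integral_finsetSum fun j _ => hi (j + 1)]
  simp only [fourierTerm]
  ring

/-- The tail of the series is at most `2 M ∑_{j > m} 1 / j ^ 2 ≤ 2 M / m`; the bound holds for
finite tails and passes to the limit. -/
lemma abs_sum_fourierTerm_sub_le {f : ℝ → ℝ} (hf : ContinuousOn f (Set.Icc 0 1)) {M : ℝ}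
    (hM0 : 0 ≤ M) (hM : ∀ n : ℤ, n ≠ 0 →
      ‖fourierCoeffOn (zero_lt_one (α := ℝ)) (fun t => (f t : ℂ)) n‖ ≤ M / (n : ℝ) ^ 2)
    (h01 : f 0 = f 1) {x : ℝ} (hx : x ∈ Set.Ico (0 : ℝ) 1) {m : ℕ} (hm : m ≠ 0) :
    |(∑ j ∈ Finset.range (m + 1), fourierTerm f j x) - (f x + ∫ t in (0 : ℝ)..1, f t)|
      ≤ 2 * M / m := by
  have h := ((hasSum_fourierTerm hf hM h01 hx).tendsto_sum_nat.const_sub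
    (∑ j ∈ Finset.range (m + 1), fourierTerm f j x)).abs
  refine le_of_tendsto h ?_
  filter_upwards [eventually_ge_atTop (m + 1)] with N hN
  obtain ⟨N', rfl⟩ : ∃ N', N = N' + 1 := ⟨N - 1, by omega⟩
  have hmN : m ≤ N' := by omega
  have e : ∑ j ∈ Finset.range (N' + 1), fourierTerm f j x
      = (∑ j ∈ Finset.range (m + 1), fourierTerm f j x) + ∑ j ∈ Finset.Ioc m N', fourierTerm f j x := by
    rw [← Finset.sum_range_add_sum_Ico _ hN]
    congr 2
    ext j
    simp only [Finset.mem_Ico, Finset.mem_Ioc]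
    omega
  rw [e, sub_add_cancel_left, abs_neg]
  calc |∑ j ∈ Finset.Ioc m N', fourierTerm f j x|
      ≤ ∑ j ∈ Finset.Ioc m N', 2 * M * ((j : ℝ) ^ 2)⁻¹ :=
        (Finset.abs_sum_le_sum_abs _ _).trans (Finset.sum_le_sum fun j hj =>
          abs_fourierTerm_le hf hM (by have := (Finset.mem_Ioc.1 hj).1; omega) x)
    _ = 2 * M * ∑ j ∈ Finset.Ioc m N', ((j : ℝ) ^ 2)⁻¹ := by rw [Finset.mul_sum]
    _ ≤ 2 * M * (m : ℝ)⁻¹ := by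
        refine mul_le_mul_of_nonneg_left ((sum_Ioc_inv_sq_le_sub hm hmN).trans ?_) (by positivity)
        exact sub_le_self _ (by positivity)
    _ = 2 * M / m := by ring

/-- Handles the unpaired cosine of an odd truncation index: by product-to-sum it is the average of
the Fourier terms at `x` and at `-x`. -/
lemma abs_integral_cos_mul_cos_le {f : ℝ → ℝ} (hf : ContinuousOn f (Set.Icc 0 1)) {M : ℝ}
    (hM : ∀ n : ℤ, n ≠ 0 →
      ‖fourierCoeffOn (zero_lt_one (α := ℝ)) (fun t => (f t : ℂ)) n‖ ≤ M / (n : ℝ) ^ 2)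
    {j : ℕ} (hj : j ≠ 0) (x : ℝ) :
    |∫ t in (0 : ℝ)..1, 2 * (Real.cos (2 * Real.pi * (j : ℝ) * x)
      * Real.cos (2 * Real.pi * (j : ℝ) * t)) * f t| ≤ 2 * M * ((j : ℝ) ^ 2)⁻¹ := by
  have hfi : IntervalIntegrable f volume 0 1 :=
    ContinuousOn.intervalIntegrable (by rwa [Set.uIcc_of_le zero_le_one])
  have hi : ∀ y : ℝ, IntervalIntegrable (fun t => 2 * Real.cos (2 * Real.pi * (j : ℝ) * (y - t)) * f t)
      volume 0 1 := fun y =>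
    hfi.continuousOn_mul (Continuous.continuousOn (by fun_prop))
  have e : ∀ t, 2 * (Real.cos (2 * Real.pi * (j : ℝ) * x) * Real.cos (2 * Real.pi * (j : ℝ) * t))
      * f t = (1 / 2) * (2 * Real.cos (2 * Real.pi * (j : ℝ) * (x - t)) * f t
        + 2 * Real.cos (2 * Real.pi * (j : ℝ) * (-x - t)) * f t) := fun t => by
    rw [mul_sub, mul_sub, mul_neg, ← neg_add', Real.cos_neg, Real.cos_sub, Real.cos_add]
    ring
  simp only [e]
  rw [intervalIntegral.integral_const_mul, intervalIntegral.integral_add (hi x) (hi (-x))]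
  change |1 / 2 * (fourierTerm f j x + fourierTerm f j (-x))| ≤ _
  have h1 := abs_fourierTerm_le hf hM hj x
  have h2 := abs_fourierTerm_le hf hM hj (-x)
  rw [abs_mul, abs_of_pos (by norm_num : (0 : ℝ) < 1 / 2)]
  have h3 := abs_add_le (fourierTerm f j x) (fourierTerm f j (-x))
  linarith

lemma dirichletKernel_one (b : ℕ) (t : ℝ) : dirichletKernel b 1 t = dirichletKernel b 0 t := by
  unfold dirichletKernel
  refine Finset.sum_congr rfl fun j _ => ?_
  congr 1
  rcases eq_zero_or_odd_or_even j with rfl | ⟨k, rfl⟩ | ⟨k, rfl⟩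
  · rw [trigBasis_zero, trigBasis_zero]
  · rw [trigBasis_odd, trigBasis_odd, show 2 * Real.pi * ((k + 1 : ℕ) : ℝ) * 1
      = 0 + ((k + 1 : ℕ) : ℝ) * (2 * Real.pi) by ring, Real.cos_add_nat_mul_two_pi, mul_zero]
  · rw [trigBasis_even, trigBasis_even, show 2 * Real.pi * ((k + 1 : ℕ) : ℝ) * 1
      = 0 + ((k + 1 : ℕ) : ℝ) * (2 * Real.pi) by ring, Real.sin_add_nat_mul_two_pi, mul_zero]

/-- The truncated trigonometric series converges at rate `1 / b`. -/
theorem abs_integral_dirichletKernel_mul_sub_le {f : ℝ → ℝ} (hf : ContinuousOn f (Set.Icc 0 1))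
    {M : ℝ} (hM0 : 0 ≤ M) (hM : ∀ n : ℤ, n ≠ 0 →
      ‖fourierCoeffOn (zero_lt_one (α := ℝ)) (fun t => (f t : ℂ)) n‖ ≤ M / (n : ℝ) ^ 2)
    (h01 : f 0 = f 1) {x : ℝ} (hx : x ∈ Set.Icc (0 : ℝ) 1) {b : ℕ} (hb : 2 ≤ b) :
    |(∫ t in (0 : ℝ)..1, dirichletKernel b x t * f t) - f x| ≤ 12 * M / b := by
  -- The pointwise convergence is available on `[0, 1)`; at `x = 1` both the kernel and `f` take
  -- their values at `0`.
  wlog hx1 : x < 1 generalizing x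
  · have : x = 1 := le_antisymm hx.2 (not_lt.1 hx1)
    subst this
    simp only [dirichletKernel_one, ← h01]
    exact this ⟨le_rfl, zero_le_one⟩ one_pos
  have hfi : IntervalIntegrable f volume 0 1 :=
    ContinuousOn.intervalIntegrable (by rwa [Set.uIcc_of_le zero_le_one])
  have key : ∀ m : ℕ, m ≠ 0 →
      |(∫ t in (0 : ℝ)..1, periodicDirichlet m (x - t) * f t) - f x| ≤ 2 * M / m := by
    intro m hm
    rw [integral_periodicDirichlet_mul hf, sub_sub, add_comm _ (f x)]
    exact abs_sum_fourierTerm_sub_le hf hM0 hM h01 ⟨hx.1, hx1⟩ hm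
  rcases Nat.even_or_odd' b with ⟨m, rfl | rfl⟩
  · have hm : m ≠ 0 := by omega
    have hm' : (0 : ℝ) < m := by positivity
    simp only [dirichletKernel_even]
    refine (key m hm).trans ?_
    push_cast
    rw [div_le_div_iff₀ hm' (by positivity)]
    nlinarith [mul_nonneg hM0 hm'.le]
  · have hm : m ≠ 0 := by omega
    have hm1 : (1 : ℝ) ≤ m := by exact_mod_cast Nat.one_le_iff_ne_zero.2 hm
    have h2 := abs_integral_cos_mul_cos_le hf hM (Nat.succ_ne_zero m) x
    have e : ∀ t, dirichletKernel (2 * m + 1) x t * f t = periodicDirichlet m (x - t) * f t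
        + 2 * (Real.cos (2 * Real.pi * ((m + 1 : ℕ) : ℝ) * x)
          * Real.cos (2 * Real.pi * ((m + 1 : ℕ) : ℝ) * t)) * f t := fun t => by
      rw [dirichletKernel_odd, add_mul]
    have hi1 : IntervalIntegrable (fun t => periodicDirichlet m (x - t) * f t) volume 0 1 :=
      hfi.continuousOn_mul ((continuous_periodicDirichlet m).comp
        (continuous_const.sub continuous_id)).continuousOn
    have hi2 : IntervalIntegrable (fun t => 2 * (Real.cos (2 * Real.pi * ((m + 1 : ℕ) : ℝ) * x)
          * Real.cos (2 * Real.pi * ((m + 1 : ℕ) : ℝ) * t)) * f t) volume 0 1 :=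
      hfi.continuousOn_mul (Continuous.continuousOn (by fun_prop))
    simp only [e]
    rw [intervalIntegral.integral_add hi1 hi2, add_sub_right_comm]
    refine (abs_add_le _ _).trans ((add_le_add (key m hm) h2).trans ?_)
    have h3 : 2 * M * ((((m + 1 : ℕ) : ℝ)) ^ 2)⁻¹ ≤ 2 * M / m := by
      rw [← div_eq_mul_inv]
      refine div_le_div_of_nonneg_left (by positivity) (by linarith) ?_
      push_cast
      nlinarith
    refine (add_le_add_right h3 _).trans ?_
    -- The constant `12` comes from here: `4 M / m ≤ 12 M / (2 m + 1)` because `m ≥ 1`.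
    rw [← add_div, div_le_div_iff₀ (by linarith) (by positivity)]
    push_cast
    nlinarith [mul_nonneg hM0 (sub_nonneg.2 hm1)]

end FourierDecay

/-! ### Constants extracted from the smoothness of `f` -/

section Smooth

lemma uniqueDiffOn_unitInterval : UniqueDiffOn ℝ (Set.Icc (0 : ℝ) 1) :=
  uniqueDiffOn_Icc zero_lt_one

lemma exists_fourierCoeffOn_bound {f : ℝ → ℝ} (hf : ContDiffOn ℝ 2 f (Set.Icc 0 1))
    (h01 : f 0 = f 1)
    (h01' : derivWithin f (Set.Icc 0 1) 0 = derivWithin f (Set.Icc 0 1) 1) :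
    ∃ M : ℝ, 0 ≤ M ∧ ∀ n : ℤ, n ≠ 0 →
      ‖fourierCoeffOn (zero_lt_one (α := ℝ)) (fun t => (f t : ℂ)) n‖ ≤ M / (n : ℝ) ^ 2 := by
  have hf' : ContDiffOn ℝ 1 (derivWithin f (Set.Icc 0 1)) (Set.Icc 0 1) :=
    hf.derivWithin uniqueDiffOn_unitInterval (by norm_num)
  have hf'' : ContinuousOn (derivWithin (derivWithin f (Set.Icc 0 1)) (Set.Icc 0 1)) (Set.Icc 0 1) :=
    hf'.continuousOn_derivWithin uniqueDiffOn_unitInterval le_rfl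
  obtain ⟨M, hM⟩ := isCompact_Icc.exists_bound_of_continuousOn hf''
  have hder : ∀ {g : ℝ → ℝ}, DifferentiableOn ℝ g (Set.Icc 0 1) → ∀ t ∈ Set.Ioo (0 : ℝ) 1,
      HasDerivAt g (derivWithin g (Set.Icc 0 1) t) t := fun hg t ht =>
    (hg t (Set.Ioo_subset_Icc_self ht)).hasDerivWithinAt.hasDerivAt (Icc_mem_nhds ht.1 ht.2)
  refine ⟨M, (norm_nonneg _).trans (hM 0 ⟨le_rfl, zero_le_one⟩), fun n hn => ?_⟩
  exact norm_fourierCoeffOn_le_div_sq hn hf.continuousOn hf'.continuousOn hf''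
    (hder (hf.differentiableOn (by norm_num))) (hder (hf'.differentiableOn (by norm_num))) h01 h01'
    fun t ht => hM t ht

lemma exists_lipschitz_bound {f : ℝ → ℝ} (hf : ContDiffOn ℝ 2 f (Set.Icc 0 1)) :
    ∃ L : ℝ, 0 < L ∧ ∀ s ∈ Set.Icc (0 : ℝ) 1, ∀ t ∈ Set.Icc (0 : ℝ) 1, |f s - f t| ≤ L * |s - t| := by
  have hf' : ContinuousOn (derivWithin f (Set.Icc 0 1)) (Set.Icc 0 1) :=
    hf.continuousOn_derivWithin uniqueDiffOn_unitInterval (by norm_num)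
  obtain ⟨L, hL⟩ := isCompact_Icc.exists_bound_of_continuousOn hf'
  have hL0 : 0 ≤ L := (norm_nonneg _).trans (hL 0 ⟨le_rfl, zero_le_one⟩)
  refine ⟨L + 1, by linarith, fun s hs t ht => ?_⟩
  refine (Convex.norm_image_sub_le_of_norm_derivWithin_le (hf.differentiableOn (by norm_num)) hL
    (convex_Icc 0 1) ht hs).trans ?_
  exact mul_le_mul_of_nonneg_right (by linarith) (abs_nonneg _)

lemma exists_pos_lower_bound {f : ℝ → ℝ} (hf : ContinuousOn f (Set.Icc 0 1))
    (hpos : ∀ t ∈ Set.Icc (0 : ℝ) 1, 0 < f t) :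
    ∃ m : ℝ, 0 < m ∧ ∀ t ∈ Set.Icc (0 : ℝ) 1, m ≤ f t := by
  obtain ⟨t, ht, hmin⟩ := isCompact_Icc.exists_isMinOn (Set.nonempty_Icc.2 zero_le_one) hf
  exact ⟨f t, hpos t ht, fun s hs => hmin hs⟩

end Smooth

/-! ### Weights of the cells -/

section Weights

/-- The weight of the `r`-th cell in the projection estimate at `x`. -/
noncomputable def cellWeight (k b : ℕ) (x : ℝ) (r : ℕ) : ℝ :=
  ∫ t in cell k r, dirichletKernel b x t

lemma sum_setIntegral_cell {k : ℕ} (hk : 0 < k) {g : ℝ → ℝ} (hg : ContinuousOn g (Set.Icc 0 1)) :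
    ∑ r ∈ Finset.range k, ∫ t in cell k r, g t = ∫ t in (0 : ℝ)..1, g t := by
  have hk' : (0 : ℝ) < k := by exact_mod_cast hk
  have h := intervalIntegral.sum_integral_adjacent_intervals (f := g) (μ := volume)
    (a := fun r : ℕ => (r : ℝ) / k) (n := k) fun r hr => by
      refine ContinuousOn.intervalIntegrable (hg.mono ?_)
      rw [Set.uIcc_of_le (by gcongr; simp)]
      refine Set.Icc_subset_Icc (by positivity) ?_
      rw [div_le_one hk']
      exact_mod_cast hr
  simp only [Nat.cast_zero, zero_div, div_self hk'.ne'] at h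
  rw [← h]
  refine Finset.sum_congr rfl fun r _ => ?_
  rw [setIntegral_cell]
  push_cast
  rfl

lemma integrableOn_cell {k r : ℕ} (hr : r < k) {g : ℝ → ℝ} (hg : ContinuousOn g (Set.Icc 0 1)) :
    IntegrableOn g (cell k r) :=
  (hg.integrableOn_compact isCompact_Icc).mono_set (cell_subset_unitInterval hr)

lemma measureReal_cell (k r : ℕ) : (volume : Measure ℝ).real (cell k r) = 1 / k := by
  rw [measureReal_def, volume_cell, ENNReal.toReal_ofReal (by positivity)]

lemma abs_cellWeight_le (k b : ℕ) (x : ℝ) (r : ℕ) : |cellWeight k b x r| ≤ 2 * (b + 1) / k := by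
  have h := norm_setIntegral_le_of_norm_le_const (f := dirichletKernel b x) (μ := volume)
    (s := cell k r) (C := 2 * (b + 1)) (by rw [volume_cell]; exact ENNReal.ofReal_lt_top)
    fun t _ => abs_dirichletKernel_le b x t
  rw [measureReal_cell, mul_one_div] at h
  exact h

lemma sum_abs_cellWeight_le {k : ℕ} (hk : 0 < k) (b : ℕ) (x : ℝ) :
    ∑ r ∈ Finset.range k, |cellWeight k b x r| ≤ 3 + Real.log (b + 1) := by
  refine le_trans ?_ (integral_abs_dirichletKernel_le b x)
  rw [← sum_setIntegral_cell hk (continuous_dirichletKernel b x).abs.continuousOn]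
  exact Finset.sum_le_sum fun r _ => abs_integral_le_integral_abs

/-- Replacing `g` by a step function costs the oscillation `D` times the Lebesgue constant. It
serves twice: with `g = f` for the bias and with `g` the kernel at a second point for the
covariance. -/
lemma abs_sum_cellWeight_mul_sub_le {k : ℕ} (hk : 0 < k) (b : ℕ) (x : ℝ) {g : ℝ → ℝ}
    (hg : ContinuousOn g (Set.Icc 0 1)) {h : ℕ → ℝ} {D : ℝ} (hD : 0 ≤ D)
    (hh : ∀ r < k, ∀ t ∈ cell k r, |h r - g t| ≤ D) :
    |∑ r ∈ Finset.range k, cellWeight k b x r * h r - ∫ t in (0 : ℝ)..1, dirichletKernel b x t * g t|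
      ≤ D * (3 + Real.log (b + 1)) := by
  have hK := (continuous_dirichletKernel b x).continuousOn (s := Set.Icc (0 : ℝ) 1)
  have hKg : ContinuousOn (fun t => dirichletKernel b x t * g t) (Set.Icc 0 1) := hK.mul hg
  rw [← sum_setIntegral_cell hk hKg, ← Finset.sum_sub_distrib]
  refine le_trans ?_ (mul_le_mul_of_nonneg_left (integral_abs_dirichletKernel_le b x) hD)
  rw [← sum_setIntegral_cell hk (continuous_dirichletKernel b x).abs.continuousOn, Finset.mul_sum]
  refine (Finset.abs_sum_le_sum_abs _ _).trans (Finset.sum_le_sum fun r hr => ?_)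
  have hr' := Finset.mem_range.1 hr
  have hKh : IntegrableOn (fun t => dirichletKernel b x t * h r) (cell k r) :=
    (integrableOn_cell hr' hK).mul_const (h r)
  have hKa : IntegrableOn (fun t => |dirichletKernel b x t|) (cell k r) :=
    integrableOn_cell hr' (continuous_dirichletKernel b x).abs.continuousOn
  have e : cellWeight k b x r * h r - ∫ t in cell k r, dirichletKernel b x t * g t
      = ∫ t in cell k r, (dirichletKernel b x t * h r - dirichletKernel b x t * g t) := by
    rw [integral_sub hKh (integrableOn_cell hr' hKg), integral_mul_const, cellWeight]
  rw [e, ← integral_const_mul, ← Real.norm_eq_abs]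
  refine norm_integral_le_of_norm_le (hKa.const_mul D) ?_
  refine (ae_restrict_iff' (measurableSet_cell k r)).2 (Eventually.of_forall fun t ht => ?_)
  change |dirichletKernel b x t * h r - dirichletKernel b x t * g t| ≤ D * |dirichletKernel b x t|
  rw [← mul_sub, abs_mul, mul_comm]
  exact mul_le_mul_of_nonneg_right (hh r hr' t ht) (abs_nonneg _)

/-- `k * cellWeight k b y r` is the mean of the kernel over the cell, which has length `1 / k`, and
the kernel is Lipschitz. -/
lemma abs_mul_cellWeight_sub_le {k r : ℕ} (hr : r < k) (b : ℕ) (y : ℝ) {t : ℝ} (ht : t ∈ cell k r) :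
    |k * cellWeight k b y r - dirichletKernel b y t| ≤ 2 * Real.pi * (b + 1) ^ 2 / k := by
  have hk' : (0 : ℝ) < k := by exact_mod_cast (Nat.zero_le r).trans_lt hr
  have hK := (continuous_dirichletKernel b y).continuousOn (s := Set.Icc (0 : ℝ) 1)
  have e : cellWeight k b y r - dirichletKernel b y t / k
      = ∫ s in cell k r, (dirichletKernel b y s - dirichletKernel b y t) := by
    rw [integral_sub (integrableOn_cell hr hK) (integrableOn_cell hr continuousOn_const),
      setIntegral_const, measureReal_cell, cellWeight, smul_eq_mul]
    ring
  have h : |cellWeight k b y r - dirichletKernel b y t / k|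
      ≤ 2 * Real.pi * (b + 1) ^ 2 * (1 / k) * (1 / k) := by
    rw [e]
    have := norm_setIntegral_le_of_norm_le_const (μ := volume) (s := cell k r)
      (f := fun s => dirichletKernel b y s - dirichletKernel b y t)
      (C := 2 * Real.pi * (b + 1) ^ 2 * (1 / k)) (by rw [volume_cell]; exact ENNReal.ofReal_lt_top)
      fun s hs => by
        refine (abs_dirichletKernel_sub_le b y s t).trans ?_
        have hs' := cell_subset_Icc k r hs
        have ht' := cell_subset_Icc k r ht
        refine mul_le_mul_of_nonneg_left ?_ (by have := Real.pi_pos; positivity)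
        have h1 : ((r : ℝ) + 1) / k = r / k + 1 / k := by ring
        rw [h1] at hs' ht'
        rw [abs_le]
        constructor <;> linarith [hs'.1, hs'.2, ht'.1, ht'.2]
    rwa [measureReal_cell] at this
  have e2 : k * cellWeight k b y r - dirichletKernel b y t
      = k * (cellWeight k b y r - dirichletKernel b y t / k) := by
    field_simp
  rw [e2, abs_mul, abs_of_pos hk']
  refine (mul_le_mul_of_nonneg_left h hk'.le).trans (le_of_eq ?_)
  field_simp

/-- The left-hand sum discretizes `∫ K(x, t) K(y, t) dt`, which is the kernel at `(x, y)` by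
reproduction. -/
lemma abs_mul_sum_cellWeight_mul_sub_le {k : ℕ} (hk : 0 < k) (b : ℕ) (x y : ℝ) :
    |k * ∑ r ∈ Finset.range k, cellWeight k b x r * cellWeight k b y r - dirichletKernel b x y|
      ≤ 2 * Real.pi * (b + 1) ^ 2 / k * (3 + Real.log (b + 1)) := by
  have h := abs_sum_cellWeight_mul_sub_le hk b x (continuous_dirichletKernel b y).continuousOn
    (h := fun r => k * cellWeight k b y r) (D := 2 * Real.pi * (b + 1) ^ 2 / k)
    (by have := Real.pi_pos; positivity) fun r hr t ht => abs_mul_cellWeight_sub_le hr b y ht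
  rw [integral_dirichletKernel_mul] at h
  convert h using 3
  rw [Finset.mul_sum]
  exact Finset.sum_congr rfl fun r _ => by ring

lemma estimator_eq_sum (f : ℝ → ℝ) (k b : ℕ) (z : Multiset (ℝ × ℝ)) (x : ℝ) :
    estimator f k b z x = ∑ r ∈ Finset.range k, cellWeight k b x r
      * correctedMaximum (count z (column f k r)) (extreme z (column f k r)) := by
  unfold estimator correctedMaximum cellWeight
  exact Finset.sum_congr rfl fun r _ => mul_assoc _ _ _

end Weights

/-! ### The remainder after extracting the noise -/

section Remainder

variable {f : ℝ → ℝ} {c : ℝ} {n k b : ℕ} {Ω : Type*} {mΩ : MeasurableSpace Ω} {P : Measure Ω}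
  {N : Ω → Multiset (ℝ × ℝ)}

lemma IsPoissonProcess.measurable_normalizedError (hN : IsPoissonProcess P (intensity f c n) N)
    (hf : ContinuousOn f (Set.Icc 0 1)) {p : ℕ} (v : ℝ) (x : Fin p → ℝ) :
    Measurable fun ω => normalizedError f c v k b x (N ω) := by
  unfold normalizedError
  refine (WithLp.measurable_toLp 2 _).comp (measurable_pi_lambda _ fun j => ?_)
  refine Measurable.const_mul (Measurable.sub_const ?_ _) _
  simp only [estimator_eq_sum]
  refine Finset.measurable_fun_sum _ fun r hr => Measurable.const_mul ?_ _
  exact hN.measurable_correctedMaximum (measurableSet_column hf (Finset.mem_range.1 hr))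
    fun q hq => hq.2.1

/-- A level such that the boundary function stays within `2 L / k` above it on the `r`-th cell,
if `L` is a Lipschitz constant. -/
noncomputable def cellLevel (f : ℝ → ℝ) (L : ℝ) (k r : ℕ) : ℝ := f (r / k) - L / k

lemma cellLevel_bounds {L : ℝ} (hL : ∀ s ∈ Set.Icc (0 : ℝ) 1, ∀ t ∈ Set.Icc (0 : ℝ) 1,
    |f s - f t| ≤ L * |s - t|) (hL0 : 0 ≤ L) {r : ℕ} (hr : r < k) {t : ℝ} (ht : t ∈ cell k r) :
    cellLevel f L k r ≤ f t ∧ f t ≤ cellLevel f L k r + 2 * L / k := by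
  have hk' : (0 : ℝ) < k := by exact_mod_cast (Nat.zero_le r).trans_lt hr
  have ht' := cell_subset_Icc k r ht
  have h1 : ((r : ℝ) + 1) / k = r / k + 1 / k := by ring
  rw [h1] at ht'
  have hr01 : (r : ℝ) / k ∈ Set.Icc (0 : ℝ) 1 := by
    refine ⟨by positivity, ?_⟩
    rw [div_le_one hk']
    exact_mod_cast hr.le
  have h := hL _ (cell_subset_unitInterval hr ht) _ hr01
  have h2 : |t - r / k| ≤ 1 / k := by
    rw [abs_le]
    have : (0 : ℝ) < 1 / k := by positivity
    constructor <;> linarith [ht'.1, ht'.2]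
  have h3 := h.trans (mul_le_mul_of_nonneg_left h2 hL0)
  rw [mul_one_div, abs_le] at h3
  have h4 : 2 * L / k = L / k + L / k := by ring
  unfold cellLevel
  rw [h4]
  constructor <;> linarith [h3.1, h3.2]

lemma le_cellLevel {L m : ℝ} (hm : ∀ t ∈ Set.Icc (0 : ℝ) 1, 2 * m ≤ f t) {r : ℕ} (hr : r < k)
    (hLk : L / k ≤ m) : m ≤ cellLevel f L k r := by
  have hk' : (0 : ℝ) < k := by exact_mod_cast (Nat.zero_le r).trans_lt hr
  have := hm (r / k) ⟨by positivity, by rw [div_le_one hk']; exact_mod_cast hr.le⟩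
  unfold cellLevel
  linarith

/-- The bias-corrected maximum over the rectangle inscribed in a column, centred at the height of
the rectangle and multiplied by the intensity of the process per unit of height. -/
noncomputable def cellNoise (f : ℝ → ℝ) (c L : ℝ) (n k r : ℕ) (z : Multiset (ℝ × ℝ)) : ℝ :=
  n * c / k * (correctedMaximum (count z (rectangle k r (cellLevel f L k r)))
    (extreme z (rectangle k r (cellLevel f L k r))) - cellLevel f L k r)

/-- The remainder has three sources: columns exchanged for rectangles, `f` exchanged for the step
function of the levels, and the truncation of the series. Only the first is random. By `hnk` the
region between the levels bounding `f` on a cell holds at most one point on average. -/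
lemma integral_remainder_le [IsProbabilityMeasure P] (hN : IsPoissonProcess P (intensity f c n) N)
    (hf : ContinuousOn f (Set.Icc 0 1)) (hc : 0 < c) (hn : 0 < n) (hk : 0 < k) (hb : 2 ≤ b)
    {L m M : ℝ} (hL : ∀ s ∈ Set.Icc (0 : ℝ) 1, ∀ t ∈ Set.Icc (0 : ℝ) 1, |f s - f t| ≤ L * |s - t|)
    (hL0 : 0 < L) (hm0 : 0 < m) (hm : ∀ t ∈ Set.Icc (0 : ℝ) 1, 2 * m ≤ f t) (hLk : L / k ≤ m)
    (hM0 : 0 ≤ M) (hM : ∀ j : ℤ, j ≠ 0 →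
      ‖fourierCoeffOn (zero_lt_one (α := ℝ)) (fun t => (f t : ℂ)) j‖ ≤ M / (j : ℝ) ^ 2)
    (h01 : f 0 = f 1) (hnk : (n : ℝ) * c * (2 * L) ≤ (k : ℝ) ^ 2) {x : ℝ}
    (hx : x ∈ Set.Icc (0 : ℝ) 1) (v : ℝ) :
    Integrable (fun ω => v * c * (estimator f k b (N ω) x - f x)
      - ∑ r : Fin k, v * k / n * cellWeight k b x r * cellNoise f c L n k r (N ω)) P ∧
    ∫ ω, |v * c * (estimator f k b (N ω) x - f x)
      - ∑ r : Fin k, v * k / n * cellWeight k b x r * cellNoise f c L n k r (N ω)| ∂P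
      ≤ |v| * c * (2 * L * (6 + 6 * L / m) * ((3 + Real.log (b + 1)) / k) + 12 * M / b) := by
  have hk' : (0 : ℝ) < k := by exact_mod_cast hk
  have hn' : (0 : ℝ) < n := by exact_mod_cast hn
  set h : ℕ → ℝ := fun r => cellLevel f L k r with hh
  let X : ℕ → Ω → ℝ := fun r ω =>
    correctedMaximum (count (N ω) (column f k r)) (extreme (N ω) (column f k r))
  let X' : ℕ → Ω → ℝ := fun r ω => correctedMaximum (count (N ω) (rectangle k r (h r)))
    (extreme (N ω) (rectangle k r (h r)))
  set B : ℝ := (∑ r ∈ Finset.range k, cellWeight k b x r * h r) - f x with hB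
  have hcol : ∀ r < k, Integrable (fun ω => X r ω - X' r ω) P ∧
      -- Here `5 = 1 + 1 + 3`: the leftover mass bounded through `hnk`, the term `1`, and the
      -- leading part of `3 M / h`.
      ∫ ω, |X r ω - X' r ω| ∂P ≤ 2 * L / k * (5 + 6 * L / m) := by
    intro r hr
    have hmh : m ≤ h r := le_cellLevel hm hr hLk
    have hh0 : 0 < h r := hm0.trans_le hmh
    have key := hN.integral_abs_column_sub_rectangle_le (h := h r) (M := h r + 2 * L / k) hf hr
      (fun t ht => (cellLevel_bounds hL hL0.le hr ht).1)
      (fun t ht => (cellLevel_bounds hL hL0.le hr ht).2) hc hn hh0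
      (le_add_of_nonneg_right (by positivity))
    refine ⟨key.1, key.2.trans ?_⟩
    rw [add_sub_cancel_left]
    refine mul_le_mul_of_nonneg_left ?_ (by positivity)
    have e1 : (n : ℝ) * c / k * (2 * L / k) ≤ 1 := by
      rw [div_mul_div_comm, div_le_one (by positivity), ← sq]
      exact hnk
    have e2 : 3 * (h r + 2 * L / k) / h r ≤ 3 + 6 * L / m := by
      rw [mul_add, add_div, mul_div_assoc, div_self hh0.ne', mul_one]
      have hk1 : (1 : ℝ) ≤ k := by exact_mod_cast hk
      have : 3 * (2 * L / k) ≤ 6 * L := by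
        rw [show 3 * (2 * L / k) = 6 * L / k by ring]
        exact div_le_self (by positivity) hk1
      gcongr
    linarith
  have hB' : |B| ≤ 2 * L / k * (3 + Real.log (b + 1)) + 12 * M / b := by
    have h1 := abs_sum_cellWeight_mul_sub_le hk b x hf (h := h) (D := 2 * L / k) (by positivity)
      fun r hr t ht => by
        have := cellLevel_bounds hL hL0.le hr ht
        rw [abs_le]
        constructor <;> linarith [this.1, this.2]
    have h2 := abs_integral_dirichletKernel_mul_sub_le hf hM0 hM h01 hx hb
    have e : B = ((∑ r ∈ Finset.range k, cellWeight k b x r * h r)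
        - ∫ t in (0 : ℝ)..1, dirichletKernel b x t * f t)
        + ((∫ t in (0 : ℝ)..1, dirichletKernel b x t * f t) - f x) := by rw [hB]; ring
    rw [e]
    exact (abs_add_le _ _).trans (add_le_add h1 h2)
  have hrep : ∀ ω, v * c * (estimator f k b (N ω) x - f x)
      - ∑ r : Fin k, v * k / n * cellWeight k b x r * cellNoise f c L n k r (N ω)
      = v * c * ((∑ r ∈ Finset.range k, cellWeight k b x r * (X r ω - X' r ω)) + B) := by
    intro ω
    rw [Fin.sum_univ_eq_sum_range (fun r => v * k / n * cellWeight k b x r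
      * cellNoise f c L n k r (N ω)) k, estimator_eq_sum, hB]
    -- The factor `v k / n` of the weight and the factor `n c / k` of the noise multiply to `v c`.
    have e1 : ∀ r, v * k / n * cellWeight k b x r * cellNoise f c L n k r (N ω)
        = v * c * (cellWeight k b x r * X' r ω - cellWeight k b x r * h r) := by
      intro r
      simp only [cellNoise, X', hh]
      field_simp
    simp only [e1, mul_sub (cellWeight k b x _), ← Finset.mul_sum, Finset.sum_sub_distrib, X]
    ring
  simp only [hrep]
  have hint : ∀ r ∈ Finset.range k, Integrable (fun ω => cellWeight k b x r * (X r ω - X' r ω)) P :=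
    fun r hr => (hcol r (Finset.mem_range.1 hr)).1.const_mul _
  have hI : Integrable (fun ω => ∑ r ∈ Finset.range k, |cellWeight k b x r| * |X r ω - X' r ω|) P :=
    integrable_finsetSum _ fun r hr => (hcol r (Finset.mem_range.1 hr)).1.abs.const_mul _
  have hII : Integrable (fun ω => v * c
      * ((∑ r ∈ Finset.range k, cellWeight k b x r * (X r ω - X' r ω)) + B)) P :=
    ((integrable_finsetSum _ hint).add (integrable_const B)).const_mul _
  refine ⟨hII, ?_⟩
  have hpt : ∀ ω, |v * c * ((∑ r ∈ Finset.range k, cellWeight k b x r * (X r ω - X' r ω)) + B)|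
      ≤ |v| * c * ((∑ r ∈ Finset.range k, |cellWeight k b x r| * |X r ω - X' r ω|) + |B|) := by
    intro ω
    rw [abs_mul, abs_mul, abs_of_pos hc]
    refine mul_le_mul_of_nonneg_left ((abs_add_le _ _).trans (add_le_add_left
      ((Finset.abs_sum_le_sum_abs _ _).trans (le_of_eq ?_)) _)) (by positivity)
    simp only [abs_mul]
  have hIB : Integrable (fun ω => |v| * c
      * ((∑ r ∈ Finset.range k, |cellWeight k b x r| * |X r ω - X' r ω|) + |B|)) P :=
    (hI.add (integrable_const |B|)).const_mul _
  refine (integral_mono hII.abs hIB hpt).trans ?_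
  rw [integral_const_mul, integral_add hI (integrable_const _), integral_const, probReal_univ,
    one_smul, integral_finsetSum _ fun r hr => (hcol r (Finset.mem_range.1 hr)).1.abs.const_mul _]
  refine mul_le_mul_of_nonneg_left ?_ (by positivity)
  have hS : ∑ r ∈ Finset.range k, ∫ ω, |cellWeight k b x r| * |X r ω - X' r ω| ∂P
      ≤ (3 + Real.log (b + 1)) * (2 * L / k * (5 + 6 * L / m)) := by
    refine le_trans ?_ (mul_le_mul_of_nonneg_right (sum_abs_cellWeight_le hk b x) (by positivity))
    rw [Finset.sum_mul]
    refine Finset.sum_le_sum fun r hr => ?_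
    rw [integral_const_mul]
    exact mul_le_mul_of_nonneg_left (hcol r (Finset.mem_range.1 hr)).2 (abs_nonneg _)
  -- The step-function part of the bias has the same order as the column error and turns `5` into
  -- `6`.
  have e : 2 * L * (6 + 6 * L / m) * ((3 + Real.log (b + 1)) / k) + 12 * M / b
      = (3 + Real.log (b + 1)) * (2 * L / k * (5 + 6 * L / m))
        + (2 * L / k * (3 + Real.log (b + 1)) + 12 * M / b) := by ring
  rw [e]
  exact add_le_add hS hB'

end Remainder

/-! ### Independence and small mean of the noise -/

section Noise

variable {f : ℝ → ℝ} {c : ℝ} {n k : ℕ} {Ω : Type*} {mΩ : MeasurableSpace Ω} {P : Measure Ω}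
  {N : Ω → Multiset (ℝ × ℝ)}

lemma IsPoissonProcess.iIndepFun_cellNoise (hN : IsPoissonProcess P (intensity f c n) N) (L : ℝ) :
    iIndepFun (fun (r : Fin k) ω => cellNoise f c L n k r (N ω)) P :=
  (hN.iIndepFun_rectangle fun r : Fin k => cellLevel f L k r).comp
    (fun r y => n * c / k * (y - cellLevel f L k r)) fun _ => by fun_prop

/-- The exponential is split in two halves: one absorbs the factor `μ`, the other is at most `1 /
y`. With `y = n` this bounds the mean of a noise by `2 / n`. -/
lemma mul_exp_neg_le {μ y : ℝ} (hy : 0 < y) (h : 2 * Real.log y ≤ μ) :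
    μ * Real.exp (-μ) ≤ 2 / y := by
  have h1 : Real.exp (-(μ / 2)) ≤ 1 / y := by
    rw [Real.exp_neg, ← one_div]
    refine one_div_le_one_div_of_le hy ?_
    rw [← Real.log_le_iff_le_exp hy]
    linarith
  have h2 : μ / 2 * Real.exp (-(μ / 2)) ≤ 1 := by
    have := Real.add_one_le_exp (μ / 2)
    rw [Real.exp_neg, ← div_eq_mul_inv, div_le_one (Real.exp_pos _)]
    linarith
  have e : μ * Real.exp (-μ)
      = 2 * (μ / 2 * Real.exp (-(μ / 2))) * Real.exp (-(μ / 2)) := by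
    have : Real.exp (-μ) = Real.exp (-(μ / 2)) * Real.exp (-(μ / 2)) := by
      rw [← Real.exp_add]
      congr 1
      ring
    rw [this]
    ring
  rw [e]
  calc _ ≤ 2 * 1 * Real.exp (-(μ / 2)) := by gcongr
    _ ≤ 2 * 1 * (1 / y) := by gcongr
    _ = 2 / y := by ring

end Noise

/-! ### Consequences of the rate conditions -/

section Rates

variable {k b : ℕ → ℕ}

namespace RateConditions

lemma tendsto_b_real (H : RateConditions k b) : Tendsto (fun n => (b n : ℝ)) atTop atTop :=
  tendsto_natCast_atTop_atTop.comp H.tendsto_b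

lemma tendsto_k (H : RateConditions k b) : Tendsto (fun n => (k n : ℝ)) atTop atTop := by
  have h1 : Tendsto (fun n : ℕ => (n : ℝ) * ((n : ℝ)⁻¹ * (k n : ℝ) ^ 2)) atTop atTop :=
    tendsto_natCast_atTop_atTop.atTop_mul_atTop₀ H.ii
  refine (Real.tendsto_sqrt_atTop.comp h1).congr' ?_
  filter_upwards [eventually_gt_atTop 0] with n hn
  have hn' : (n : ℝ) ≠ 0 := by exact_mod_cast hn.ne'
  simp only [Function.comp]
  rw [mul_inv_cancel_left₀ hn', Real.sqrt_sq (by positivity)]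

lemma eventually_mul_le_sq (H : RateConditions k b) (C : ℝ) :
    ∀ᶠ n : ℕ in atTop, (n : ℝ) * C ≤ (k n : ℝ) ^ 2 := by
  filter_upwards [H.ii.eventually_ge_atTop C, eventually_gt_atTop 0] with n h hn
  have hn' : (0 : ℝ) < n := by exact_mod_cast hn
  calc (n : ℝ) * C ≤ n * ((n : ℝ)⁻¹ * (k n : ℝ) ^ 2) := by gcongr
    _ = _ := mul_inv_cancel_left₀ hn'.ne' _

lemma eventually_mul_log_le (H : RateConditions k b) {C : ℝ} (hC : 0 < C) :
    ∀ᶠ n : ℕ in atTop, C * Real.log n ≤ n / k n := by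
  filter_upwards [H.i.eventually_lt_const (u := C⁻¹) (by positivity), eventually_gt_atTop 0,
    H.tendsto_k.eventually_gt_atTop 0] with n h hn hk
  have hn' : (0 : ℝ) < n := by exact_mod_cast hn
  rw [le_div_iff₀ hk]
  calc C * Real.log n * k n = C * n * ((n : ℝ)⁻¹ * k n * Real.log n) := by field_simp
    _ ≤ C * n * C⁻¹ := by gcongr
    _ = n := by field_simp

lemma tendsto_div_k (H : RateConditions k b) : Tendsto (fun n : ℕ => (n : ℝ) / k n) atTop atTop :=
  tendsto_atTop_mono' _ ((H.eventually_mul_log_le one_pos).mono fun n h => by rwa [one_mul] at h)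
    (Real.tendsto_log_atTop.comp tendsto_natCast_atTop_atTop)

lemma tendsto_b_mul_log_div_k (H : RateConditions k b) :
    Tendsto (fun n => (b n : ℝ) * (3 + Real.log (b n + 1)) / k n) atTop (𝓝 0) := by
  -- For `b ≥ 2` one has `3 + log (b + 1) ≤ 3 + 2 log b ≤ 7 log b`, because `5 log 2 > 3`.
  have h1 : Tendsto (fun n => 7 * (((b n : ℝ) * Real.log (b n))⁻¹ * (k n : ℝ))⁻¹) atTop (𝓝 0) := by
    simpa using (tendsto_inv_atTop_zero.comp H.iii).const_mul 7
  refine squeeze_zero' (Eventually.of_forall fun n => ?_) ?_ h1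
  · have : 0 ≤ Real.log ((b n : ℝ) + 1) := Real.log_nonneg (by simp)
    positivity
  · filter_upwards [H.tendsto_b.eventually_ge_atTop 2] with n hb
    have hb' : (2 : ℝ) ≤ b n := by exact_mod_cast hb
    have h2 : Real.log 2 ≤ Real.log (b n) := Real.log_le_log (by norm_num) hb'
    have h3 := Real.log_two_gt_d9
    have h4 : Real.log ((b n : ℝ) + 1) ≤ 2 * Real.log (b n) := by
      rw [← Real.log_rpow (by linarith)]
      refine Real.log_le_log (by linarith) ?_
      norm_num
      nlinarith
    rw [mul_inv, inv_inv, ← div_eq_mul_inv, ← mul_div_assoc]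
    refine div_le_div_of_nonneg_right ?_ (by positivity)
    nlinarith

lemma tendsto_b_div_k (H : RateConditions k b) :
    Tendsto (fun n => (b n : ℝ) / k n) atTop (𝓝 0) := by
  refine squeeze_zero (fun n => by positivity) (fun n => ?_) H.tendsto_b_mul_log_div_k
  have : 0 ≤ Real.log ((b n : ℝ) + 1) := Real.log_nonneg (by simp)
  refine div_le_div_of_nonneg_right (le_mul_of_one_le_right (by positivity) (by linarith))
    (by positivity)

lemma tendsto_b_add_one_div_sqrt (H : RateConditions k b) :
    Tendsto (fun n => ((b n : ℝ) + 1) / √(b n * k n)) atTop (𝓝 0) := by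
  have h1 : Tendsto (fun n => 2 * √((b n : ℝ) / k n)) atTop (𝓝 0) := by
    simpa using (H.tendsto_b_div_k.sqrt).const_mul 2
  refine squeeze_zero' (Eventually.of_forall fun n => by positivity) ?_ h1
  filter_upwards [H.tendsto_b.eventually_ge_atTop 1, H.tendsto_k.eventually_gt_atTop 0] with n hb hk
  have hb' : (1 : ℝ) ≤ b n := by exact_mod_cast hb
  have hb0 : (0 : ℝ) < b n := by linarith
  have e : √((b n : ℝ) / k n) = b n / √(b n * k n) := by
    rw [Real.sqrt_div hb0.le, Real.sqrt_mul hb0.le, div_eq_div_iff (by positivity) (by positivity),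
      ← mul_assoc, Real.mul_self_sqrt hb0.le]
  rw [e, ← mul_div_assoc]
  exact div_le_div_of_nonneg_right (by linarith) (by positivity)

/-- Condition (iv) in the form in which it is used: the truncation bias, of order `1 / b`, vanishes
after normalization. -/
lemma tendsto_div_sqrt_div_b (H : RateConditions k b) :
    Tendsto (fun n : ℕ => (n : ℝ) / √(b n * k n) / b n) atTop (𝓝 0) := by
  refine H.iv.congr' ?_
  filter_upwards [H.tendsto_b.eventually_ge_atTop 1, H.tendsto_k.eventually_gt_atTop 0] with n hb hk
  have hb0 : (0 : ℝ) < b n := by exact_mod_cast hb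
  rw [Real.rpow_neg hk.le, ← Real.sqrt_eq_rpow, show (-(3 / 2) : ℝ) = -(1 / 2) - 1 by norm_num,
    Real.rpow_sub_one hb0.ne', Real.rpow_neg hb0.le, ← Real.sqrt_eq_rpow, Real.sqrt_mul hb0.le]
  field_simp

end RateConditions

end Rates

/-! ### Asymptotic normality -/

section Main

variable {f : ℝ → ℝ} {c : ℝ} {Ω : ℕ → Type*} [∀ n, MeasurableSpace (Ω n)]
  {P : (n : ℕ) → Measure (Ω n)} [∀ n, IsProbabilityMeasure (P n)]
  {N : (n : ℕ) → Ω n → Multiset (ℝ × ℝ)} {p : ℕ} {x : Fin p → ℝ} {k b : ℕ → ℕ} {v : ℕ → ℝ}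

/-- The sum equals `(v √(b k) / n) ^ 2` times `(k ∑ r, a r * a' r) / b`, with `a`, `a'` the cell
weights at `y` and `z`. The first factor tends to `1`, and the second differs from `K_b(y, z) / b`
by `O(b log b / k)`. -/
lemma RateConditions.tendsto_sum_cellWeight_mul (H : RateConditions k b)
    (hv : Tendsto (fun n => v n * √(b n * k n) / n) atTop (𝓝 1)) {y z : ℝ}
    (hy : y ∈ Set.Icc (0 : ℝ) 1) (hz : z ∈ Set.Icc (0 : ℝ) 1) (h01 : ¬(y = 0 ∧ z = 1))
    (h10 : ¬(y = 1 ∧ z = 0)) :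
    Tendsto (fun n => ∑ r : Fin (k n), (v n * k n / n * cellWeight (k n) (b n) y r)
      * (v n * k n / n * cellWeight (k n) (b n) z r)) atTop (𝓝 (if y = z then 1 else 0)) := by
  have hK := tendsto_dirichletKernel_div H.tendsto_b hy hz h01 h10
  have herr : Tendsto (fun n => (k n * ∑ r ∈ Finset.range (k n),
      cellWeight (k n) (b n) y r * cellWeight (k n) (b n) z r - dirichletKernel (b n) y z) / b n)
      atTop (𝓝 0) := by
    refine squeeze_zero_norm' ?_ (a := fun n => 8 * Real.pi
      * ((b n : ℝ) * (3 + Real.log (b n + 1)) / k n)) (by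
        simpa using H.tendsto_b_mul_log_div_k.const_mul (8 * Real.pi))
    filter_upwards [H.tendsto_b.eventually_ge_atTop 1, H.tendsto_k.eventually_gt_atTop 0]
      with n hb hk
    have hb1 : (1 : ℝ) ≤ b n := by exact_mod_cast hb
    have hl : 0 ≤ Real.log ((b n : ℝ) + 1) := Real.log_nonneg (by linarith)
    rw [norm_div, Real.norm_eq_abs, Real.norm_natCast, div_le_iff₀ (by linarith)]
    refine (abs_mul_sum_cellWeight_mul_sub_le (by exact_mod_cast hk) _ _ _).trans ?_
    have h1 : ((b n : ℝ) + 1) ^ 2 ≤ 4 * (b n : ℝ) ^ 2 := by nlinarith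
    have := Real.pi_pos
    calc 2 * Real.pi * ((b n : ℝ) + 1) ^ 2 / k n * (3 + Real.log (b n + 1))
        ≤ 2 * Real.pi * (4 * (b n : ℝ) ^ 2) / k n * (3 + Real.log (b n + 1)) := by gcongr
      _ = _ := by ring
  have h := (hv.pow 2).mul (herr.add hK)
  rw [one_pow, zero_add, one_mul] at h
  refine h.congr' ?_
  filter_upwards [H.tendsto_b.eventually_ge_atTop 1, H.tendsto_k.eventually_gt_atTop 0]
    with n hb hk
  have hb0 : (0 : ℝ) < b n := by exact_mod_cast hb
  rw [Fin.sum_univ_eq_sum_range (fun r => (v n * k n / n * cellWeight (k n) (b n) y r)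
    * (v n * k n / n * cellWeight (k n) (b n) z r))]
  have e : ∀ r, (v n * k n / n * cellWeight (k n) (b n) y r)
      * (v n * k n / n * cellWeight (k n) (b n) z r)
      = (v n * k n / n) ^ 2 * (cellWeight (k n) (b n) y r * cellWeight (k n) (b n) z r) :=
    fun r => by ring
  simp only [e, ← Finset.mul_sum]
  rw [div_pow, mul_pow, Real.sq_sqrt (by positivity), ← add_div, sub_add_cancel]
  field_simp

/-- Only the asymptotics of `v` enter, so the exact normalization of (a) and the simplified one of
(b) are covered at once. -/
theorem RateConditions.tendstoInDistribution_normalizedError (H : RateConditions k b)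
    (hf : ContDiffOn ℝ 2 f (Set.Icc 0 1)) (hf_pos : ∀ t ∈ Set.Icc (0 : ℝ) 1, 0 < f t)
    (hf_bdry : f 0 = f 1)
    (hf_bdry' : derivWithin f (Set.Icc 0 1) 0 = derivWithin f (Set.Icc 0 1) 1) (hc : 0 < c)
    (hN : ∀ n, IsPoissonProcess (P n) (intensity f c n) (N n))
    (hx : ∀ j, x j ∈ Set.Icc (0 : ℝ) 1) (hx_inj : Function.Injective x)
    (hx_ends : ¬ ∃ i j, x i = 0 ∧ x j = 1)
    (hv : Tendsto (fun n => v n * √(b n * k n) / n) atTop (𝓝 1)) :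
    TendstoInDistribution (fun n ω => normalizedError f c (v n) (k n) (b n) x (N n ω))
      atTop id P (multivariateGaussian 0 (1 : Matrix (Fin p) (Fin p) ℝ)) := by
  obtain ⟨L, hL0, hL⟩ := exists_lipschitz_bound hf
  obtain ⟨m', hm', hmf⟩ := exists_pos_lower_bound hf.continuousOn hf_pos
  obtain ⟨M, hM0, hM⟩ := exists_fourierCoeffOn_bound hf hf_bdry hf_bdry'
  -- Half the lower bound of `f` is reserved for the drop `L / k` of the levels, which thus stay
  -- above `m` eventually.
  obtain ⟨m, hm0, hm⟩ : ∃ m : ℝ, 0 < m ∧ ∀ t ∈ Set.Icc (0 : ℝ) 1, 2 * m ≤ f t :=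
    ⟨m' / 2, by linarith, fun t ht => by linarith [hmf t ht]⟩
  have hLk : ∀ᶠ n in atTop, L / k n ≤ m :=
    (H.tendsto_k.const_div_atTop L).eventually_le_const hm0
  have hk0 : ∀ᶠ n in atTop, 0 < k n := by
    filter_upwards [H.tendsto_k.eventually_gt_atTop 0] with n h
    exact_mod_cast h
  let lam : ℕ → ℝ := fun n => n * c / k n
  have hlamT : Tendsto (fun n => lam n * m) atTop atTop := by
    refine (H.tendsto_div_k.atTop_mul_const (mul_pos hc hm0)).congr fun n => ?_
    simp only [lam]
    ring
  have hlam : ∀ᶠ n in atTop, 0 < lam n := by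
    filter_upwards [hk0, eventually_gt_atTop 0] with n hk hn
    positivity
  have hmax : ∀ᶠ n in atTop, ∀ r : Fin (k n), m ≤ cellLevel f L (k n) r ∧
      IsPoissonMaximum (P n) (lam n) (cellLevel f L (k n) r)
        (fun ω => count (N n ω) (rectangle (k n) r (cellLevel f L (k n) r)))
        (fun ω => extreme (N n ω) (rectangle (k n) r (cellLevel f L (k n) r))) := by
    filter_upwards [hLk] with n hLk r
    have h1 := le_cellLevel hm r.2 hLk
    exact ⟨h1, (hN n).isPoissonMaximum_rectangle r.2
      (fun t ht => (cellLevel_bounds hL hL0.le r.2 ht).1) hc.le (hm0.le.trans h1)⟩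
  let η : ℕ → ℝ := fun n => |v n * k n / n| * (2 * (b n + 1) / k n)
  have hη : Tendsto η atTop (𝓝 0) := by
    have h := ((hv.abs.mul H.tendsto_b_add_one_div_sqrt).const_mul 2)
    rw [mul_zero, mul_zero] at h
    refine h.congr' ?_
    filter_upwards [hk0, H.tendsto_b.eventually_ge_atTop 1] with n hk hb
    have hb0 : (0 : ℝ) < b n := by exact_mod_cast hb
    have hk' : (0 : ℝ) < k n := by exact_mod_cast hk
    have hs : 0 < √((b n : ℝ) * k n) := by positivity
    simp only [η, abs_div, abs_mul, abs_of_pos hs, Nat.abs_cast]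
    field_simp
  have hwη : ∀ n (r : Fin (k n)) j,
      |v n * k n / n * cellWeight (k n) (b n) (x j) r| ≤ η n := fun n r j => by
    rw [abs_mul]
    exact mul_le_mul_of_nonneg_left (abs_cellWeight_le _ _ _ _) (abs_nonneg _)
  refine tendstoInDistribution_of_weighted_sums
    (ξ := fun n r ω => cellNoise f c L n (k n) r (N n ω))
    (w := fun n r j => v n * k n / n * cellWeight (k n) (b n) (x j) r)
    (δ := fun n => 2 / n) (ε := fun n => 4 / (lam n * m)) (η := η)
    (ρ := fun n => |v n| * c * (2 * L * (6 + 6 * L / m) * ((3 + Real.log (b n + 1)) / k n)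
      + 12 * M / b n)) (C := 216)
    (fun n => ((hN n).measurable_normalizedError hf.continuousOn _ _).aemeasurable) ?_ ?_ ?_
    (Eventually.of_forall hwη) hη ?_ ?_ ?_ ?_
  · filter_upwards [hmax] with n hmax
    have hmul : ∀ r : Fin (k n), ∀ j : ℕ,
        Integrable (fun ω => cellNoise f c L n (k n) r (N n ω) ^ j) (P n) := fun r j => by
      simp only [cellNoise, mul_pow]
      exact ((hmax r).2.integrable_correctedMaximum_sub_pow j).const_mul _
    refine ⟨fun r => ?_, (hN n).iIndepFun_cellNoise L, fun r => ?_, fun r => hmul r 2, fun r => ?_⟩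
    · exact ((hmax r).2.measurable_correctedMaximum.sub_const _).const_mul _
    · simpa using hmul r 1
    · simpa only [abs_pow] using (hmul r 3).abs
  -- The constant `2 / (c m)` makes condition (i) give `lam n * m ≥ 2 log n`, as the bound `2 / n`
  -- on the mean requires.
  · filter_upwards [hmax, hlam, hlamT.eventually_gt_atTop 0, eventually_gt_atTop 0,
      H.eventually_mul_log_le (C := 2 / (c * m)) (by positivity)] with n hmax hlam hlm hn hlog r
    obtain ⟨h1, h2⟩ := hmax r
    have hh : 0 < cellLevel f L (k n) r := hm0.trans_le h1
    have h3 : lam n * m ≤ lam n * cellLevel f L (k n) r := by gcongr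
    refine ⟨?_, ?_, h2.normalized_thirdMoment_le hlam hh⟩
    · have e := h2.abs_integral_normalized_le
      rw [abs_of_pos (mul_pos hlam hh)] at e
      refine (le_of_eq e).trans (mul_exp_neg_le (by exact_mod_cast hn) (le_trans ?_ h3))
      have h4 := mul_le_mul_of_nonneg_left hlog (mul_pos hc hm0).le
      calc 2 * Real.log n = c * m * (2 / (c * m) * Real.log n) := by field_simp
        _ ≤ c * m * (n / k n) := h4
        _ = lam n * m := by simp only [lam]; ring
    · exact (h2.abs_normalized_secondMoment_sub_one_le hlam hh).trans (by gcongr)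
  · exact hlamT.const_div_atTop 4
  · intro j
    refine squeeze_zero' (Eventually.of_forall fun n => by positivity) ?_
      (by simpa using hη.const_mul 2)
    -- The `k` weights are at most `η` each and `k ≤ n` eventually, so their sum times `2 / n` is at
    -- most `2 η`.
    filter_upwards [H.eventually_mul_log_le one_pos, hk0, eventually_ge_atTop 3] with n hlog hk hn
    have hn' : (3 : ℝ) ≤ n := by exact_mod_cast hn
    have hk' : (0 : ℝ) < k n := by exact_mod_cast hk
    have hη0 : 0 ≤ η n := by positivity
    have hl : 1 ≤ Real.log n := by
      rw [Real.le_log_iff_exp_le (by linarith)]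
      exact (Real.exp_one_lt_d9.le).trans (by linarith)
    have hkn : (k n : ℝ) ≤ n := by
      rw [one_mul, le_div_iff₀ hk'] at hlog
      exact (le_mul_of_one_le_left hk'.le hl).trans hlog
    calc (∑ r : Fin (k n), |v n * k n / n * cellWeight (k n) (b n) (x j) r|) * (2 / n)
        ≤ (∑ _r : Fin (k n), η n) * (2 / n) := by
          gcongr with r _
          exact hwη n r j
      _ = 2 * η n * (k n / n) := by
          rw [Finset.sum_const, Finset.card_univ, Fintype.card_fin, nsmul_eq_mul]
          ring
      _ ≤ 2 * η n * 1 := by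
          gcongr
          rw [div_le_one (by linarith)]
          exact hkn
      _ = 2 * η n := mul_one _
  · intro i j
    simpa only [hx_inj.eq_iff] using H.tendsto_sum_cellWeight_mul hv (hx i) (hx j)
      (fun h => hx_ends ⟨i, j, h⟩) (fun h => hx_ends ⟨j, i, h.symm⟩)
  · filter_upwards [hk0, hLk, eventually_gt_atTop 0, H.tendsto_b.eventually_ge_atTop 2,
      H.eventually_mul_le_sq (c * (2 * L))] with n hk hLk hn hb hsq j
    exact integral_remainder_le (hN n) hf.continuousOn hc hn hk hb hL hL0 hm0 hm hLk hM0 hM hf_bdry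
      (by rwa [mul_assoc]) (hx j) (v n)
  -- Both parts of the remainder contain `|v| / b`, which tends to `0`: the logarithmic one is `(|v|
  -- / b) * (b (3 + log (b + 1)) / k)`.
  · have h1 := hv.abs.mul H.tendsto_div_sqrt_div_b
    have h2 := (h1.mul H.tendsto_b_mul_log_div_k).const_mul (c * (2 * L * (6 + 6 * L / m)))
    have h3 := h2.add (h1.const_mul (c * (12 * M)))
    simp only [mul_zero, add_zero] at h3
    refine h3.congr' ?_
    filter_upwards [hk0, H.tendsto_b.eventually_ge_atTop 1, eventually_gt_atTop 0] with n hk hb hn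
    have hb0 : (0 : ℝ) < b n := by exact_mod_cast hb
    have hk' : (0 : ℝ) < k n := by exact_mod_cast hk
    have hn' : (0 : ℝ) < n := by exact_mod_cast hn
    have hs : 0 < √((b n : ℝ) * k n) := by positivity
    rw [abs_div, abs_mul, abs_of_pos hs, abs_of_pos hn']
    field_simp

end Main

/-! ### The explicit choice of rates -/

section Example

open Asymptotics

variable {u : ℕ → ℝ} {k b : ℕ → ℕ}

lemma isEquivalent_normalization (hu : Tendsto u atTop atTop)
    (hb : IsEquivalent atTop (fun n => (b n : ℝ)) (fun n : ℕ => (n : ℝ) ^ (1 / 2 : ℝ)))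
    (hk : IsEquivalent atTop (fun n => (k n : ℝ))
      (fun n : ℕ => (n : ℝ) ^ (1 / 2 : ℝ) * Real.log n * u n ^ 2)) :
    IsEquivalent atTop (fun n : ℕ => (n : ℝ) * ((b n : ℝ) * (k n : ℝ)) ^ (-(1 / 2) : ℝ))
      (fun n : ℕ => (n : ℝ) ^ (1 / 2 : ℝ) * Real.log n ^ (-(1 / 2) : ℝ) * (u n)⁻¹) := by
  have h0 : 0 ≤ fun n : ℕ =>
      (n : ℝ) ^ (1 / 2 : ℝ) * ((n : ℝ) ^ (1 / 2 : ℝ) * Real.log n * u n ^ 2) := fun n => by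
    have := Real.log_natCast_nonneg n
    simp only [Pi.zero_apply]
    positivity
  have h1 := (IsEquivalent.refl (u := fun n : ℕ => (n : ℝ)) (l := atTop)).mul
    ((hb.mul hk).rpow h0 (r := -(1 / 2)))
  refine h1.congr_right ?_
  filter_upwards [eventually_gt_atTop 1, hu.eventually_gt_atTop 0] with n hn hun
  have hn0 : (0 : ℝ) < n := by exact_mod_cast zero_lt_one.trans hn
  have hl : 0 < Real.log n := Real.log_pos (by exact_mod_cast hn)
  have e : (n : ℝ) ^ (1 / 2 : ℝ) * ((n : ℝ) ^ (1 / 2 : ℝ) * Real.log n * u n ^ 2)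
      = n * Real.log n * u n ^ 2 := by
    rw [← mul_assoc, ← mul_assoc, ← Real.sqrt_eq_rpow, Real.mul_self_sqrt hn0.le]
  simp only [Pi.mul_apply, Pi.pow_apply, e]
  rw [Real.mul_rpow (by positivity) (by positivity), Real.mul_rpow hn0.le hl.le,
    ← Real.rpow_natCast (u n) 2, ← Real.rpow_mul hun.le, ← mul_assoc, ← mul_assoc,
    ← Real.rpow_one_add' hn0.le (by norm_num), ← Real.rpow_neg_one]
  norm_num

/-- Each condition is checked on the model sequences and carried over by equivalence. There (i) is
the growth restriction on `u`, (ii) reads `log n ^ 2 * u ^ 4 → ∞`, (iii) reads `2 u ^ 2 → ∞` because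
`log b ~ log n / 2`, and (iv) reads `(log n) ^ (-1 / 2) / u → 0`. -/
theorem rateConditions_of_isEquivalent (hu : Tendsto u atTop atTop)
    (hnu : Tendsto (fun n : ℕ => (n : ℝ) ^ (-(1 / 2) : ℝ) * Real.log n ^ 2 * u n ^ 2) atTop (𝓝 0))
    (hb : IsEquivalent atTop (fun n => (b n : ℝ)) (fun n : ℕ => (n : ℝ) ^ (1 / 2 : ℝ)))
    (hk : IsEquivalent atTop (fun n => (k n : ℝ))
      (fun n : ℕ => (n : ℝ) ^ (1 / 2 : ℝ) * Real.log n * u n ^ 2)) :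
    RateConditions k b := by
  have hn : Tendsto (fun n : ℕ => (n : ℝ)) atTop atTop := tendsto_natCast_atTop_atTop
  have hlog : Tendsto (fun n : ℕ => Real.log n) atTop atTop := Real.tendsto_log_atTop.comp hn
  have hsqrt : Tendsto (fun n : ℕ => (n : ℝ) ^ (1 / 2 : ℝ)) atTop atTop :=
    (tendsto_rpow_atTop (by norm_num)).comp hn
  have hpos : ∀ᶠ n : ℕ in atTop, (0 : ℝ) < n ∧ 0 < Real.log n ∧ 0 < u n :=
    (hn.eventually_gt_atTop 0).and ((hlog.eventually_gt_atTop 0).and (hu.eventually_gt_atTop 0))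
  have hn_equiv := IsEquivalent.refl (u := fun n : ℕ => (n : ℝ)) (l := atTop)
  have hlog_equiv := IsEquivalent.refl (u := fun n : ℕ => Real.log n) (l := atTop)
  have hsq : ∀ n : ℕ, (n : ℝ) ^ (1 / 2 : ℝ) * (n : ℝ) ^ (1 / 2 : ℝ) = n := fun n => by
    rw [← Real.sqrt_eq_rpow, Real.mul_self_sqrt n.cast_nonneg]
  refine ⟨tendsto_natCast_atTop_iff.1 (hb.symm.tendsto_atTop hsqrt), ?_, ?_, ?_, ?_⟩
  · refine ((hn_equiv.inv.mul hk).mul hlog_equiv).symm.tendsto_nhds (hnu.congr' ?_)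
    filter_upwards [hpos] with n ⟨h1, h2, h3⟩
    simp only [Pi.mul_apply, Pi.inv_apply]
    have e : (n : ℝ)⁻¹ * (n : ℝ) ^ (1 / 2 : ℝ) = (n : ℝ) ^ (-(1 / 2) : ℝ) := by
      rw [← Real.rpow_neg_one, ← Real.rpow_add h1]
      norm_num
    rw [← e]
    ring
  · have h : Tendsto (fun n : ℕ => Real.log n ^ 2 * (u n ^ 2) ^ 2) atTop atTop :=
      ((tendsto_pow_atTop two_ne_zero).comp hlog).atTop_mul_atTop₀ ((tendsto_pow_atTop two_ne_zero).comp
        ((tendsto_pow_atTop two_ne_zero).comp hu))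
    refine (hn_equiv.inv.mul (hk.pow 2)).symm.tendsto_atTop (h.congr' ?_)
    filter_upwards [hpos] with n ⟨h1, h2, h3⟩
    simp only [Pi.mul_apply, Pi.inv_apply, Pi.pow_apply, mul_pow]
    rw [sq ((n : ℝ) ^ (1 / 2 : ℝ)), hsq]
    field_simp
  · have hlogb := hb.log hsqrt
    have h : Tendsto (fun n : ℕ => 2 * u n ^ 2) atTop atTop :=
      ((tendsto_pow_atTop two_ne_zero).comp hu).const_mul_atTop two_pos
    refine (((hb.mul hlogb).inv.mul hk)).symm.tendsto_atTop (h.congr' ?_)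
    filter_upwards [hpos] with n ⟨h1, h2, h3⟩
    simp only [Pi.mul_apply, Pi.inv_apply]
    rw [Real.log_rpow h1]
    have := Real.rpow_pos_of_pos h1 (1 / 2)
    field_simp
  · have h : Tendsto (fun n : ℕ => Real.log n ^ (-(1 / 2) : ℝ) * (u n)⁻¹) atTop (𝓝 0) := by
      simpa using ((tendsto_rpow_neg_atTop (y := 1 / 2) (by norm_num)).comp hlog).mul
        (tendsto_inv_atTop_zero.comp hu)
    have h0 : 0 ≤ fun n : ℕ => (n : ℝ) ^ (1 / 2 : ℝ) * Real.log n * u n ^ 2 := fun n => by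
      have := Real.log_natCast_nonneg n
      simp only [Pi.zero_apply]
      positivity
    have h0' : 0 ≤ fun n : ℕ => (n : ℝ) ^ (1 / 2 : ℝ) := fun n => by
      simp only [Pi.zero_apply]
      positivity
    refine ((hn_equiv.mul (hk.rpow h0 (r := -(1 / 2)))).mul
      (hb.rpow h0' (r := -(3 / 2)))).symm.tendsto_nhds (h.congr' ?_)
    filter_upwards [hpos] with n ⟨h1, h2, h3⟩
    simp only [Pi.mul_apply, Pi.pow_apply]
    have hs := Real.rpow_pos_of_pos h1 (1 / 2)
    rw [Real.mul_rpow (by positivity) (by positivity), Real.mul_rpow hs.le h2.le,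
      ← Real.rpow_natCast (u n) 2, ← Real.rpow_mul h3.le, ← Real.rpow_mul h1.le,
      ← Real.rpow_mul h1.le]
    -- The powers of `n` cancel exactly, as `1 - 1 / 4 - 3 / 4 = 0`; only the logarithm and `u`
    -- remain.
    have e : (n : ℝ) * (n : ℝ) ^ (1 / 2 * -(1 / 2) : ℝ) * (n : ℝ) ^ (1 / 2 * -(3 / 2) : ℝ) = 1 := by
      nth_rewrite 1 [← Real.rpow_one (n : ℝ)]
      rw [← Real.rpow_add h1, ← Real.rpow_add h1]
      norm_num
    norm_num [Real.rpow_neg_one] at e ⊢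
    linear_combination (-Real.log n ^ (-(1 / 2) : ℝ) * (u n)⁻¹) * e

end Example

end BoundaryEstimation

theorem corollary3
    (f : ℝ → ℝ) (hf : ContDiffOn ℝ 2 f (Set.Icc 0 1))
    (hf_pos : ∀ t ∈ Set.Icc (0 : ℝ) 1, 0 < f t)
    (hf_bdry : f 0 = f 1)
    (hf_bdry' : derivWithin f (Set.Icc 0 1) 0 = derivWithin f (Set.Icc 0 1) 1)
    (c : ℝ) (hc : 0 < c)
    {Ω : ℕ → Type*} [∀ n, MeasurableSpace (Ω n)]
    (P : (n : ℕ) → Measure (Ω n)) [∀ n, IsProbabilityMeasure (P n)]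
    (N : (n : ℕ) → Ω n → Multiset (ℝ × ℝ))
    (hN : ∀ n, BoundaryEstimation.IsPoissonProcess (P n)
      (BoundaryEstimation.intensity f c n) (N n))
    (p : ℕ) (x : Fin p → ℝ) (hx : ∀ j, x j ∈ Set.Icc (0 : ℝ) 1)
    (hx_inj : Function.Injective x) (hx_ends : ¬ ∃ i j, x i = 0 ∧ x j = 1) :
    (∀ k b : ℕ → ℕ, BoundaryEstimation.RateConditions k b →
      TendstoInDistribution
        (fun (n : ℕ) ω => BoundaryEstimation.normalizedError f c
          ((n : ℝ) * ((b n : ℝ) * (k n : ℝ)) ^ (-(1 / 2) : ℝ)) (k n) (b n) x (N n ω))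
        atTop id P (multivariateGaussian 0 (1 : Matrix (Fin p) (Fin p) ℝ))) ∧
    (∀ (u : ℕ → ℝ) (k b : ℕ → ℕ), Tendsto u atTop atTop →
      Tendsto (fun n : ℕ => (n : ℝ) ^ (-(1 / 2) : ℝ) * Real.log n ^ 2 * u n ^ 2) atTop (𝓝 0) →
      Asymptotics.IsEquivalent atTop (fun n => (b n : ℝ)) (fun n : ℕ => (n : ℝ) ^ (1 / 2 : ℝ)) →
      Asymptotics.IsEquivalent atTop (fun n => (k n : ℝ))
        (fun n : ℕ => (n : ℝ) ^ (1 / 2 : ℝ) * Real.log n * u n ^ 2) →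
      BoundaryEstimation.RateConditions k b ∧
      Asymptotics.IsEquivalent atTop
        (fun n : ℕ => (n : ℝ) * ((b n : ℝ) * (k n : ℝ)) ^ (-(1 / 2) : ℝ))
        (fun n : ℕ => (n : ℝ) ^ (1 / 2 : ℝ) * Real.log n ^ (-(1 / 2) : ℝ) * (u n)⁻¹) ∧
      TendstoInDistribution
        (fun (n : ℕ) ω => BoundaryEstimation.normalizedError f c
          ((n : ℝ) ^ (1 / 2 : ℝ) * Real.log n ^ (-(1 / 2) : ℝ) * (u n)⁻¹) (k n) (b n) x (N n ω))
        atTop id P (multivariateGaussian 0 (1 : Matrix (Fin p) (Fin p) ℝ))) := by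

  have hnorm : ∀ {k b : ℕ → ℕ}, BoundaryEstimation.RateConditions k b → ∀ᶠ n : ℕ in atTop,
      (n : ℝ) * ((b n : ℝ) * (k n : ℝ)) ^ (-(1 / 2) : ℝ) = n / √(b n * k n) ∧
        (n : ℝ) / √(b n * k n) ≠ 0 := by
    intro k b H
    filter_upwards [H.tendsto_b_real.eventually_gt_atTop 0, H.tendsto_k.eventually_gt_atTop 0,
      eventually_gt_atTop 0] with n hb hk hn
    rw [Real.rpow_neg (by positivity), ← Real.sqrt_eq_rpow, div_eq_mul_inv]
    exact ⟨rfl, by positivity⟩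
  refine ⟨fun k b H => ?_, fun u k b hu hnu hb hk => ?_⟩
  · refine H.tendstoInDistribution_normalizedError hf hf_pos hf_bdry hf_bdry' hc hN hx hx_inj
      hx_ends (tendsto_const_nhds.congr' ?_)
    filter_upwards [hnorm H] with n h
    rw [h.1, mul_div_assoc, ← inv_div (n : ℝ), mul_inv_cancel₀ h.2]
  · have H := BoundaryEstimation.rateConditions_of_isEquivalent hu hnu hb hk
    have hv := BoundaryEstimation.isEquivalent_normalization hu hb hk
    refine ⟨H, hv, H.tendstoInDistribution_normalizedError hf hf_pos hf_bdry hf_bdry' hc hN hx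
      hx_inj hx_ends ?_⟩
    -- The quantity `v √(b k) / n` is the ratio of the simplified normalization to the exact one,
    -- eventually nonzero by `hnorm`.
    refine ((Asymptotics.isEquivalent_iff_tendsto_one ?_).1 hv.symm).congr' ?_
    · filter_upwards [hnorm H] with n h
      rw [h.1]
      exact h.2
    · filter_upwards [hnorm H] with n h
      rw [Pi.div_apply, h.1, div_div_eq_mul_div]
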